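/- Let $k$ be a field of characteristic $2$, let $E$ be an elementary abelian $2$-group of rank $r\ge 0$ with generators $g_1,\dots,g_r$, and let $kE$ be its group algebra. Put $z_i=g_i-1\in kE$, so that $z_i^2=0$ (and $kE=k[z_1,\dots,z_r]/(z_1^2,\dots,z_r^2)$). Let $S=k[x_1,\dots,x_r]$ be the polynomial algebra graded by $|x_i|=1$, regarded as a differential graded (DG) algebra with zero differential. Let $J=kE\otimes_k S$ be the complex of $kE$-modules with $J^n=kE\otimes_k S^n$ (so $J^n=0$ for $n<0$) and with differential $d(e)=\delta e$, where $\delta=\sum_{i=1}^r z_i\otimes x_i$; note that $\delta^2=0$. For a complex $M$ of $kE$-modules let $\operatorname{Hom}_{kE}(J,M)$ be the Hom complex, with degree $n$ component $\prod_{p}\operatorname{Hom}_{kE}(J^p,M^{p+n})$ and differential $d(f)=d\circ f-(-1)^{|f|}f\circ d$. It is a DG $S$-module via $(sf)(e)=f((1\otimes s)e)$. Let $$\zeta\colon S\longrightarrow \operatorname{Hom}_{kE}(J,J)=\operatorname{End}_{kE}(J)$$ be the morphism of DG algebras that sends $s\in S$ to multiplication by $1\otimes s$. Let $\mathsf K(\operatorname{Inj}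 kE)$ be the homotopy category of complexes of injective $kE$-modules, and let $\mathsf D(S)$ be the derived category of DG $S$-modules, that is, the homotopy category of DG $S$-modules with the quasi-isomorphisms inverted. Then $\zeta$ is a quasi-isomorphism, and the functor $$\operatorname{Hom}_{kE}(J,-)\colon \mathsf K(\operatorname{Inj} kE)\longrightarrow \mathsf D(S)$$ is an equivalence of triangulated categories (that is, it is an exact functor of triangulated categories and an equivalence of categories). -/

import Mathlib

universe u

noncomputable section

open CategoryTheory CategoryTheory.Limits CategoryTheory.Pretriangulated
open CochainComplex.HomComplex
open scoped TensorProduct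

/-- A differential graded algebra over `k` (cohomological grading by `ℤ`, differential of
degree `1`): a cochain complex of `k`-modules with a unital associative product satisfying
`d(ab) = d(a) b + (-1)^|a| a d(b)`. -/
structure DGAlgebra (k : Type u) [Field k] where
  X : CochainComplex (ModuleCat.{u} k) ℤ
  one : X.X 0
  mul {p q n : ℤ} (h : p + q = n) : X.X p →ₗ[k] X.X q →ₗ[k] X.X n
  one_mul {n : ℤ} (a : X.X n) : mul (zero_add n) one a = a
  mul_one {n : ℤ} (a : X.X n) : mul (add_zero n) a one = a
  mul_assoc {p q r pq qr n : ℤ} (hpq : p + q = pq) (hqr : q + r = qr) (h : pq + r = n)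
    (h' : p + qr = n) (a : X.X p) (b : X.X q) (c : X.X r) :
    mul h (mul hpq a b) c = mul h' a (mul hqr b c)
  leibniz {p q n : ℤ} (h : p + q = n) (a : X.X p) (b : X.X q) :
    X.d n (n + 1) (mul h a b) =
      mul (by omega : (p + 1) + q = n + 1) (X.d p (p + 1) a) b +
        p.negOnePow • mul (by omega : p + (q + 1) = n + 1) a (X.d q (q + 1) b)

namespace DGAlgebra

variable {k : Type u} [Field k]

/-- A morphism of differential graded algebras. -/
@[ext]
structure Hom (A B : DGAlgebra k) where
  hom : A.X ⟶ B.X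
  map_one : hom.f 0 A.one = B.one
  map_mul {p q n : ℤ} (h : p + q = n) (a : A.X.X p) (b : A.X.X q) :
    hom.f n (A.mul h a b) = B.mul h (hom.f p a) (hom.f q b)

end DGAlgebra

section HomComplex

variable (k : Type u) [Field k] {C : Type*} [Category.{u} C] [Preadditive C] [Linear k C]

/-- The complex of `k`-modules `Hom(F, G)`: in degree `n` it is `∏ₚ Hom(F^p, G^(p+n))` and
the differential is `d(f) = d ∘ f - (-1)^|f| f ∘ d`. -/
def homComplex (F G : CochainComplex C ℤ) : CochainComplex (ModuleCat.{u} k) ℤ where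
  X n := ModuleCat.of k (Cochain F G n)
  d n m := ModuleCat.ofHom (δ_hom k F G n m)
  shape n m h := by
    exact ModuleCat.hom_ext (LinearMap.ext fun z => δ_shape n m h z)
  d_comp_d' a b c _ _ := by
    exact ModuleCat.hom_ext (LinearMap.ext fun z => δ_δ a b c z)

/-- The differential graded algebra `End(F)`, with product `f g = f ∘ g`. -/
def endDGAlgebra (F : CochainComplex C ℤ) : DGAlgebra k where
  X := homComplex k F F
  one := (Cochain.ofHom (𝟙 F) : Cochain F F 0)
  mul {p q n} h := LinearMap.mk₂ k
    (fun (f : Cochain F F p) (g : Cochain F F q) =>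
      (g.comp f ((add_comm q p).trans h) : Cochain F F n))
    (fun _ _ _ => Cochain.comp_add _ _ _ _) (fun _ _ _ => Cochain.comp_smul _ _ _ _)
    (fun _ _ _ => Cochain.add_comp _ _ _ _) (fun _ _ _ => Cochain.smul_comp _ _ _ _)
  one_mul a := Cochain.comp_id (show Cochain F F _ from a)
  mul_one a := Cochain.id_comp (show Cochain F F _ from a)
  mul_assoc {p q r pq qr n} hpq hqr h h' a b c :=
    (Cochain.comp_assoc (show Cochain F F r from c) (show Cochain F F q from b)
      (show Cochain F F p from a) (by omega) (by omega) (by omega)).symm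
  leibniz {p q n} h a b :=
    (δ_comp (show Cochain F F q from b) (show Cochain F F p from a) (by omega)
      (q + 1) (p + 1) (n + 1) rfl rfl rfl)

end HomComplex

/-- A (left) differential graded module over a differential graded algebra `A`: a complex of
`k`-modules `X` together with an action of `A`. An element `a` of degree `p` acts by the
`k`-linear map `act p a` of degree `p`, whose component `X^q ⟶ X^n`, for `q + p = n`, is
`m ↦ a m`. The axiom `leibniz` says that `d(a m) - (-1)^|a| a d(m) = d(a) m`. -/
structure DGModule {k : Type u} [Field k] (A : DGAlgebra k) where
  X : CochainComplex (ModuleCat.{u} k) ℤ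
  act (p : ℤ) : A.X.X p →ₗ[k] Cochain X X p
  act_one : act 0 A.one = Cochain.ofHom (𝟙 X)
  act_mul {p q n : ℤ} (h : p + q = n) (a : A.X.X p) (b : A.X.X q) :
    act n (A.mul h a b) = (act q b).comp (act p a) ((add_comm q p).trans h)
  leibniz {p : ℤ} (a : A.X.X p) : δ p (p + 1) (act p a) = act (p + 1) (A.X.d p (p + 1) a)

namespace DGModule

variable {k : Type u} [Field k] {A : DGAlgebra k}

/-- A homogeneous map `z` of degree `n` between differential graded `A`-modules is `A`-linear
if `z(a m) = (-1)^(n |a|) a z(m)`. -/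
def IsLinear (M N : DGModule A) {n : ℤ} (z : Cochain M.X N.X n) : Prop :=
  ∀ (p m : ℤ) (h : p + n = m) (a : A.X.X p),
    (M.act p a).comp z h = (n * p).negOnePow • z.comp (N.act p a) ((add_comm n p).trans h)

/-- A morphism of differential graded modules: an `A`-linear morphism of complexes. -/
@[ext]
structure Hom (M N : DGModule A) where
  hom : M.X ⟶ N.X
  linear : IsLinear M N (Cochain.ofHom hom)

namespace IsLinear

variable {M N P : DGModule A}

lemma zero (n : ℤ) : IsLinear M N (0 : Cochain M.X N.X n) := by
  intro p m h a
  simp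

lemma add {n : ℤ} {z z' : Cochain M.X N.X n} (hz : IsLinear M N z) (hz' : IsLinear M N z') :
    IsLinear M N (z + z') := by
  intro p m h a
  simp [hz p m h a, hz' p m h a]

lemma neg {n : ℤ} {z : Cochain M.X N.X n} (hz : IsLinear M N z) : IsLinear M N (-z) := by
  intro p m h a
  simp [hz p m h a]

lemma units_smul {n : ℤ} (c : ℤˣ) {z : Cochain M.X N.X n} (hz : IsLinear M N z) :
    IsLinear M N (c • z) := by
  intro p m h a
  simp [hz p m h a, Cochain.comp_units_smul, Cochain.units_smul_comp, smul_smul, mul_comm]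

lemma comp {n₁ n₂ n₁₂ : ℤ} {z₁ : Cochain M.X N.X n₁} {z₂ : Cochain N.X P.X n₂}
    (h₁ : IsLinear M N z₁) (h₂ : IsLinear N P z₂) (h : n₁ + n₂ = n₁₂) :
    IsLinear M P (z₁.comp z₂ h) := by
  intro p m hm a
  rw [← Cochain.comp_assoc (M.act p a) z₁ z₂ rfl h (by omega), h₁ p _ rfl a,
    Cochain.units_smul_comp, Cochain.comp_assoc z₁ (N.act p a) z₂ (by omega) rfl (by omega),
    h₂ p _ rfl a, Cochain.comp_units_smul,
    Cochain.comp_assoc z₁ z₂ (P.act p a) h (by omega : _ = p + n₂) (by omega), smul_smul,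
    ← Int.negOnePow_add]
  congr 2
  rw [← h]; ring

lemma id (M : DGModule A) : IsLinear M M (Cochain.ofHom (𝟙 M.X)) := by
  intro p m h a
  obtain rfl : m = p := by omega
  simp

end IsLinear

instance : Category (DGModule A) where
  Hom M N := Hom M N
  id M := ⟨𝟙 M.X, IsLinear.id M⟩
  comp {M N P} f g := ⟨f.hom ≫ g.hom, by
    rw [Cochain.ofHom_comp]
    exact f.linear.comp g.linear _⟩
  id_comp f := Hom.ext (Category.id_comp f.hom)
  comp_id f := Hom.ext (Category.comp_id f.hom)
  assoc f g h := Hom.ext (Category.assoc f.hom g.hom h.hom)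

@[ext]
lemma hom_ext {M N : DGModule A} {f g : M ⟶ N} (h : f.hom = g.hom) : f = g := Hom.ext h

@[simp]
lemma id_hom (M : DGModule A) : Hom.hom (𝟙 M) = 𝟙 M.X := rfl

@[simp]
lemma comp_hom {M N P : DGModule A} (f : M ⟶ N) (g : N ⟶ P) :
    (f ≫ g).hom = f.hom ≫ g.hom := rfl

section Preadditive

variable {M N : DGModule A}

instance : Zero (M ⟶ N) := ⟨⟨0, by rw [Cochain.ofHom_zero]; exact .zero 0⟩⟩
instance : Add (M ⟶ N) :=
  ⟨fun f g => ⟨f.hom + g.hom, by rw [Cochain.ofHom_add]; exact f.linear.add g.linear⟩⟩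
instance : Neg (M ⟶ N) := ⟨fun f => ⟨-f.hom, by rw [Cochain.ofHom_neg]; exact f.linear.neg⟩⟩
instance : AddCommGroup (M ⟶ N) where
  add_assoc f g h := hom_ext (add_assoc f.hom g.hom h.hom)
  zero_add f := hom_ext (zero_add f.hom)
  add_zero f := hom_ext (add_zero f.hom)
  neg_add_cancel f := hom_ext (neg_add_cancel f.hom)
  add_comm f g := hom_ext (add_comm f.hom g.hom)
  nsmul := nsmulRec
  zsmul := zsmulRec

instance : Preadditive (DGModule A) where
  add_comp _ _ _ f g h := hom_ext (Preadditive.add_comp _ _ _ f.hom g.hom h.hom)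
  comp_add _ _ _ f g h := hom_ext (Preadditive.comp_add _ _ _ f.hom g.hom h.hom)

@[simp] lemma zero_hom : Hom.hom (0 : M ⟶ N) = 0 := rfl
@[simp] lemma add_hom (f g : M ⟶ N) : (f + g).hom = f.hom + g.hom := rfl
@[simp] lemma neg_hom (f : M ⟶ N) : (-f).hom = -f.hom := rfl

end Preadditive

variable (A) in
/-- The functor which sends a differential graded module to the underlying complex. -/
@[simps]
def forget : DGModule A ⥤ CochainComplex (ModuleCat.{u} k) ℤ where
  obj M := M.X
  map f := f.hom

instance : (forget A).Additive where

instance : (forget A).Faithful where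
  map_injective h := hom_ext h

/-- An isomorphism of differential graded modules, constructed from an isomorphism of
complexes which is `A`-linear. -/
@[simps]
def isoMk {M N : DGModule A} (e : M.X ≅ N.X) (h : IsLinear M N (Cochain.ofHom e.hom)) :
    M ≅ N where
  hom := ⟨e.hom, h⟩
  inv := ⟨e.inv, by
    intro p m hm a
    obtain rfl : m = p := by omega
    have h1 := h m m (add_zero m) a
    simp only [zero_mul, Int.negOnePow_zero, one_smul] at h1 ⊢
    have e1 : (Cochain.ofHom e.inv).comp (Cochain.ofHom e.hom) (zero_add 0) =
      Cochain.ofHom (𝟙 _) := by rw [← Cochain.ofHom_comp, e.inv_hom_id]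
    have e2 : (Cochain.ofHom e.hom).comp (Cochain.ofHom e.inv) (zero_add 0) =
      Cochain.ofHom (𝟙 _) := by rw [← Cochain.ofHom_comp, e.hom_inv_id]
    calc (N.act m a).comp (Cochain.ofHom e.inv) hm
        = ((Cochain.ofHom e.inv).comp ((Cochain.ofHom e.hom).comp (N.act m a)
            (zero_add m)) (zero_add m)).comp (Cochain.ofHom e.inv) hm := by
          rw [← Cochain.comp_assoc_of_first_is_zero_cochain, e1, Cochain.id_comp]
      _ = (Cochain.ofHom e.inv).comp (M.act m a) (zero_add m) := by
          rw [← h1, Cochain.comp_assoc_of_first_is_zero_cochain,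
            Cochain.comp_assoc_of_third_is_zero_cochain, e2, Cochain.comp_id]⟩
  hom_inv_id := hom_ext e.hom_inv_id
  inv_hom_id := hom_ext e.inv_hom_id

end DGModule

namespace DGModule

variable {k : Type u} [Field k] {A : DGAlgebra k}

section Shift

lemma cochain_shift_comp {C : Type*} [Category C] [Preadditive C] {F G K : CochainComplex C ℤ}
    {n₁ n₂ n₁₂ : ℤ} (z₁ : Cochain F G n₁) (z₂ : Cochain G K n₂) (h : n₁ + n₂ = n₁₂) (a : ℤ) :
    (z₁.comp z₂ h).shift a = (z₁.shift a).comp (z₂.shift a) h := by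
  ext i j hij
  rw [Cochain.shift_v', Cochain.comp_v z₁ z₂ h (i + a) (i + n₁ + a) (j + a) (by omega) (by omega),
    Cochain.comp_v _ _ h i (i + n₁) j rfl (by omega), Cochain.shift_v', Cochain.shift_v']
  rfl

/-- The shift `M⟦n⟧`: the complex `X⟦n⟧`, on which `a` acts by `(-1)^(n |a|) a`. -/
@[simps]
abbrev shiftObj (M : DGModule A) (n : ℤ) : DGModule A where
  X := M.X⟦n⟧
  act p :=
    { toFun := fun a => (n * p).negOnePow • (M.act p a).shift n
      map_add' := fun a b => by simp [Cochain.shift_add]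
      map_smul' := fun c a => by
        rw [map_smul, Cochain.shift_smul, RingHom.id_apply]
        exact (smul_comm c _ _).symm }
  act_one := by
    ext p
    simp [M.act_one, Cochain.shift_v']
  act_mul {p q r} h a b := by
    simp only [LinearMap.coe_mk, AddHom.coe_mk, M.act_mul h]
    rw [Cochain.comp_units_smul, Cochain.units_smul_comp, smul_smul, ← Int.negOnePow_add]
    congr 1
    · rw [← h]; ring_nf
    · exact cochain_shift_comp _ _ _ n
  leibniz {p} a := by
    simp only [LinearMap.coe_mk, AddHom.coe_mk, δ_units_smul, Cochain.δ_shift, M.leibniz,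
      smul_smul, ← Int.negOnePow_add]
    congr 2
    ring

lemma shiftObj_act (M : DGModule A) (n p : ℤ) (a : A.X.X p) :
    (M.shiftObj n).act p a = (n * p).negOnePow • (M.act p a).shift n := rfl

lemma IsLinear.shift {M N : DGModule A} {n : ℤ} {z : Cochain M.X N.X n} (hz : IsLinear M N z)
    (a : ℤ) : IsLinear (M.shiftObj a) (N.shiftObj a) (z.shift a) := by
  intro p m h x
  have e := congr_arg (fun y => Cochain.shift y a) (hz p m h x)
  rw [cochain_shift_comp, Cochain.shift_units_smul, cochain_shift_comp] at e
  rw [shiftObj_act, shiftObj_act, Cochain.units_smul_comp, Cochain.comp_units_smul, e,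
    smul_smul, smul_smul, mul_comm]

@[simp]
lemma cochain_shift_ofHom {C : Type*} [Category C] [Preadditive C] {F G : CochainComplex C ℤ}
    (f : F ⟶ G) (a : ℤ) : (Cochain.ofHom f).shift a = Cochain.ofHom (f⟦a⟧') := by
  ext p
  rw [Cochain.shift_v', Cochain.ofHom_v, Cochain.ofHom_v]
  rfl

variable (A) in
/-- The shift functor `M ↦ M⟦n⟧` on differential graded modules. -/
abbrev shiftFun (n : ℤ) : DGModule A ⥤ DGModule A where
  obj M := M.shiftObj n
  map f := ⟨f.hom⟦n⟧', by
    rw [← cochain_shift_ofHom]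
    exact f.linear.shift n⟩
  map_id M := hom_ext ((shiftFunctor (CochainComplex (ModuleCat.{u} k) ℤ) n).map_id M.X)
  map_comp f g :=
    hom_ext ((shiftFunctor (CochainComplex (ModuleCat.{u} k) ℤ) n).map_comp f.hom g.hom)

lemma cochain_v_comp_XIsoOfEq {C : Type*} [Category C] [Preadditive C]
    {F G : CochainComplex C ℤ} {n : ℤ} (z : Cochain F G n) (i i' j j' : ℤ) (h : i + n = j)
    (h' : i' + n = j') (hi : i = i') (hj : j = j') :
    z.v i j h ≫ (G.XIsoOfEq hj).hom = (F.XIsoOfEq hi).hom ≫ z.v i' j' h' := by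
  subst hi hj
  simp

variable (A) in
/-- The shift by `0` is the identity. -/
abbrev shiftFunZero : shiftFun A 0 ≅ 𝟭 (DGModule A) :=
  NatIso.ofComponents (fun M => isoMk
    ((shiftFunctorZero (CochainComplex (ModuleCat.{u} k) ℤ) ℤ).app M.X) (by
      intro p m h a
      obtain rfl : m = p := by omega
      refine Cochain.ext _ _ fun i j hij => ?_
      simp only [Cochain.comp_zero_cochain_v, Cochain.zero_cochain_comp_v, Cochain.ofHom_v,
        zero_mul, Int.negOnePow_zero, one_smul, CochainComplex.shiftFunctorZero_hom_app_f,
        Iso.app_hom]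
      exact cochain_v_comp_XIsoOfEq (M.act m a) (i + 0) i (j + 0) j (by omega) hij
        (by omega) (by omega)))
    (fun f => hom_ext ((shiftFunctorZero _ ℤ).hom.naturality f.hom))

variable (A) in
/-- The shift by `a + b` is the composition of the shifts by `a` and `b`. -/
abbrev shiftFunAdd (a b : ℤ) : shiftFun A (a + b) ≅ shiftFun A a ⋙ shiftFun A b :=
  NatIso.ofComponents (fun M => isoMk
    ((shiftFunctorAdd (CochainComplex (ModuleCat.{u} k) ℤ) a b).app M.X) (by
      intro p m h x
      obtain rfl : m = p := by omega
      refine Cochain.ext _ _ fun i j hij => ?_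
      simp only [Cochain.comp_zero_cochain_v, Cochain.zero_cochain_comp_v, Cochain.ofHom_v,
        zero_mul, Int.negOnePow_zero, one_smul, CochainComplex.shiftFunctorAdd_hom_app_f,
        Iso.app_hom]
      change (((a + b) * m).negOnePow • ((M.act m x).shift (a + b))).v i j hij ≫ _ =
        _ ≫ ((b * m).negOnePow • ((a * m).negOnePow • (M.act m x).shift a).shift b).v i j hij
      rw [Cochain.shift_units_smul, smul_smul, ← Int.negOnePow_add, ← add_mul, add_comm b a,
        Cochain.units_smul_v, Cochain.units_smul_v]
      have key := cochain_v_comp_XIsoOfEq (M.act m x) (i + (a + b)) (i + b + a) (j + (a + b))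
        (j + b + a) (by omega) (by omega) (by omega) (by omega)
      exact (Linear.units_smul_comp _ _ _).trans ((congrArg _ key).trans
        (Linear.comp_units_smul _ _ _).symm)))
    (fun f => hom_ext ((shiftFunctorAdd _ a b).hom.naturality f.hom))

instance : HasShift (DGModule A) ℤ := hasShiftMk _ _
  { F := shiftFun A
    zero := shiftFunZero A
    add := shiftFunAdd A
    assoc_hom_app := fun a b c M => by
      apply (forget A).map_injective
      simp only [Functor.map_comp, eqToHom_map]
      have := shiftFunctorAdd_assoc_hom_app a b c M.X
      simp [shiftFunctorAdd'] at this
      exact this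
    zero_add_hom_app := fun n M => by
      apply (forget A).map_injective
      simp only [Functor.map_comp, eqToHom_map]
      exact shiftFunctorAdd_zero_add_hom_app n M.X
    add_zero_hom_app := fun n M => by
      apply (forget A).map_injective
      simp only [Functor.map_comp, eqToHom_map]
      exact shiftFunctorAdd_add_zero_hom_app n M.X }

end Shift

end DGModule

namespace DGModule

variable {k : Type u} [Field k] {A : DGAlgebra k}

instance : (forget A).CommShift ℤ where
  commShiftIso n := NatIso.ofComponents (fun M => Iso.refl (M.X⟦n⟧))
    (fun f => (Category.comp_id _).trans (Category.id_comp (f.hom⟦n⟧')).symm)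
  commShiftIso_zero := by
    ext1
    ext1
    ext1 M
    rw [Functor.CommShift.isoZero_hom_app]
    exact ((shiftFunctorZero (CochainComplex (ModuleCat.{u} k) ℤ) ℤ).hom_inv_id_app M.X).symm
  commShiftIso_add a b := by
    ext1
    ext1
    ext1 M
    rw [Functor.CommShift.isoAdd_hom_app]
    simp
    exact ((shiftFunctorAdd (CochainComplex (ModuleCat.{u} k) ℤ) a b).hom_inv_id_app M.X).symm

instance (n : ℤ) : (shiftFunctor (DGModule A) n).Additive where
  map_add {_ _ f g} := hom_ext
    ((shiftFunctor (CochainComplex (ModuleCat.{u} k) ℤ) n).map_add (f := f.hom) (g := g.hom))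

section Cone

open CochainComplex.mappingCone

variable {M N : DGModule A} (f : M ⟶ N)

/-- The action on the mapping cone `N ⊕ M⟦1⟧` of a morphism `f : M ⟶ N`. -/
def coneAct (p : ℤ) (a : A.X.X p) :
    Cochain (CochainComplex.mappingCone f.hom) (CochainComplex.mappingCone f.hom) p :=
  descCochain f.hom (p.negOnePow • (M.act p a).comp (inl f.hom) (sub_eq_add_neg p 1).symm)
    ((N.act p a).comp (Cochain.ofHom (inr f.hom)) (add_zero p)) (sub_add_cancel p 1)

lemma inl_coneAct (p : ℤ) (a : A.X.X p) (q : ℤ) (hq : -1 + p = q) :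
    (inl f.hom).comp (coneAct f p a) hq =
      p.negOnePow • (M.act p a).comp (inl f.hom) ((add_comm p (-1)).trans hq) := by
  obtain rfl : q = p - 1 := by omega
  exact inl_descCochain _ _ _ _

lemma inr_coneAct (p : ℤ) (a : A.X.X p) :
    (Cochain.ofHom (inr f.hom)).comp (coneAct f p a) (zero_add p) =
      (N.act p a).comp (Cochain.ofHom (inr f.hom)) (add_zero p) :=
  inr_descCochain _ _ _ _

/-- The mapping cone of a morphism of differential graded modules. -/
@[simps]
abbrev cone : DGModule A where
  X := CochainComplex.mappingCone f.hom
  act p :=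
    { toFun := coneAct f p
      map_add' := fun a b => by
        rw [ext_cochain_from_iff f.hom (p - 1) p (by omega)]
        simp [inl_coneAct, inr_coneAct, Cochain.comp_add, Cochain.add_comp]
      map_smul' := fun c a => by
        rw [ext_cochain_from_iff f.hom (p - 1) p (by omega)]
        simp only [inl_coneAct, inr_coneAct, Cochain.comp_smul, Cochain.smul_comp, map_smul,
          RingHom.id_apply, and_true]
        exact (smul_comm c _ _).symm }
  act_one := by
    rw [ext_cochain_from_iff f.hom (-1) 0 (by omega)]
    simp [inl_coneAct, inr_coneAct, act_one]
  act_mul {p q n} h a b := by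
    rw [ext_cochain_from_iff f.hom (n - 1) n (by omega)]
    simp only [LinearMap.coe_mk, AddHom.coe_mk]
    constructor
    · rw [inl_coneAct, M.act_mul h,
        ← Cochain.comp_assoc (inl f.hom) (coneAct f q b) (coneAct f p a) rfl (by omega) (by omega),
        inl_coneAct, Cochain.units_smul_comp,
        Cochain.comp_assoc (M.act q b) (inl f.hom) (coneAct f p a) (by omega) rfl (by omega),
        inl_coneAct, Cochain.comp_units_smul, smul_smul, ← Int.negOnePow_add,
        Cochain.comp_assoc (M.act q b) (M.act p a) (inl f.hom) (by omega)
          (add_comm p (-1)) (by omega)]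
      congr 2
      omega
    · rw [inr_coneAct, N.act_mul h, ← Cochain.comp_assoc_of_first_is_zero_cochain, inr_coneAct,
        Cochain.comp_assoc_of_second_is_zero_cochain, inr_coneAct,
        Cochain.comp_assoc_of_third_is_zero_cochain]
  leibniz {p} a := by
    have hf := f.linear p p (add_zero p) a
    rw [zero_mul, Int.negOnePow_zero, one_smul] at hf
    change δ p (p + 1) (coneAct f p a) = coneAct f (p + 1) (A.X.d p (p + 1) a)
    rw [show δ p (p + 1) (coneAct f p a) = _ from δ_descCochain _ _ _ _ (p + 1) rfl,
      ext_cochain_from_iff f.hom p (p + 1) rfl]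
    constructor
    · rw [inl_coneAct, Cochain.comp_add, inl_fst_assoc, inl_snd_assoc, add_zero, δ_units_smul]
      rw [δ_comp (M.act p a) (inl f.hom) (sub_eq_add_neg p 1).symm (p + 1) 0 p (by omega) rfl
        (by omega), δ_inl, M.leibniz, Cochain.ofHom_comp,
        ← Cochain.comp_assoc_of_first_is_zero_cochain, ← hf,
        Cochain.comp_assoc_of_second_is_zero_cochain]
      simp [Int.negOnePow_succ, Int.negOnePow_neg]
    · rw [inr_coneAct, Cochain.comp_add, inr_fst_assoc, inr_snd_assoc, zero_add,
        δ_comp_zero_cochain _ _ _ rfl, N.leibniz, δ_ofHom]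
      simp

lemma inl_linear : IsLinear M (cone f) (inl f.hom) := by
  intro p m h a
  change _ = _ • (inl f.hom).comp (coneAct f p a) _
  rw [inl_coneAct, smul_smul, ← Int.negOnePow_add]
  simp

/-- The inclusion `N ⟶ cone f`. -/
abbrev coneInr : N ⟶ cone f where
  hom := inr f.hom
  linear := by
    intro p m h a
    obtain rfl : m = p := by omega
    change _ = _ • (Cochain.ofHom (inr f.hom)).comp (coneAct f m a) _
    rw [inr_coneAct]
    simp

lemma fst_linear : IsLinear (cone f) M (fst f.hom).1 := by
  intro p m h a
  obtain rfl := h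
  change (coneAct f p a).comp _ _ = _
  rw [ext_cochain_from_iff f.hom p (p + 1) rfl]
  constructor
  · rw [← Cochain.comp_assoc (inl f.hom) (coneAct f p a) (fst f.hom).1 rfl (by omega) (by omega),
      inl_coneAct, Cochain.units_smul_comp, Cochain.comp_units_smul, inl_fst_assoc,
      Cochain.comp_assoc (M.act p a) (inl f.hom) (fst f.hom).1 (n₁₂ := -1 + p) (by omega)
        (neg_add_cancel 1) (by omega), inl_fst]
    simp
  · rw [← Cochain.comp_assoc_of_first_is_zero_cochain, inr_coneAct,
      Cochain.comp_units_smul, inr_fst_assoc, Cochain.comp_assoc_of_second_is_zero_cochain]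
    simp

lemma snd_linear : IsLinear (cone f) N (snd f.hom) := by
  intro p m h a
  obtain rfl : m = p := by omega
  change (coneAct f m a).comp _ _ = _
  rw [ext_cochain_from_iff f.hom (m - 1) m (by omega)]
  constructor
  · rw [← Cochain.comp_assoc_of_third_is_zero_cochain, inl_coneAct, Cochain.units_smul_comp,
      Cochain.comp_units_smul, inl_snd_assoc, Cochain.comp_assoc_of_third_is_zero_cochain]
    simp
  · rw [← Cochain.comp_assoc_of_first_is_zero_cochain, inr_coneAct,
      Cochain.comp_units_smul, inr_snd_assoc, Cochain.comp_assoc_of_second_is_zero_cochain]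
    simp

variable {f} in
lemma IsLinear.descCochain {P : DGModule A} {m n : ℤ} {α : Cochain M.X P.X m}
    {β : Cochain N.X P.X n} (hα : IsLinear M P α) (hβ : IsLinear N P β) (h : m + 1 = n) :
    IsLinear (cone f) P (CochainComplex.mappingCone.descCochain f.hom α β h) :=
  ((fst_linear f).comp hα _).add ((snd_linear f).comp hβ _)

variable {f} in
lemma IsLinear.liftCochain {P : DGModule A} {m n : ℤ} {α : Cochain P.X M.X m}
    {β : Cochain P.X N.X n} (hα : IsLinear P M α) (hβ : IsLinear P N β) (h : n + 1 = m) :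
    IsLinear P (cone f) (CochainComplex.mappingCone.liftCochain f.hom α β h) :=
  (hα.comp (inl_linear f) _).add (hβ.comp (coneInr f).linear _)

end Cone

end DGModule

namespace DGModule

variable {k : Type u} [Field k] {A : DGAlgebra k}

section ShiftLinear

lemma smul_aux₁ {C : Type*} [Category C] [Preadditive C] {X Y Z V W : C} (α : X ⟶ Y) (ζ : Y ⟶ Z)
    (ζ' : X ⟶ W) (β : W ⟶ Z) (e : V ≅ W) (s t r : ℤˣ) (h : α ≫ ζ = s • ζ' ≫ β) (hs : s = r * t) :
    α ≫ ζ ≫ 𝟙 Z = r • (ζ' ≫ e.inv) ≫ (t • e.hom ≫ β ≫ 𝟙 Z) := by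
  simp [h, hs, smul_smul]

lemma smul_aux₂ {C : Type*} [Category C] [Preadditive C] {X Y Z W : C} (α : X ⟶ Y) (ζ : Y ⟶ Z)
    (ζ' : X ⟶ W) (β : W ⟶ Z) (s t r c : ℤˣ) (h : α ≫ ζ = s • ζ' ≫ β) (hs : t * s = r) :
    (t • α) ≫ (c • 𝟙 Y ≫ ζ) = r • (c • 𝟙 X ≫ ζ') ≫ β := by
  simp only [Linear.units_smul_comp, Linear.comp_units_smul, Category.id_comp, h, ← hs, smul_smul]
  congr 1
  rw [mul_comm, mul_assoc]

variable {M N : DGModule A}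

lemma IsLinear.rightShift {n : ℤ} {z : Cochain M.X N.X n} (hz : IsLinear M N z) (a n' : ℤ)
    (hn' : n' + a = n) : IsLinear M (N.shiftObj a) (z.rightShift a n' hn') := by
  intro p m h x
  rw [shiftObj_act]
  refine Cochain.ext _ _ fun i j hij => ?_
  have e := Cochain.congr_v (hz p (p + n) rfl x) i (j + a) (by omega)
  rw [Cochain.comp_v _ _ rfl i (i + p) (j + a) rfl (by omega), Cochain.units_smul_v,
    Cochain.comp_v _ _ (add_comm n p) i (i + n) (j + a) rfl (by omega)] at e
  rw [Cochain.comp_v _ _ h i (i + p) j rfl (by omega),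
    Cochain.rightShift_v z a n' hn' (i + p) j (by omega) (j + a) (by omega)]
  rw [Cochain.units_smul_v, Cochain.comp_v _ _ ((add_comm n' p).trans h) i (i + n') j rfl
    (by omega), Cochain.rightShift_v z a n' hn' i (i + n') rfl (i + n) (by omega),
    Cochain.units_smul_v,
    Cochain.shift_v _ a (i + n') j (by omega) (i + n) (j + a) (by omega) rfl]
  refine smul_aux₁ _ _ _ _ _ _ _ _ e ?_
  rw [← Int.negOnePow_add, ← hn']
  ring_nf

lemma IsLinear.leftShift {n : ℤ} {z : Cochain M.X N.X n} (hz : IsLinear M N z) (a n' : ℤ)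
    (hn' : n + a = n') : IsLinear (M.shiftObj a) N (z.leftShift a n' hn') := by
  intro p m h x
  rw [shiftObj_act]
  refine Cochain.ext _ _ fun i j hij => ?_
  have e := Cochain.congr_v (hz p (p + n) rfl x) (i + a) j (by omega)
  rw [Cochain.comp_v _ _ rfl (i + a) (i + p + a) j (by omega) (by omega), Cochain.units_smul_v,
    Cochain.comp_v _ _ (add_comm n p) (i + a) (i + n') j (by omega) (by omega)] at e
  rw [Cochain.comp_v _ _ h i (i + p) j rfl (by omega), Cochain.units_smul_v, Cochain.units_smul_v,
    Cochain.comp_v _ _ ((add_comm n' p).trans h) i (i + n') j rfl (by omega),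
    Cochain.shift_v', Cochain.leftShift_v z a n' hn' (i + p) j (by omega) (i + p + a) (by omega),
    Cochain.leftShift_v z a n' hn' i (i + n') rfl (i + a) (by omega)]
  refine smul_aux₂ _ _ _ _ _ _ _ _ e ?_
  rw [← Int.negOnePow_add, ← hn']
  ring_nf

end ShiftLinear

section Homotopy

variable (A) in
/-- Two morphisms of differential graded modules are homotopic if their difference is
`d ∘ z + z ∘ d` for some `A`-linear map `z` of degree `-1`. -/
def homotopic : HomRel (DGModule A) := fun M N f g =>
  ∃ z : Cochain M.X N.X (-1), IsLinear M N z ∧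
    Cochain.ofHom f.hom = δ (-1) 0 z + Cochain.ofHom g.hom

instance : Congruence (homotopic A) where
  equivalence :=
    { refl := fun f => ⟨0, .zero _, by simp⟩
      symm := by
        rintro f g ⟨z, hz, h⟩
        exact ⟨-z, hz.neg, by rw [h, δ_neg]; abel⟩
      trans := by
        rintro f g h ⟨z, hz, e⟩ ⟨z', hz', e'⟩
        exact ⟨z + z', hz.add hz', by rw [e, e', δ_add]; abel⟩ }
  comp_left := by
    rintro M N P f g g' ⟨z, hz, h⟩
    refine ⟨(Cochain.ofHom f.hom).comp z (zero_add _), f.linear.comp hz _, ?_⟩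
    rw [comp_hom, comp_hom, Cochain.ofHom_comp, Cochain.ofHom_comp, h, Cochain.comp_add,
      δ_ofHom_comp]
  comp_right := by
    rintro M N P f f' g ⟨z, hz, h⟩
    refine ⟨z.comp (Cochain.ofHom g.hom) (add_zero _), hz.comp g.linear _, ?_⟩
    rw [comp_hom, comp_hom, Cochain.ofHom_comp, Cochain.ofHom_comp, h, Cochain.add_comp,
      δ_comp_ofHom]

lemma homotopic_add {M N : DGModule A} {f g f' g' : M ⟶ N} (h : homotopic A f g)
    (h' : homotopic A f' g') : homotopic A (f + f') (g + g') := by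
  obtain ⟨z, hz, h⟩ := h
  obtain ⟨z', hz', h'⟩ := h'
  exact ⟨z + z', hz.add hz', by
    rw [add_hom, add_hom, Cochain.ofHom_add, Cochain.ofHom_add, h, h', δ_add]; abel⟩

instance : (homotopic A).IsCompatibleWithShift ℤ where
  condition := by
    rintro n M N f g ⟨z, hz, h⟩
    refine ⟨n.negOnePow • z.shift n, (hz.shift n).units_smul _, ?_⟩
    rw [δ_units_smul, Cochain.δ_shift, smul_smul, Int.units_mul_self, one_smul]
    have e := congr_arg (fun y => Cochain.shift y n) h
    simp only [Cochain.shift_add, cochain_shift_ofHom] at e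
    exact e

variable (A) in
/-- The homotopy category of differential graded `A`-modules. -/
abbrev HtpyCat := Quotient (homotopic A)

variable (A) in
/-- The quotient functor from differential graded modules to their homotopy category. -/
abbrev htpyQuotient : DGModule A ⥤ HtpyCat A := Quotient.functor (homotopic A)

instance : Preadditive (HtpyCat A) :=
  Quotient.preadditive _ (fun _ _ _ _ _ _ h h' => homotopic_add h h')

instance : (htpyQuotient A).Additive where

instance (n : ℤ) : (shiftFunctor (HtpyCat A) n).Additive := by
  have : (htpyQuotient A ⋙ shiftFunctor (HtpyCat A) n).Additive :=
    Functor.additive_of_iso ((htpyQuotient A).commShiftIso n)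
  exact Functor.additive_of_full_essSurj_comp (htpyQuotient A) _

lemma htpy_map_eq {M N : DGModule A} {f g : M ⟶ N} (h : homotopic A f g) :
    (htpyQuotient A).map f = (htpyQuotient A).map g :=
  CategoryTheory.Quotient.sound _ h

lemma homotopic_of_map_eq {M N : DGModule A} {f g : M ⟶ N}
    (h : (htpyQuotient A).map f = (htpyQuotient A).map g) : homotopic A f g :=
  (Quotient.functor_map_eq_iff _ _ _).1 h

/-- The isomorphism in the homotopy category given by a homotopy equivalence. -/
@[simps]
def htpyIso {M N : DGModule A} (f : M ⟶ N) (g : N ⟶ M) (h : homotopic A (f ≫ g) (𝟙 M))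
    (h' : homotopic A (g ≫ f) (𝟙 N)) : (htpyQuotient A).obj M ≅ (htpyQuotient A).obj N where
  hom := (htpyQuotient A).map f
  inv := (htpyQuotient A).map g
  hom_inv_id := by rw [← Functor.map_comp, htpy_map_eq h, CategoryTheory.Functor.map_id]
  inv_hom_id := by rw [← Functor.map_comp, htpy_map_eq h', CategoryTheory.Functor.map_id]

lemma homotopic_of_homotopy {M N : DGModule A} {f g : M ⟶ N} (H : Homotopy f.hom g.hom)
    (hH : IsLinear M N (Cochain.equivHomotopy _ _ H).1) : homotopic A f g :=
  ⟨_, hH, (Cochain.equivHomotopy _ _ H).2⟩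

variable (A) in
/-- The zero differential graded module. -/
abbrev zeroObj : DGModule A where
  X := (HasZeroObject.zero' (CochainComplex (ModuleCat.{u} k) ℤ)).zero
  act p := 0
  act_one := (Cochain.ofHom_zero _ _).symm.trans (congrArg Cochain.ofHom
    ((isZero_zero (CochainComplex (ModuleCat.{u} k) ℤ)).eq_of_src 0 _))
  act_mul h a b := by simp
  leibniz a := by simp

lemma isZero_zeroObj : IsZero (zeroObj A) := by
  rw [IsZero.iff_id_eq_zero]
  exact hom_ext ((isZero_zero (CochainComplex (ModuleCat.{u} k) ℤ)).eq_of_src _ _)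

instance : HasZeroObject (DGModule A) := ⟨⟨_, isZero_zeroObj⟩⟩

instance : HasZeroObject (HtpyCat A) :=
  ⟨⟨_, (htpyQuotient A).map_isZero (isZero_zeroObj (A := A))⟩⟩

end Homotopy

end DGModule

namespace DGModule

variable {k : Type u} [Field k] {A : DGAlgebra k}

section Triangles

open CochainComplex.mappingCone

variable {M N : DGModule A} (f : M ⟶ N)

lemma triangle_mor₃_linear : IsLinear (cone f) (M.shiftObj 1)
    (Cochain.ofHom (CochainComplex.mappingCone.triangle f.hom).mor₃) := by
  have h := (fst_linear f).neg.rightShift 1 0 (zero_add 1)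
  have e := Cocycle.cochain_ofHom_homOf_eq_coe ((-fst f.hom).rightShift 1 0 (zero_add 1))
  exact (congrArg (IsLinear (cone f) (M.shiftObj 1)) e).mpr h

/-- The standard triangle `M ⟶ N ⟶ cone f ⟶ M⟦1⟧` attached to a morphism `f : M ⟶ N` of
differential graded modules. -/
abbrev coneTriangle : Triangle (DGModule A) :=
  Triangle.mk f (coneInr f) (⟨(CochainComplex.mappingCone.triangle f.hom).mor₃,
    triangle_mor₃_linear f⟩ : cone f ⟶ M⟦(1 : ℤ)⟧)

/-- The image of the standard triangle in the homotopy category. -/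
abbrev coneTriangleh : Triangle (HtpyCat A) :=
  (htpyQuotient A).mapTriangle.obj (coneTriangle f)

variable (A) in
/-- The triangles which are isomorphic to the image of a standard triangle. -/
def distinguishedTriangles : Set (Triangle (HtpyCat A)) :=
  {T | ∃ (M N : DGModule A) (f : M ⟶ N), Nonempty (T ≅ coneTriangleh f)}

lemma isomorphic_distinguished (T₁ : Triangle (HtpyCat A))
    (hT₁ : T₁ ∈ distinguishedTriangles A) (T₂ : Triangle (HtpyCat A))
    (e : T₂ ≅ T₁) : T₂ ∈ distinguishedTriangles A := by
  obtain ⟨X, Y, f, ⟨e'⟩⟩ := hT₁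
  exact ⟨X, Y, f, ⟨e ≪≫ e'⟩⟩

lemma isZero_cone_id (M : DGModule A) : IsZero ((htpyQuotient A).obj (cone (𝟙 M))) := by
  rw [IsZero.iff_id_eq_zero, ← CategoryTheory.Functor.map_id,
    ← (htpyQuotient A).map_zero (cone (𝟙 M)) (cone (𝟙 M))]
  apply htpy_map_eq
  refine homotopic_of_homotopy (homotopyToZeroOfId M.X) ?_
  have e : (Cochain.equivHomotopy _ _ (homotopyToZeroOfId M.X)).1 =
      descCochain (𝟙 M.X) (0 : Cochain _ _ (-2)) (inl (𝟙 M.X)) (by rfl) :=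
    congrArg Subtype.val (Equiv.apply_symm_apply _ _)
  exact (congrArg (IsLinear (cone (𝟙 M)) (cone (𝟙 M))) e).mpr
    ((IsLinear.zero (M := M) _).descCochain (f := 𝟙 M) (inl_linear (𝟙 M)) _)

lemma contractible_distinguished (X : HtpyCat A) :
    Pretriangulated.contractibleTriangle X ∈ distinguishedTriangles A := by
  obtain ⟨X⟩ := X
  refine ⟨_, _, 𝟙 X, ⟨?_⟩⟩
  have h := isZero_cone_id X
  exact Triangle.isoMk _ _ (Iso.refl _) (Iso.refl _) h.isoZero.symm
    (by
      change 𝟙 _ ≫ 𝟙 _ = 𝟙 _ ≫ (htpyQuotient A).map (𝟙 X)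
      rw [CategoryTheory.Functor.map_id]) (h.eq_of_tgt _ _)
    ((isZero_zero _).eq_of_src _ _)

lemma distinguished_cocone_triangle {X Y : HtpyCat A} (f : X ⟶ Y) :
    ∃ (Z : HtpyCat A) (g : Y ⟶ Z) (h : Z ⟶ X⟦(1 : ℤ)⟧),
      Triangle.mk f g h ∈ distinguishedTriangles A := by
  obtain ⟨f, rfl⟩ := (htpyQuotient A).map_surjective f
  exact ⟨_, _, _, ⟨_, _, f, ⟨Iso.refl _⟩⟩⟩

lemma shift_hom (f : M ⟶ N) (n : ℤ) : Hom.hom (f⟦n⟧') = f.hom⟦n⟧' := rfl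

lemma desc_linear {P : DGModule A} (α : Cochain M.X P.X (-1)) (β : N.X ⟶ P.X)
    (eq : δ (-1) 0 α = Cochain.ofHom (f.hom ≫ β)) (hα : IsLinear M P α)
    (hβ : IsLinear N P (Cochain.ofHom β)) :
    IsLinear (cone f) P (Cochain.ofHom (desc f.hom α β eq)) := by
  rw [ofHom_desc]
  exact hα.descCochain hβ _

lemma lift_linear {P : DGModule A} (α : Cocycle P.X M.X 1) (β : Cochain P.X N.X 0)
    (eq : δ 0 1 β + α.1.comp (Cochain.ofHom f.hom) (add_zero 1) = 0) (hα : IsLinear P M α.1)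
    (hβ : IsLinear P N β) :
    IsLinear P (cone f) (Cochain.ofHom (lift f.hom α β eq)) := by
  rw [ofHom_lift]
  exact hα.liftCochain hβ _

section MapOfHomotopy

variable {M₁ N₁ M₂ N₂ : DGModule A} {φ₁ : M₁ ⟶ N₁} {φ₂ : M₂ ⟶ N₂} {a : M₁ ⟶ M₂} {b : N₁ ⟶ N₂}

lemma mapOfHomotopy_linear (H : Homotopy (φ₁.hom ≫ b.hom) (a.hom ≫ φ₂.hom))
    (hH : IsLinear M₁ N₂ (Cochain.equivHomotopy _ _ H).1) :
    IsLinear (cone φ₁) (cone φ₂) (Cochain.ofHom (mapOfHomotopy H)) := by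
  refine desc_linear φ₁ _ _ _ ?_ ?_
  · exact (a.linear.comp (inl_linear φ₂) _).add (hH.comp (coneInr φ₂).linear _)
  · exact (b ≫ coneInr φ₂).linear

lemma complete_aux (h : homotopic A (φ₁ ≫ b) (a ≫ φ₂)) :
    ∃ c : cone φ₁ ⟶ cone φ₂, coneInr φ₁ ≫ c = b ≫ coneInr φ₂ ∧
      c ≫ (coneTriangle φ₂).mor₃ = (coneTriangle φ₁).mor₃ ≫ a⟦(1 : ℤ)⟧' := by
  obtain ⟨z, hz, e⟩ := h
  let H : Homotopy (φ₁.hom ≫ b.hom) (a.hom ≫ φ₂.hom) :=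
    (Cochain.equivHomotopy _ _).symm ⟨z, e⟩
  have hH : (Cochain.equivHomotopy _ _ H).1 = z :=
    congrArg Subtype.val (Equiv.apply_symm_apply _ _)
  refine ⟨⟨mapOfHomotopy H, mapOfHomotopy_linear H (by rw [hH]; exact hz)⟩,
    hom_ext (triangleMapOfHomotopy_comm₂ H), hom_ext (triangleMapOfHomotopy_comm₃ H)⟩

lemma triangleh_mor₃ (f : M ⟶ N) : (coneTriangleh f).mor₃ =
    (htpyQuotient A).map (coneTriangle f).mor₃ ≫
      ((htpyQuotient A).commShiftIso (1 : ℤ)).hom.app M := rfl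

lemma comp_aux {C : Type*} [Category C] {X Y Z X' Y' Z' : C} {u : X ⟶ Y} {s : Y ⟶ Z}
    {u' : X' ⟶ Y'} {s' : Y' ⟶ Z'} {c : X ⟶ X'} {a : Y ⟶ Y'} {a' : Z ⟶ Z'}
    (h : c ≫ u' = u ≫ a) (h' : a ≫ s' = s ≫ a') : (u ≫ s) ≫ a' = c ≫ u' ≫ s' := by
  rw [Category.assoc, ← h', ← Category.assoc, ← h, Category.assoc]

lemma complete_aux' (φ₁ : M₁ ⟶ N₁) (φ₂ : M₂ ⟶ N₂)
    (x : (coneTriangleh φ₁).obj₁ ⟶ (coneTriangleh φ₂).obj₁)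
    (y : (coneTriangleh φ₁).obj₂ ⟶ (coneTriangleh φ₂).obj₂)
    (h : (coneTriangleh φ₁).mor₁ ≫ y = x ≫ (coneTriangleh φ₂).mor₁) :
    ∃ c : (coneTriangleh φ₁).obj₃ ⟶ (coneTriangleh φ₂).obj₃,
      (coneTriangleh φ₁).mor₂ ≫ c = y ≫ (coneTriangleh φ₂).mor₂ ∧
      (coneTriangleh φ₁).mor₃ ≫ x⟦(1 : ℤ)⟧' = c ≫ (coneTriangleh φ₂).mor₃ := by
  obtain ⟨a, rfl⟩ := (htpyQuotient A).map_surjective (X := M₁) (Y := M₂) x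
  obtain ⟨b, rfl⟩ := (htpyQuotient A).map_surjective (X := N₁) (Y := N₂) y
  have h' : (htpyQuotient A).map (φ₁ ≫ b) = (htpyQuotient A).map (a ≫ φ₂) :=
    ((htpyQuotient A).map_comp _ _).trans (h.trans ((htpyQuotient A).map_comp _ _).symm)
  obtain ⟨c, h₂, h₃⟩ := complete_aux (homotopic_of_map_eq h')
  refine ⟨(htpyQuotient A).map c, ?_, ?_⟩
  · exact ((htpyQuotient A).map_comp _ _).symm.trans ((congrArg _ h₂).trans
      ((htpyQuotient A).map_comp _ _))
  · exact comp_aux (((htpyQuotient A).map_comp _ _).symm.trans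
      ((congrArg (htpyQuotient A).map h₃).trans ((htpyQuotient A).map_comp _ _)))
      (((htpyQuotient A).commShiftIso (1 : ℤ)).hom.naturality a)

lemma complete_of_iso {C : Type*} [Category C] [HasShift C ℤ] {T₁ T₂ T₁' T₂' : Triangle C}
    (e₁ : T₁ ≅ T₁') (e₂ : T₂ ≅ T₂')
    (H : ∀ (a : T₁'.obj₁ ⟶ T₂'.obj₁) (b : T₁'.obj₂ ⟶ T₂'.obj₂) (_ : T₁'.mor₁ ≫ b = a ≫ T₂'.mor₁),
      ∃ (c : T₁'.obj₃ ⟶ T₂'.obj₃), T₁'.mor₂ ≫ c = b ≫ T₂'.mor₂ ∧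
        T₁'.mor₃ ≫ a⟦(1 : ℤ)⟧' = c ≫ T₂'.mor₃)
    (a : T₁.obj₁ ⟶ T₂.obj₁) (b : T₁.obj₂ ⟶ T₂.obj₂) (fac : T₁.mor₁ ≫ b = a ≫ T₂.mor₁) :
    ∃ (c : T₁.obj₃ ⟶ T₂.obj₃), T₁.mor₂ ≫ c = b ≫ T₂.mor₂ ∧
      T₁.mor₃ ≫ a⟦(1 : ℤ)⟧' = c ≫ T₂.mor₃ := by
  obtain ⟨c, h₂, h₃⟩ := H (e₁.inv.hom₁ ≫ a ≫ e₂.hom.hom₁) (e₁.inv.hom₂ ≫ b ≫ e₂.hom.hom₂) (by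
      have comm₁₁ := e₁.inv.comm₁
      have comm₁₂ := e₂.hom.comm₁
      rw [reassoc_of% comm₁₁, reassoc_of% fac, comm₁₂]
      simp only [Category.assoc])
  refine ⟨e₁.hom.hom₃ ≫ c ≫ e₂.inv.hom₃, ?_, ?_⟩
  · rw [e₁.hom.comm₂_assoc, reassoc_of% h₂, e₂.inv.comm₂]
    simp
  · have h4 := e₁.hom.comm₃
    have h5 := e₂.inv.comm₃
    rw [Category.assoc, Category.assoc, ← h5, ← reassoc_of% h₃, ← reassoc_of% h4,
      ← Functor.map_comp, ← Functor.map_comp]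
    simp

lemma complete_distinguished_triangle_morphism (T₁ T₂ : Triangle (HtpyCat A))
    (hT₁ : T₁ ∈ distinguishedTriangles A) (hT₂ : T₂ ∈ distinguishedTriangles A)
    (a : T₁.obj₁ ⟶ T₂.obj₁) (b : T₁.obj₂ ⟶ T₂.obj₂) (fac : T₁.mor₁ ≫ b = a ≫ T₂.mor₁) :
    ∃ (c : T₁.obj₃ ⟶ T₂.obj₃), T₁.mor₂ ≫ c = b ≫ T₂.mor₂ ∧
      T₁.mor₃ ≫ a⟦(1 : ℤ)⟧' = c ≫ T₂.mor₃ := by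
  obtain ⟨M₁, N₁, φ₁, ⟨e₁⟩⟩ := hT₁
  obtain ⟨M₂, N₂, φ₂, ⟨e₂⟩⟩ := hT₂
  exact complete_of_iso e₁ e₂ (complete_aux' φ₁ φ₂) a b fac

end MapOfHomotopy

section Rotate

lemma rotate_hom_linear :
    IsLinear (M.shiftObj 1) (cone (coneInr f)) (Cochain.ofHom (rotateHomotopyEquiv f.hom).hom) := by
  refine lift_linear (coneInr f) _ _ _ ?_ ?_
  · exact (f.linear.leftShift 1 1 (zero_add 1)).neg
  · exact ((inl_linear f).leftShift 1 0 (neg_add_cancel 1)).neg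

lemma rotate_inv_linear :
    IsLinear (cone (coneInr f)) (M.shiftObj 1)
      (Cochain.ofHom (rotateHomotopyEquiv f.hom).inv) := by
  have h : δ (-1) 0 (0 : Cochain N.X (M.shiftObj 1).X (-1)) = Cochain.ofHom ((coneInr f).hom ≫
      (CochainComplex.mappingCone.triangle f.hom).mor₃) := by
    rw [δ_zero]
    exact (Cochain.ofHom_zero _ _).symm.trans (congrArg Cochain.ofHom (inr_triangleδ f.hom).symm)
  exact desc_linear (P := M.shiftObj 1) (coneInr f) 0 _ h (.zero _) (triangle_mor₃_linear f)

/-- The isomorphism between `M⟦1⟧` and the cone of `N ⟶ cone f` in the homotopy category. -/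
def rotateIso : (htpyQuotient A).obj (M⟦(1 : ℤ)⟧) ≅ (htpyQuotient A).obj (cone (coneInr f)) :=
  htpyIso (M := M⟦(1 : ℤ)⟧) ⟨(rotateHomotopyEquiv f.hom).hom, rotate_hom_linear f⟩
    ⟨(rotateHomotopyEquiv f.hom).inv, rotate_inv_linear f⟩
    (homotopic_of_homotopy (rotateHomotopyEquiv f.hom).homotopyHomInvId (by
      exact (IsLinear.zero (M := M.shiftObj 1) (N := M.shiftObj 1) (-1))))
    (homotopic_of_homotopy (rotateHomotopyEquiv f.hom).homotopyInvHomId (by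
      have e : (Cochain.equivHomotopy _ _ (rotateHomotopyEquiv f.hom).homotopyInvHomId).1 =
        _ := congrArg Subtype.val (Equiv.apply_symm_apply _ _)
      exact (congrArg (IsLinear (cone (coneInr f)) (cone (coneInr f))) e).mpr
        (((snd_linear (coneInr f)).comp ((snd_linear f).comp (inl_linear (coneInr f)) _) _).neg)))

lemma rotate_aux₂ {C : Type*} [Category C] {X Y Z W : C} {u : X ⟶ Y} (s : Y ≅ Z) {r : Y ⟶ W}
    {v : X ⟶ W} (h : u ≫ r = v) : (u ≫ s.hom) ≫ (s.inv ≫ r) = 𝟙 X ≫ v := by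
  simp [h]

lemma rotate_aux₃ {C : Type*} [Category C] [Preadditive C] {X X' Y Y' Z : C} {m : X' ⟶ Y'}
    {i : Y' ⟶ Y'} {s : X ≅ X'} {r : X ⟶ Z} {v : Z ⟶ Y} {s' : Y ⟶ Y'} {w : X ⟶ Y} (hi : i = 𝟙 _)
    (h : r ≫ v = -w) (h' : w ≫ s' = s.hom ≫ m) : (-m) ≫ i = (s.inv ≫ r) ≫ v ≫ s' := by
  rw [Category.assoc, reassoc_of% h, hi, Preadditive.neg_comp w s', h']
  simp

lemma rotateIso_comm₂ : (htpyQuotient A).map (coneTriangle f).mor₃ ≫ (rotateIso f).hom =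
    (htpyQuotient A).map (coneInr (coneInr f)) := by
  refine ((htpyQuotient A).map_comp _ _).symm.trans (htpy_map_eq (homotopic_of_homotopy
    (rotateHomotopyEquivComm₂Homotopy f.hom) ?_))
  have e : (Cochain.equivHomotopy _ _ (rotateHomotopyEquivComm₂Homotopy f.hom)).1 =
    _ := congrArg Subtype.val (Equiv.apply_symm_apply _ _)
  exact (congrArg (IsLinear (cone f) (cone (coneInr f))) e).mpr
    (((snd_linear f).comp (inl_linear (coneInr f)) _).neg)

lemma rotateIso_comm₃ : (rotateIso f).hom ≫ (htpyQuotient A).map (coneTriangle (coneInr f)).mor₃ =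
    -(htpyQuotient A).map (f⟦(1 : ℤ)⟧') := by
  refine ((htpyQuotient A).map_comp _ _).symm.trans (Eq.trans ?_ ((htpyQuotient A).map_neg))
  exact congrArg (htpyQuotient A).map (hom_ext (rotateHomotopyEquiv_comm₃ f.hom))

/-- The rotation of a standard triangle is isomorphic to a standard triangle. -/
def rotateTrianglehIso : (coneTriangleh f).rotate ≅ coneTriangleh (coneInr f) :=
  Triangle.isoMk _ _ (Iso.refl _) (Iso.refl _)
    (((htpyQuotient A).commShiftIso (1 : ℤ)).symm.app M ≪≫ rotateIso f)
    ((Category.comp_id _).trans (Category.id_comp _).symm)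
    (rotate_aux₂ (((htpyQuotient A).commShiftIso (1 : ℤ)).app M) (rotateIso_comm₂ f))
    (rotate_aux₃ (s := ((htpyQuotient A).commShiftIso (1 : ℤ)).app M)
      ((shiftFunctor (HtpyCat A) (1 : ℤ)).map_id _) (rotateIso_comm₃ f)
      (((htpyQuotient A).commShiftIso (1 : ℤ)).hom.naturality f))

end Rotate

section Shift

lemma shiftIso_linear (n : ℤ) : IsLinear ((cone f).shiftObj n) (cone (f⟦n⟧'))
    (Cochain.ofHom (CochainComplex.mappingCone.shiftIso f.hom n).hom) := by
  refine lift_linear (f⟦n⟧') _ _ _ ?_ ?_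
  · exact ((fst_linear f).shift n).units_smul _
  · exact (snd_linear f).shift n

/-- The shift of the mapping cone. -/
def coneShiftIso (n : ℤ) : (cone f)⟦n⟧ ≅ cone (f⟦n⟧') :=
  isoMk (CochainComplex.mappingCone.shiftIso f.hom n) (shiftIso_linear f n)

lemma units_smul_hom (u : ℤˣ) (g : M ⟶ N) : (u • g).hom = u • g.hom := by
  obtain rfl | rfl := Int.units_eq_one_or u
  · rw [one_smul, one_smul]
  · rw [Units.neg_smul, Units.neg_smul, one_smul, one_smul, neg_hom]

lemma shiftFunctorComm_hom (M : DGModule A) (a b : ℤ) :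
    Hom.hom ((shiftFunctorComm (DGModule A) a b).hom.app M) =
      (shiftFunctorComm (CochainComplex (ModuleCat.{u} k) ℤ) a b).hom.app M.X := by
  have h := (forget A).map_shiftFunctorComm M a b
  refine h.trans ?_
  refine (Category.id_comp _).trans ?_
  have e : ((shiftFunctor (CochainComplex (ModuleCat.{u} k) ℤ) b).map
    (((forget A).commShiftIso a).hom.app M)) = 𝟙 _ :=
      (shiftFunctor (CochainComplex (ModuleCat.{u} k) ℤ) b).map_id _
  have e' : ((shiftFunctor (CochainComplex (ModuleCat.{u} k) ℤ) a).map
    (((forget A).commShiftIso b).inv.app M)) = 𝟙 _ :=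
      (shiftFunctor (CochainComplex (ModuleCat.{u} k) ℤ) a).map_id _
  refine (congrArg (fun t => t ≫ _) e).trans ((Category.id_comp _).trans ?_)
  refine (congrArg (fun t => _ ≫ t ≫ _) e').trans ?_
  exact (congrArg (fun t => _ ≫ t) (Category.id_comp _)).trans (Category.comp_id _)

lemma units_smul_comp_units_smul {C : Type*} [Category C] [Preadditive C] {X Y : C} (c : ℤˣ)
    (h : X ⟶ Y) : (c • h) ≫ (c • 𝟙 Y) = 𝟙 X ≫ h := by
  simp [smul_smul]

lemma coneShift_comm₂ (n : ℤ) :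
    (n.negOnePow • (coneInr f)⟦n⟧') ≫ (coneShiftIso f n).hom =
      (n.negOnePow • 𝟙 (N⟦n⟧)) ≫ coneInr (f⟦n⟧') := by
  refine hom_ext ?_
  rw [comp_hom, comp_hom, units_smul_hom, units_smul_hom]
  exact (CochainComplex.mappingCone.shiftTriangleIso f.hom n).hom.comm₂

/-- The last morphism of the standard triangle. -/
abbrev coneδ : cone f ⟶ M⟦(1 : ℤ)⟧ := (coneTriangle f).mor₃

/-- The canonical isomorphism `M⟦1⟧⟦n⟧ ⟶ M⟦n⟧⟦1⟧`. -/
abbrev shiftComm (M : DGModule A) (n : ℤ) : M⟦(1 : ℤ)⟧⟦n⟧ ⟶ M⟦n⟧⟦(1 : ℤ)⟧ :=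
  (shiftFunctorComm (DGModule A) 1 n).hom.app M

lemma coneShift_comm₃ (n : ℤ) :
    (n.negOnePow • ((coneδ f)⟦n⟧' ≫ shiftComm M n)) ≫
      (𝟙 (M⟦n⟧))⟦(1 : ℤ)⟧' = (coneShiftIso f n).hom ≫ coneδ (f⟦n⟧') := by
  refine hom_ext ?_
  rw [comp_hom, comp_hom, units_smul_hom, comp_hom, shiftFunctorComm_hom]
  exact (CochainComplex.mappingCone.shiftTriangleIso f.hom n).hom.comm₃

/-- The shift of a standard triangle is isomorphic to a standard triangle. -/
def coneTriangleShiftIso (n : ℤ) :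
    (Triangle.shiftFunctor _ n).obj (coneTriangle f) ≅ coneTriangle (f⟦n⟧') :=
  Triangle.isoMk ((Triangle.shiftFunctor _ n).obj (coneTriangle f)) (coneTriangle (f⟦n⟧'))
    (Iso.refl (M⟦n⟧)) (n.negOnePow • Iso.refl (N⟦n⟧)) (coneShiftIso f n)
    (units_smul_comp_units_smul n.negOnePow (f⟦n⟧')) (coneShift_comm₂ f n) (coneShift_comm₃ f n)

/-- The shift of a standard triangle is isomorphic to a standard triangle. -/
def shiftTrianglehIso (n : ℤ) :
    (Triangle.shiftFunctor _ n).obj (coneTriangleh f) ≅ coneTriangleh (f⟦n⟧') :=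
  ((htpyQuotient A).mapTriangle.commShiftIso n).symm.app _ ≪≫
    (htpyQuotient A).mapTriangle.mapIso (coneTriangleShiftIso f n)

end Shift

lemma rotate_distinguished_triangle' (T : Triangle (HtpyCat A))
    (hT : T ∈ distinguishedTriangles A) : T.rotate ∈ distinguishedTriangles A := by
  obtain ⟨K, L, φ, ⟨e⟩⟩ := hT
  exact ⟨_, _, _, ⟨(rotate _).mapIso e ≪≫ rotateTrianglehIso φ⟩⟩

lemma shift_distinguished_triangle (T : Triangle (HtpyCat A))
    (hT : T ∈ distinguishedTriangles A) (n : ℤ) :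
      (Triangle.shiftFunctor _ n).obj T ∈ distinguishedTriangles A := by
  obtain ⟨K, L, φ, ⟨e⟩⟩ := hT
  exact ⟨_, _, _, ⟨Functor.mapIso _ e ≪≫ shiftTrianglehIso φ n⟩⟩

lemma invRotate_distinguished_triangle' (T : Triangle (HtpyCat A))
    (hT : T ∈ distinguishedTriangles A) : T.invRotate ∈ distinguishedTriangles A :=
  isomorphic_distinguished _
    (shift_distinguished_triangle _ (rotate_distinguished_triangle' _
      (rotate_distinguished_triangle' _ hT)) _) _
    ((invRotateIsoRotateRotateShiftFunctorNegOne _).app T)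

lemma rotate_distinguished_triangle (T : Triangle (HtpyCat A)) :
    T ∈ distinguishedTriangles A ↔ T.rotate ∈ distinguishedTriangles A := by
  constructor
  · exact rotate_distinguished_triangle' T
  · intro hT
    exact isomorphic_distinguished _ (invRotate_distinguished_triangle' T.rotate hT) _
      ((triangleRotation _).unitIso.app T)

instance : Pretriangulated (HtpyCat A) where
  distinguishedTriangles := distinguishedTriangles A
  isomorphic_distinguished := isomorphic_distinguished
  contractible_distinguished := contractible_distinguished
  distinguished_cocone_triangle := distinguished_cocone_triangle
  rotate_distinguished_triangle := rotate_distinguished_triangle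
  complete_distinguished_triangle_morphism := complete_distinguished_triangle_morphism

end Triangles

end DGModule

namespace DGModule

variable {k : Type u} [Field k] {A : DGAlgebra k}

section Octahedron

open CochainComplex.mappingCone
open CochainComplex (mappingConeCompTriangle mappingConeCompHomotopyEquiv)

variable {M₁ N₁ M₂ N₂ : DGModule A}

/-- The morphism between mapping cones induced by a commutative square. -/
abbrev coneMap (φ₁ : M₁ ⟶ N₁) (φ₂ : M₂ ⟶ N₂) (a : M₁ ⟶ M₂) (b : N₁ ⟶ N₂)
    (comm : φ₁ ≫ b = a ≫ φ₂) : cone φ₁ ⟶ cone φ₂ where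
  hom := CochainComplex.mappingCone.map φ₁.hom φ₂.hom a.hom b.hom (congrArg Hom.hom comm)
  linear := desc_linear φ₁ _ _ _ (a.linear.comp (inl_linear φ₂) _) (b ≫ coneInr φ₂).linear

variable {X₁ X₂ X₃ : DGModule A} (f : X₁ ⟶ X₂) (g : X₂ ⟶ X₃)

/-- The morphism `cone f ⟶ cone (f ≫ g)`. -/
abbrev coneCompα : cone f ⟶ cone (f ≫ g) := coneMap f (f ≫ g) (𝟙 X₁) g (by rw [Category.id_comp])

/-- The morphism `cone (f ≫ g) ⟶ cone g`. -/
abbrev coneCompβ : cone (f ≫ g) ⟶ cone g := coneMap (f ≫ g) g f (𝟙 X₃) (by rw [Category.comp_id])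

lemma coneComp_hom_linear : IsLinear (cone g) (cone (coneCompα f g))
    (Cochain.ofHom (mappingConeCompHomotopyEquiv f.hom g.hom).hom) := by
  refine lift_linear (coneCompα f g) _ _ _ ?_ ?_
  · exact (coneInr f).linear.descCochain (.zero _) (zero_add 1)
  · exact (IsLinear.zero (M := X₂) (N := cone (f ≫ g)) _).descCochain (coneInr (f ≫ g)).linear _

lemma coneComp_inv_linear : IsLinear (cone (coneCompα f g)) (cone g)
    (Cochain.ofHom (mappingConeCompHomotopyEquiv f.hom g.hom).inv) := by
  have e : Cochain.ofHom (mappingConeCompHomotopyEquiv f.hom g.hom).inv =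
      descCochain (mappingConeCompTriangle f.hom g.hom).mor₁
        ((snd f.hom).comp (inl g.hom) (zero_add (-1))) (Cochain.ofHom (desc (f.hom ≫ g.hom)
          ((Cochain.ofHom f.hom).comp (inl g.hom) (zero_add (-1))) (inr g.hom) (by simp)))
        (neg_add_cancel 1) := by
    change Cochain.ofHom (CochainComplex.MappingConeCompHomotopyEquiv.inv f.hom g.hom) = _
    unfold CochainComplex.MappingConeCompHomotopyEquiv.inv
    erw [ofHom_desc]
  refine (congrArg (IsLinear (cone (coneCompα f g)) (cone g)) e).mpr
    (IsLinear.descCochain (f := coneCompα f g) ?_ ?_ (neg_add_cancel 1))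
  · exact (snd_linear f).comp (inl_linear g) _
  · exact desc_linear (f ≫ g) _ _ _ (f.linear.comp (inl_linear g) _) (coneInr g).linear

/-- The morphism `cone g ⟶ cone (cone f ⟶ cone (f ≫ g))`. -/
abbrev coneCompHom : cone g ⟶ cone (coneCompα f g) :=
  ⟨(mappingConeCompHomotopyEquiv f.hom g.hom).hom, coneComp_hom_linear f g⟩

/-- The morphism `cone (cone f ⟶ cone (f ≫ g)) ⟶ cone g`. -/
abbrev coneCompInv : cone (coneCompα f g) ⟶ cone g :=
  ⟨(mappingConeCompHomotopyEquiv f.hom g.hom).inv, coneComp_inv_linear f g⟩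

/-- The isomorphism in the homotopy category between `cone g` and the cone of the
morphism `cone f ⟶ cone (f ≫ g)`. -/
def coneCompIso : (htpyQuotient A).obj (cone g) ≅ (htpyQuotient A).obj (cone (coneCompα f g)) :=
  htpyIso (coneCompHom f g) (coneCompInv f g)
    (homotopic_of_homotopy (mappingConeCompHomotopyEquiv f.hom g.hom).homotopyHomInvId
      (IsLinear.zero (M := cone g) (N := cone g) (-1)))
    (homotopic_of_homotopy (mappingConeCompHomotopyEquiv f.hom g.hom).homotopyInvHomId (by
      have e : (Cochain.equivHomotopy _ _
        (mappingConeCompHomotopyEquiv f.hom g.hom).homotopyInvHomId).1 =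
          _ := congrArg Subtype.val (Equiv.apply_symm_apply _ _)
      exact (congrArg (IsLinear (cone (coneCompα f g)) (cone (coneCompα f g))) e).mpr
        ((snd_linear (coneCompα f g)).comp ((fst_linear (f ≫ g)).comp ((inl_linear f).comp
          (inl_linear (coneCompα f g)) _) _) _).neg))

lemma coneComp_comm₁ : coneInr (coneCompα f g) ≫ coneCompInv f g = coneCompβ f g :=
  hom_ext (CochainComplex.mappingConeCompHomotopyEquiv_comm₁ f.hom g.hom)

lemma coneComp_comm₂ :
    coneCompHom f g ≫ coneδ (coneCompα f g) = coneδ g ≫ (coneInr f)⟦(1 : ℤ)⟧' :=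
  hom_ext (CochainComplex.mappingConeCompHomotopyEquiv_comm₂ f.hom g.hom)

/-- The triangle `cone f ⟶ cone (f ≫ g) ⟶ cone g ⟶ (cone f)⟦1⟧`. -/
abbrev coneCompTriangle : Triangle (DGModule A) :=
  Triangle.mk (coneCompα f g) (coneCompβ f g) (coneδ g ≫ (coneInr f)⟦(1 : ℤ)⟧')

lemma coneCompTriangleh_distinguished :
    (htpyQuotient A).mapTriangle.obj (coneCompTriangle f g) ∈ distTriang (HtpyCat A) := by
  refine ⟨_, _, coneCompα f g, ⟨?_⟩⟩
  refine Triangle.isoMk _ _ (Iso.refl _) (Iso.refl _) (coneCompIso f g) ?_ ?_ ?_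
  · exact (Category.comp_id _).trans (Category.id_comp _).symm
  · refine Eq.trans ?_ (Category.id_comp _).symm
    exact (Iso.eq_comp_inv (coneCompIso f g)).1 (((congrArg _ (coneComp_comm₁ f g)).symm).trans
      ((htpyQuotient A).map_comp _ _))
  · refine (congrArg (fun t => _ ≫ t) ((shiftFunctor (HtpyCat A) (1 : ℤ)).map_id _)).trans
      ((Category.comp_id _).trans ?_)
    exact (congrArg (fun t => t ≫ _) ((congrArg (htpyQuotient A).map (coneComp_comm₂ f g).symm).trans
      ((htpyQuotient A).map_comp _ _))).trans (Category.assoc _ _ _)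

lemma coneMap_comm₂ (φ₁ : M₁ ⟶ N₁) (φ₂ : M₂ ⟶ N₂) (a : M₁ ⟶ M₂) (b : N₁ ⟶ N₂)
    (comm : φ₁ ≫ b = a ≫ φ₂) : coneInr φ₁ ≫ coneMap φ₁ φ₂ a b comm = b ≫ coneInr φ₂ :=
  hom_ext (triangleMap φ₁.hom φ₂.hom a.hom b.hom (congrArg Hom.hom comm)).comm₂

lemma coneMap_comm₃ (φ₁ : M₁ ⟶ N₁) (φ₂ : M₂ ⟶ N₂) (a : M₁ ⟶ M₂) (b : N₁ ⟶ N₂)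
    (comm : φ₁ ≫ b = a ≫ φ₂) : coneδ φ₁ ≫ a⟦(1 : ℤ)⟧' = coneMap φ₁ φ₂ a b comm ≫ coneδ φ₂ :=
  hom_ext (triangleMap φ₁.hom φ₂.hom a.hom b.hom (congrArg Hom.hom comm)).comm₃

/-- The morphism between standard triangles induced by a commutative square. -/
abbrev coneTriangleMap (φ₁ : M₁ ⟶ N₁) (φ₂ : M₂ ⟶ N₂) (a : M₁ ⟶ M₂) (b : N₁ ⟶ N₂)
    (comm : φ₁ ≫ b = a ≫ φ₂) : coneTriangle φ₁ ⟶ coneTriangle φ₂ where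
  hom₁ := a
  hom₂ := b
  hom₃ := coneMap φ₁ φ₂ a b comm
  comm₁ := comm
  comm₂ := coneMap_comm₂ φ₁ φ₂ a b comm
  comm₃ := coneMap_comm₃ φ₁ φ₂ a b comm

lemma coneTriangleh_distinguished (φ : M₁ ⟶ N₁) : coneTriangleh φ ∈ distTriang (HtpyCat A) :=
  ⟨_, _, φ, ⟨Iso.refl _⟩⟩

lemma comp_id_aux {C : Type*} [Category C] {X Y : C} (u : X ⟶ Y) {i : Y ⟶ Y} (h : i = 𝟙 Y) :
    u ≫ i = u := by
  rw [h, Category.comp_id]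

lemma id_comp_aux {C : Type*} [Category C] {X Y : C} (u : X ⟶ Y) {i : X ⟶ X} (h : i = 𝟙 X) :
    i ≫ u = u := by
  rw [h, Category.id_comp]

lemma comp_aux' {C : Type*} [Category C] {X Y Z Y' Z' : C} {u : X ⟶ Y} {v : Y ⟶ Z}
    {w : X ⟶ Z} {s : Y ⟶ Y'} {s' : Z ⟶ Z'} {v' : Y' ⟶ Z'} (h : w = u ≫ v)
    (h' : v ≫ s' = s ≫ v') : (u ≫ s) ≫ v' = w ≫ s' := by
  rw [h, Category.assoc, Category.assoc, h']

instance : IsTriangulated (HtpyCat A) :=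
  IsTriangulated.mk' (by
    rintro ⟨X₁⟩ ⟨X₂⟩ ⟨X₃⟩ u₁₂' u₂₃'
    obtain ⟨f, rfl⟩ := (htpyQuotient A).map_surjective (X := X₁) (Y := X₂) u₁₂'
    obtain ⟨g, rfl⟩ := (htpyQuotient A).map_surjective (X := X₂) (Y := X₃) u₂₃'
    refine ⟨_, _, _, _, _, _, _, _, Iso.refl _, Iso.refl _, Iso.refl _,
        (Category.comp_id _).trans (Category.id_comp _).symm,
        (Category.comp_id _).trans (Category.id_comp _).symm,
        _, _, coneTriangleh_distinguished f, _, _, coneTriangleh_distinguished g,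
        _, _, coneTriangleh_distinguished (f ≫ g), ⟨?_⟩⟩
    let α := coneTriangleMap f (f ≫ g) (𝟙 X₁) g (by rw [Category.id_comp])
    let β := coneTriangleMap (f ≫ g) g f (𝟙 X₃) (by rw [Category.comp_id])
    refine Triangulated.Octahedron.mk ((htpyQuotient A).map α.hom₃)
      ((htpyQuotient A).map β.hom₃) ?_ ?_ ?_ ?_ ?_
    · exact ((htpyQuotient A).mapTriangle.map α).comm₂
    · refine ((htpyQuotient A).mapTriangle.map α).comm₃.symm.trans ?_
      exact comp_id_aux _ (((shiftFunctor (HtpyCat A) (1 : ℤ)).congr_map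
        ((htpyQuotient A).map_id X₁)).trans ((shiftFunctor (HtpyCat A) (1 : ℤ)).map_id _))
    · refine ((htpyQuotient A).mapTriangle.map β).comm₂.trans ?_
      exact id_comp_aux _ ((htpyQuotient A).map_id X₃)
    · exact ((htpyQuotient A).mapTriangle.map β).comm₃
    · refine isomorphic_distinguished _ (coneCompTriangleh_distinguished f g) _ ?_
      exact Triangle.isoMk _ _ (Iso.refl _) (Iso.refl _) (Iso.refl _)
        ((Category.comp_id _).trans (Category.id_comp _).symm)
        ((Category.comp_id _).trans (Category.id_comp _).symm)
        ((comp_id_aux _ ((shiftFunctor (HtpyCat A) (1 : ℤ)).map_id _)).trans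
          ((comp_aux' ((htpyQuotient A).map_comp _ _)
            (((htpyQuotient A).commShiftIso (1 : ℤ)).hom.naturality (coneInr f))).trans
              (Category.id_comp _).symm)))

end Octahedron

end DGModule

namespace DGModule

variable {k : Type u} [Field k] (A : DGAlgebra k)

/-- The functor which sends a differential graded module to the underlying complex,
considered as an object of the homotopy category of complexes. -/
abbrev forgetH : DGModule A ⥤ HomotopyCategory (ModuleCat.{u} k) (ComplexShape.up ℤ) :=
  forget A ⋙ HomotopyCategory.quotient _ _

variable {A} in
lemma forgetH_map_eq {M N : DGModule A} {f g : M ⟶ N} (h : homotopic A f g) :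
    (forgetH A).map f = (forgetH A).map g := by
  obtain ⟨z, _, e⟩ := h
  exact HomotopyCategory.eq_of_homotopy _ _ ((Cochain.equivHomotopy _ _).symm ⟨z, e⟩)

/-- The functor from the homotopy category of differential graded modules to the
homotopy category of complexes of vector spaces which forgets the action. -/
abbrev htpyForget : HtpyCat A ⥤ HomotopyCategory (ModuleCat.{u} k) (ComplexShape.up ℤ) :=
  CategoryTheory.Quotient.lift (homotopic A) (forgetH A) (fun _ _ _ _ h => forgetH_map_eq h)

instance : (htpyForget A).Additive := by
  have : (htpyQuotient A ⋙ htpyForget A).Additive := Functor.additive_of_iso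
    (CategoryTheory.Quotient.lift.isLift (homotopic A) (forgetH A)
      (fun _ _ _ _ h => forgetH_map_eq h)).symm
  exact Functor.additive_of_full_essSurj_comp (htpyQuotient A) (htpyForget A)

variable {A} in
/-- The image of a standard triangle is a standard triangle. -/
def htpyForgetTriangleIso {M N : DGModule A} (f : M ⟶ N) :
    (htpyForget A).mapTriangle.obj (coneTriangleh f) ≅
      CochainComplex.mappingCone.triangleh f.hom :=
  (Functor.mapTriangleCompIso (htpyQuotient A) (htpyForget A)).symm.app (coneTriangle f) ≪≫
    (Functor.mapTriangleIso (CategoryTheory.Quotient.lift.isLift (homotopic A) (forgetH A) _)).app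
      (coneTriangle f) ≪≫
    (Functor.mapTriangleCompIso (forget A) (HomotopyCategory.quotient _ _)).app (coneTriangle f) ≪≫
    (HomotopyCategory.quotient _ _).mapTriangle.mapIso
      (Triangle.isoMk ((forget A).mapTriangle.obj (coneTriangle f))
        (CochainComplex.mappingCone.triangle f.hom) (Iso.refl _) (Iso.refl _) (Iso.refl _)
        ((Category.comp_id _).trans (Category.id_comp _).symm)
        ((Category.comp_id _).trans (Category.id_comp _).symm)
        ((comp_id_aux _ ((shiftFunctor (CochainComplex (ModuleCat.{u} k) ℤ) (1 : ℤ)).map_id _)).trans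
          ((Category.comp_id _).trans (Category.id_comp _).symm)))

instance : (htpyForget A).IsTriangulated where
  map_distinguished := by
    rintro T ⟨M, N, f, ⟨e⟩⟩
    exact ⟨_, _, _, ⟨(htpyForget A).mapTriangle.mapIso e ≪≫ htpyForgetTriangleIso f⟩⟩

/-- The morphisms in the homotopy category of differential graded modules which induce
isomorphisms in cohomology. -/
def quasiIso : MorphismProperty (HtpyCat A) :=
  (HomotopyCategory.quasiIso (ModuleCat.{u} k) (ComplexShape.up ℤ)).inverseImage (htpyForget A)

lemma quasiIso_eq : quasiIso A =
    ((HomotopyCategory.subcategoryAcyclic (ModuleCat.{u} k)).inverseImage (htpyForget A)).trW := by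
  ext M N f
  rw [ObjectProperty.inverseImage_trW_iff, quasiIso,
    HomotopyCategory.quasiIso_eq_trW_subcategoryAcyclic]
  rfl

instance : (quasiIso A).HasLeftCalculusOfFractions := by
  rw [quasiIso_eq]; infer_instance

instance : (quasiIso A).HasRightCalculusOfFractions := by
  rw [quasiIso_eq]; infer_instance

instance : (quasiIso A).IsCompatibleWithTriangulation := by
  rw [quasiIso_eq]; infer_instance

instance : (quasiIso A).IsStableUnderFiniteProducts := by
  rw [quasiIso_eq]; infer_instance

/-- The derived category of a differential graded algebra: the localization of the homotopy
category of differential graded modules with respect to quasi-isomorphisms. -/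
abbrev DerCat := (quasiIso A).Localization

/-- The localization functor. -/
abbrev derQ : HtpyCat A ⥤ DerCat A := (quasiIso A).Q

end DGModule

section BGG

variable (k : Type u) [Field k] (r : ℕ)

/-- The graded components of the polynomial ring `S = k[x₁, …, x_r]`, with `|x_i| = 1`. -/
abbrev polyDeg (n : ℤ) : Submodule k (MvPolynomial (Fin r) k) :=
  MvPolynomial.weightedHomogeneousSubmodule k (fun _ => (1 : ℤ)) n

variable {k r} in
/-- Multiplication `S^p × S^q ⟶ S^n` for `p + q = n`. -/
def polyMul {p q n : ℤ} (h : p + q = n) : polyDeg k r p →ₗ[k] polyDeg k r q →ₗ[k] polyDeg k r n :=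
  LinearMap.mk₂ k (fun a b => ⟨a.1 * b.1, h ▸ MvPolynomial.IsWeightedHomogeneous.mul a.2 b.2⟩)
    (fun _ _ _ => Subtype.ext (add_mul _ _ _)) (fun _ _ _ => Subtype.ext (smul_mul_assoc _ _ _))
    (fun _ _ _ => Subtype.ext (mul_add _ _ _)) (fun _ _ _ => Subtype.ext (mul_smul_comm _ _ _))

variable {k r} in
@[simp]
lemma polyMul_coe {p q n : ℤ} (h : p + q = n) (a : polyDeg k r p) (b : polyDeg k r q) :
    (polyMul h a b).1 = a.1 * b.1 := rfl

/-- The element `1 ∈ S^0`. -/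
def polyOne : polyDeg k r 0 := ⟨1, MvPolynomial.isWeightedHomogeneous_one _ _⟩

/-- The variable `x_i ∈ S^1`. -/
def polyVar (i : Fin r) : polyDeg k r 1 :=
  ⟨MvPolynomial.X i, MvPolynomial.isWeightedHomogeneous_X _ _ i⟩

/-- The polynomial ring `S = k[x₁, …, x_r]`, with `|x_i| = 1`, as a differential graded algebra
with zero differential. -/
abbrev polyDG : DGAlgebra k where
  X :=
    { X := fun n => ModuleCat.of k (polyDeg k r n)
      d := fun _ _ => 0 }
  one := polyOne k r
  mul h := polyMul h
  one_mul a := Subtype.ext (one_mul a.1)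
  mul_one a := Subtype.ext (mul_one a.1)
  mul_assoc _ _ _ _ a b c := Subtype.ext (mul_assoc a.1 b.1 c.1)
  leibniz h a b := by simp

variable {k r} {Λ : Type u} [CommRing Λ] [Algebra k Λ] (z : Fin r → Λ)

/-- The map `Λ ⊗ S^n ⟶ Λ ⊗ S^m`, for `n + p = m`, given by multiplication by `1 ⊗ s`,
where `s ∈ S^p`. -/
def mulPoly {p n m : ℤ} (h : n + p = m) (s : polyDeg k r p) :
    Λ ⊗[k] polyDeg k r n →ₗ[Λ] Λ ⊗[k] polyDeg k r m :=
  (polyMul ((add_comm p n).trans h) s).baseChange Λ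

@[simp]
lemma mulPoly_tmul {p n m : ℤ} (h : n + p = m) (s : polyDeg k r p) (a : Λ) (t : polyDeg k r n) :
    mulPoly h s (a ⊗ₜ[k] t) = a ⊗ₜ polyMul ((add_comm p n).trans h) s t := rfl

/-- The map `Λ ⊗ S^n ⟶ Λ ⊗ S^m`, for `n + 1 = m`, given by multiplication by
`δ = ∑ z_i ⊗ x_i`. -/
def mulδ {n m : ℤ} (h : n + 1 = m) : Λ ⊗[k] polyDeg k r n →ₗ[Λ] Λ ⊗[k] polyDeg k r m :=
  ∑ i, z i • mulPoly h (polyVar k r i)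

lemma mulδ_tmul {n m : ℤ} (h : n + 1 = m) (a : Λ) (t : polyDeg k r n) :
    mulδ z h (a ⊗ₜ[k] t) =
      ∑ i, (z i * a) ⊗ₜ[k] polyMul ((add_comm 1 n).trans h) (polyVar k r i) t := by
  simp [mulδ, LinearMap.sum_apply, TensorProduct.smul_tmul']

lemma mulPoly_mulPoly {p q n m l : ℤ} (h : n + p = m) (h' : m + q = l) (s : polyDeg k r p)
    (t : polyDeg k r q) {pq : ℤ} (hpq : p + q = pq) (hl : n + pq = l) :
    mulPoly (Λ := Λ) h' t ∘ₗ mulPoly h s = mulPoly hl (polyMul hpq s t) := by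
  unfold mulPoly
  rw [← LinearMap.baseChange_comp]
  congr 1
  refine LinearMap.ext fun x => Subtype.ext ?_
  simp only [LinearMap.comp_apply, polyMul_coe]
  ring

lemma lin_sum_comp {ι M N P : Type*} [AddCommGroup M] [AddCommGroup N] [AddCommGroup P]
    [Module Λ M] [Module Λ N] [Module Λ P] (t : Finset ι) (f : ι → N →ₗ[Λ] P) (g : M →ₗ[Λ] N) :
    (∑ i ∈ t, f i) ∘ₗ g = ∑ i ∈ t, f i ∘ₗ g := by
  ext x
  simp [LinearMap.sum_apply]

lemma lin_comp_sum {ι M N P : Type*} [AddCommGroup M] [AddCommGroup N] [AddCommGroup P]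
    [Module Λ M] [Module Λ N] [Module Λ P] (t : Finset ι) (f : ι → M →ₗ[Λ] N) (g : N →ₗ[Λ] P) :
    g ∘ₗ (∑ i ∈ t, f i) = ∑ i ∈ t, g ∘ₗ f i := by
  ext x
  simp [LinearMap.sum_apply]

lemma mulδ_mulδ [CharP k 2] (hz : ∀ i, z i * z i = 0) {n m l : ℤ} (h : n + 1 = m) (h' : m + 1 = l) :
    mulδ z h' ∘ₗ mulδ (k := k) z h = 0 := by
  have hl : n + 2 = l := by omega
  have e : ∀ i j, (z j • mulPoly h' (polyVar k r j)) ∘ₗ (z i • mulPoly h (polyVar k r i)) =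
      (z j * z i) • mulPoly (Λ := Λ) hl (polyMul (by norm_num) (polyVar k r i) (polyVar k r j)) := by
    intro i j
    rw [LinearMap.smul_comp, LinearMap.comp_smul, smul_smul,
      mulPoly_mulPoly h h' _ _ (by norm_num) hl]
  have h2 : (2 : Λ) = 0 := by
    rw [← map_ofNat (algebraMap k Λ) 2, show (OfNat.ofNat 2 : k) = 0 from CharTwo.two_eq_zero,
      map_zero]
  unfold mulδ
  simp only [lin_sum_comp, lin_comp_sum, e]
  rw [← Finset.sum_product']
  refine Finset.sum_involution (fun p _ => p.swap) ?_ ?_ (by simp) (by simp)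
  · rintro ⟨i, j⟩ _
    have hs : polyMul (n := 2) (by norm_num) (polyVar k r j) (polyVar k r i) =
        polyMul (by norm_num) (polyVar k r i) (polyVar k r j) := Subtype.ext (mul_comm _ _)
    simp only [Prod.swap, hs, mul_comm (z j) (z i)]
    rw [← two_smul Λ, h2, zero_smul]
  · rintro ⟨i, j⟩ _ hne heq
    obtain rfl : j = i := congrArg Prod.fst heq
    exact hne (by simp [hz])

lemma mulδ_mulPoly {p n m n' m' : ℤ} (h : n + p = m) (hn : n + 1 = n') (hm : m + 1 = m')
    (h' : n' + p = m') (s : polyDeg k r p) :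
    mulδ z hm ∘ₗ mulPoly h s = mulPoly h' s ∘ₗ mulδ z hn := by
  unfold mulδ
  rw [lin_sum_comp, lin_comp_sum]
  refine Finset.sum_congr rfl fun i _ => ?_
  rw [LinearMap.smul_comp, LinearMap.comp_smul, mulPoly_mulPoly h hm _ _ rfl (by omega),
    mulPoly_mulPoly hn h' _ _ (add_comm 1 p) (by omega)]
  congr 2
  exact Subtype.ext (mul_comm _ _)

/-- The complex `J = Λ ⊗ S` of `Λ`-modules, with `J^n = Λ ⊗ S^n` and differential given by
multiplication by `δ = ∑ z_i ⊗ x_i`. -/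
abbrev bggJ [CharP k 2] (hz : ∀ i, z i * z i = 0) : CochainComplex (ModuleCat.{u} Λ) ℤ where
  X n := ModuleCat.of Λ (Λ ⊗[k] polyDeg k r n)
  d n m := if h : n + 1 = m then ModuleCat.ofHom (mulδ z h) else 0
  shape n m h := dif_neg h
  d_comp_d' n m l h h' := by
    have h : n + 1 = m := h
    have h' : m + 1 = l := h'
    rw [dif_pos h, dif_pos h', ← ModuleCat.ofHom_comp, mulδ_mulδ z hz h h']
    rfl

section Zeta

variable [CharP k 2] (hz : ∀ i, z i * z i = 0)

/-- For `s ∈ S^p`, the map `J ⟶ J` of degree `p` given by multiplication by `1 ⊗ s`. -/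
def zetaFun {p : ℤ} (s : polyDeg k r p) : Cochain (bggJ (k := k) z hz) (bggJ (k := k) z hz) p :=
  Cochain.mk fun _ _ h => ModuleCat.ofHom (mulPoly h s)

@[simp]
lemma zetaFun_v {p n m : ℤ} (s : polyDeg k r p) (h : n + p = m) :
    (zetaFun z hz s).v n m h = ModuleCat.ofHom (mulPoly h s) := rfl

lemma zetaFun_mul {p q n : ℤ} (h : p + q = n) (s : polyDeg k r p) (t : polyDeg k r q) :
    zetaFun z hz (polyMul h s t) = (zetaFun z hz t).comp (zetaFun z hz s) ((add_comm q p).trans h) := by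
  refine Cochain.ext _ _ fun i j hij => ?_
  rw [Cochain.comp_v _ _ ((add_comm q p).trans h) i (i + q) j rfl (by omega), zetaFun_v, zetaFun_v,
    zetaFun_v, ← ModuleCat.ofHom_comp,
    mulPoly_mulPoly _ _ _ _ ((add_comm q p).trans h) hij]
  congr 2
  exact Subtype.ext (mul_comm _ _)

lemma zetaFun_one : zetaFun z hz (polyOne k r) = Cochain.ofHom (𝟙 _) := by
  refine Cochain.ext₀ _ _ fun i => ?_
  rw [zetaFun_v, Cochain.ofHom_v]
  refine ModuleCat.hom_ext ?_
  have e : polyMul ((add_comm 0 i).trans (add_zero i)) (polyOne k r) = LinearMap.id :=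
    LinearMap.ext fun x => Subtype.ext (one_mul _)
  exact (congrArg (LinearMap.baseChange Λ) e).trans LinearMap.baseChange_id

lemma add_self_hom {C : Type*} [Category C] [Preadditive C] [Linear k C] {X Y : C} (f : X ⟶ Y) :
    f + f = 0 := by
  rw [← two_smul k, CharTwo.two_eq_zero, zero_smul]

lemma units_smul_hom' {C : Type*} [Category C] [Preadditive C] [Linear k C] {X Y : C} (c : ℤˣ)
    (f : X ⟶ Y) : c • f = f := by
  obtain rfl | rfl := Int.units_eq_one_or c
  · rw [one_smul]
  · rw [Units.neg_smul, one_smul, neg_eq_iff_add_eq_zero, add_self_hom (k := k)]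

lemma units_smul_cochain {C : Type*} [Category C] [Preadditive C] [Linear k C]
    {F G : CochainComplex C ℤ} {n : ℤ} (c : ℤˣ) (f : Cochain F G n) : c • f = f := by
  refine Cochain.ext _ _ fun i j hij => ?_
  rw [Cochain.units_smul_v, units_smul_hom' (k := k)]

lemma δ_zetaFun {p : ℤ} (s : polyDeg k r p) : δ p (p + 1) (zetaFun z hz s) = 0 := by
  refine Cochain.ext _ _ fun i j hij => ?_
  have hj : i + p + 1 = j := by omega
  rw [δ_v p (p + 1) rfl _ i j hij (i + p) (i + 1) (by omega) rfl, units_smul_hom' (k := k),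
    zetaFun_v, zetaFun_v]
  have h1 : (bggJ (k := k) z hz).d (i + p) j = ModuleCat.ofHom (mulδ z hj) := dif_pos hj
  have h2 : (bggJ (k := k) z hz).d i (i + 1) = ModuleCat.ofHom (mulδ z rfl) := dif_pos rfl
  rw [h1, h2, ← ModuleCat.ofHom_comp, ← ModuleCat.ofHom_comp,
    mulδ_mulPoly z rfl rfl hj (by omega) s, add_self_hom (k := k)]
  rfl

/-- The map `S^p ⟶ Hom(J, J)^p` given by multiplication. -/
def zetaLin (p : ℤ) : polyDeg k r p →ₗ[k] Cochain (bggJ (k := k) z hz) (bggJ (k := k) z hz) p where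
  toFun s := zetaFun z hz s
  map_add' s t := by
    refine Cochain.ext _ _ fun i j hij => ?_
    rw [Cochain.add_v, zetaFun_v, zetaFun_v, zetaFun_v, ← ModuleCat.ofHom_add]
    congr 1
    unfold mulPoly
    rw [map_add, LinearMap.baseChange_add]
  map_smul' c s := by
    refine Cochain.ext _ _ fun i j hij => ?_
    rw [RingHom.id_apply, Cochain.smul_v, zetaFun_v, zetaFun_v]
    refine ModuleCat.hom_ext (LinearMap.ext fun x => ?_)
    have e : mulPoly (Λ := Λ) hij (c • s) = c • mulPoly hij s := by
      unfold mulPoly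
      rw [map_smul, LinearMap.baseChange_smul]
    refine (LinearMap.congr_fun e x).trans ?_
    exact (algebraMap_smul Λ c _).symm

/-- The morphism `ζ : S ⟶ End(J)` of differential graded algebras, given by multiplication. -/
def zeta : DGAlgebra.Hom (polyDG k r) (endDGAlgebra k (bggJ (k := k) z hz)) where
  hom :=
    { f := fun p => ModuleCat.ofHom (zetaLin z hz p)
      comm' := fun p q hpq => by
        obtain rfl : p + 1 = q := hpq
        refine ModuleCat.hom_ext (LinearMap.ext fun s => ?_)
        exact (δ_zetaFun z hz s).trans (map_zero (zetaLin z hz (p + 1))).symm }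
  map_one := zetaFun_one z hz
  map_mul h a b := zetaFun_mul z hz h a b

end Zeta

section Comp

variable {C : Type*} [Category.{u} C] [Preadditive C] [Linear k C]

/-- The map `Hom(G, M) ⟶ Hom(F, M)` of degree `p` given by composition with a map
`F ⟶ G` of degree `p`. -/
def precomp {F G : CochainComplex C ℤ} {p : ℤ} (c : Cochain F G p) (M : CochainComplex C ℤ) :
    Cochain (homComplex k G M) (homComplex k F M) p :=
  Cochain.mk fun q n h => ModuleCat.ofHom
    { toFun := fun f : Cochain G M q => (c.comp f ((add_comm p q).trans h) : Cochain F M n)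
      map_add' := fun _ _ => Cochain.comp_add _ _ _ _
      map_smul' := fun _ _ => Cochain.comp_smul _ _ _ _ }

/-- The map `Hom(F, M) ⟶ Hom(F, N)` of degree `p` given by composition with a map
`M ⟶ N` of degree `p`. -/
def postcomp {M N : CochainComplex C ℤ} {p : ℤ} (F : CochainComplex C ℤ) (c : Cochain M N p) :
    Cochain (homComplex k F M) (homComplex k F N) p :=
  Cochain.mk fun q n h => ModuleCat.ofHom
    { toFun := fun f : Cochain F M q => (f.comp c h : Cochain F N n)
      map_add' := fun _ _ => Cochain.add_comp _ _ _ _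
      map_smul' := fun _ _ => Cochain.smul_comp _ _ _ _ }

/-- A map of degree `p` between complexes of vector spaces is determined by its values. -/
lemma cochain_ext_apply {X Y : CochainComplex (ModuleCat.{u} k) ℤ} {p : ℤ} {c d : Cochain X Y p}
    (h : ∀ (q n : ℤ) (hq : q + p = n) (x : X.X q), (c.v q n hq).hom x = (d.v q n hq).hom x) :
    c = d :=
  Cochain.ext _ _ fun q n hq => ModuleCat.hom_ext (LinearMap.ext (h q n hq))

variable (k) in
lemma precomp_v_apply {F G : CochainComplex C ℤ} {p : ℤ} (c : Cochain F G p)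
    (M : CochainComplex C ℤ) {q n : ℤ} (h : q + p = n) (f : Cochain G M q) :
    ((precomp (k := k) c M).v q n h).hom f = c.comp f ((add_comm p q).trans h) := rfl

variable (k) in
lemma postcomp_v_apply {M N : CochainComplex C ℤ} {p : ℤ} (F : CochainComplex C ℤ)
    (c : Cochain M N p) {q n : ℤ} (h : q + p = n) (f : Cochain F M q) :
    ((postcomp (k := k) F c).v q n h).hom f = f.comp c h := rfl

lemma homComplex_d_apply {F G : CochainComplex C ℤ} (n m : ℤ) (f : Cochain F G n) :
    ((homComplex k F G).d n m).hom f = δ n m f := rfl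

variable {F G H M N : CochainComplex C ℤ}

lemma precomp_comp {p q n : ℤ} (c : Cochain F G p) (d : Cochain G H q) (h : p + q = n) :
    precomp (k := k) (c.comp d h) M =
      (precomp (k := k) d M).comp (precomp c M) ((add_comm q p).trans h) := by
  refine cochain_ext_apply fun i j hij f => ?_
  rw [Cochain.comp_v _ _ ((add_comm q p).trans h) i (i + q) j rfl (by omega), ModuleCat.comp_apply]
  exact Cochain.comp_assoc c d (show Cochain H M i from f) h (add_comm q i) (by omega)

lemma postcomp_comp {p q n : ℤ} (c : Cochain M N p) (d : Cochain N H q) (h : p + q = n) :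
    postcomp (k := k) F (c.comp d h) = (postcomp (k := k) F c).comp (postcomp F d) h := by
  refine cochain_ext_apply fun i j hij f => ?_
  rw [Cochain.comp_v _ _ h i (i + p) j rfl (by omega), ModuleCat.comp_apply]
  exact (Cochain.comp_assoc (show Cochain F M i from f) c d rfl h (by omega)).symm

lemma precomp_postcomp {p q n : ℤ} (c : Cochain F G p) (d : Cochain M N q) (h : p + q = n) :
    (precomp (k := k) c M).comp (postcomp F d) h =
      (postcomp (k := k) G d).comp (precomp c N) ((add_comm q p).trans h) := by
  refine cochain_ext_apply fun i j hij f => ?_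
  rw [Cochain.comp_v _ _ h i (i + p) j rfl (by omega),
    Cochain.comp_v _ _ ((add_comm q p).trans h) i (i + q) j rfl (by omega), ModuleCat.comp_apply,
    ModuleCat.comp_apply]
  exact Cochain.comp_assoc c (show Cochain G M i from f) d (add_comm p i) rfl (by omega)

lemma precomp_add {p : ℤ} (c d : Cochain F G p) :
    precomp (k := k) (c + d) M = precomp c M + precomp d M :=
  cochain_ext_apply fun i _ h f =>
    Cochain.add_comp c d (show Cochain G M i from f) ((add_comm p i).trans h)

lemma precomp_zero {p : ℤ} : precomp (k := k) (0 : Cochain F G p) M = 0 :=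
  cochain_ext_apply fun i _ h f =>
    Cochain.zero_comp (show Cochain G M i from f) ((add_comm p i).trans h)

lemma precomp_smul {p : ℤ} (a : k) (c : Cochain F G p) :
    precomp (k := k) (a • c) M = a • precomp c M :=
  cochain_ext_apply fun i _ h f =>
    Cochain.smul_comp a c (show Cochain G M i from f) ((add_comm p i).trans h)

lemma postcomp_add {p : ℤ} (c d : Cochain M N p) :
    postcomp (k := k) F (c + d) = postcomp F c + postcomp F d :=
  cochain_ext_apply fun i _ h f => Cochain.comp_add (show Cochain F M i from f) c d h

lemma precomp_id : precomp (k := k) (Cochain.ofHom (𝟙 F)) M = Cochain.ofHom (𝟙 _) :=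
  cochain_ext_apply fun i j h f => by
    obtain rfl : i = j := by omega
    rw [Cochain.ofHom_v]
    exact Cochain.id_comp _

lemma δ_precomp [CharP k 2] {p : ℤ} (c : Cochain F G p) (hc : δ p (p + 1) c = 0) :
    δ p (p + 1) (precomp (k := k) c M) = 0 := by
  refine cochain_ext_apply fun i j hij f => ?_
  have hj : i + p + 1 = j := by omega
  rw [δ_v p (p + 1) rfl _ i j hij (i + p) (i + 1) (by omega) rfl, units_smul_hom' (k := k)]
  change δ (i + p) j (c.comp (show Cochain G M i from f) (add_comm p i)) +
    c.comp (δ i (i + 1) (show Cochain G M i from f)) (show p + (i + 1) = j by omega) = 0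
  rw [δ_comp c (show Cochain G M i from f) (add_comm p i) (p + 1) (i + 1) j hj rfl rfl, hc,
    Cochain.zero_comp, smul_zero, add_zero]
  exact LinearMap.congr_fun (congrArg ModuleCat.Hom.hom
    (add_self_hom (k := k) ((precomp (k := k) c M).v (i + 1) j (by omega))))
      (δ i (i + 1) (show Cochain G M i from f))

lemma postcomp_id : postcomp (k := k) F (Cochain.ofHom (𝟙 M)) = Cochain.ofHom (𝟙 _) :=
  cochain_ext_apply fun i j h f => by
    obtain rfl : i = j := by omega
    rw [Cochain.ofHom_v]
    exact Cochain.comp_id _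

lemma δ_postcomp {p p' : ℤ} (hp : p + 1 = p') (c : Cochain M N p) :
    δ p p' (postcomp (k := k) F c) = postcomp F (δ p p' c) := by
  obtain rfl := hp
  refine cochain_ext_apply fun i j hij f => ?_
  have hj : i + p + 1 = j := by omega
  rw [δ_v p (p + 1) rfl _ i j hij (i + p) (i + 1) (by omega) rfl]
  obtain ⟨f, rfl⟩ : ∃ g : Cochain F M i, g = f := ⟨f, rfl⟩
  change δ (i + p) j (f.comp c rfl) + (p + 1).negOnePow •
    (δ i (i + 1) f).comp c (show (i + 1) + p = j by omega) = f.comp (δ p (p + 1) c) hij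
  rw [δ_comp f c rfl (i + 1) (p + 1) j hj rfl rfl, Int.negOnePow_succ, Units.neg_smul]
  abel

/-- The morphism `Hom(F, M) ⟶ Hom(F, N)` induced by a morphism `M ⟶ N`. -/
def homComplexMap (F : CochainComplex C ℤ) (g : M ⟶ N) : homComplex k F M ⟶ homComplex k F N where
  f n := (postcomp (k := k) F (Cochain.ofHom g)).v n n (add_zero n)
  comm' n m h := by
    obtain rfl : n + 1 = m := h
    refine ModuleCat.hom_ext (LinearMap.ext fun f => ?_)
    obtain ⟨f, rfl⟩ : ∃ g : Cochain F M n, g = f := ⟨f, rfl⟩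
    exact δ_comp_ofHom f g (n + 1)

lemma ofHom_homComplexMap (g : M ⟶ N) :
    Cochain.ofHom (homComplexMap (k := k) F g) = postcomp F (Cochain.ofHom g) :=
  Cochain.ext₀ _ _ fun _ => Cochain.ofHom_v _ _

end Comp

section Functor

open DGModule

variable [CharP k 2] (hz : ∀ i, z i * z i = 0)

/-- The differential graded `S`-module `Hom(J, M)`, with `(s f)(x) = f(s x)`. -/
abbrev homJ (M : CochainComplex (ModuleCat.{u} Λ) ℤ) : DGModule (polyDG k r) where
  X := homComplex k (bggJ (k := k) z hz) M
  act p :=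
    { toFun := fun s => precomp (zetaLin z hz p s) M
      map_add' := fun s t => by rw [map_add, precomp_add]
      map_smul' := fun c s => by rw [map_smul, precomp_smul, RingHom.id_apply] }
  act_one := (congrArg (fun c => precomp c M) (zetaFun_one z hz)).trans precomp_id
  act_mul {p q n} h s t :=
    (congrArg (fun c => precomp c M) ((congrArg (zetaFun z hz) (Subtype.ext (mul_comm _ _))).trans
      (zetaFun_mul z hz ((add_comm q p).trans h) t s))).trans (precomp_comp _ _ _)
  leibniz {p} s := (δ_precomp _ (δ_zetaFun z hz s)).trans
    ((congrArg (fun c => precomp c M) (map_zero (zetaLin z hz (p + 1)))).trans precomp_zero).symm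

lemma homJ_postcomp_linear {M N : CochainComplex (ModuleCat.{u} Λ) ℤ} {n : ℤ} (c : Cochain M N n) :
    IsLinear (homJ (k := k) z hz M) (homJ (k := k) z hz N) (postcomp _ c) := by
  intro p m h s
  rw [units_smul_cochain (k := k)]
  exact precomp_postcomp _ _ _

/-- The functor `Hom(J, -)` from complexes of `Λ`-modules to differential graded `S`-modules. -/
abbrev homJFunctor : CochainComplex (ModuleCat.{u} Λ) ℤ ⥤ DGModule (polyDG k r) where
  obj M := homJ z hz M
  map {M N} g := ⟨homComplexMap _ g, by
    rw [ofHom_homComplexMap]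
    exact homJ_postcomp_linear z hz (Cochain.ofHom g)⟩
  map_id M := hom_ext (HomologicalComplex.hom_ext _ _ fun n =>
    ModuleCat.hom_ext (LinearMap.ext fun f => Cochain.comp_id (show Cochain _ M n from f)))
  map_comp {M N P} g h := hom_ext (HomologicalComplex.hom_ext _ _ fun n =>
    ModuleCat.hom_ext (LinearMap.ext fun f => by
      obtain ⟨f, rfl⟩ : ∃ g : Cochain _ M n, g = f := ⟨f, rfl⟩
      change f.comp (Cochain.ofHom (g ≫ h)) (add_zero n) =
        (f.comp (Cochain.ofHom g) (add_zero n)).comp (Cochain.ofHom h) (add_zero n)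
      rw [Cochain.ofHom_comp, Cochain.comp_assoc_of_third_is_zero_cochain]))

lemma homJFunctor_homotopic {M N : CochainComplex (ModuleCat.{u} Λ) ℤ} {f g : M ⟶ N}
    (h : Homotopy f g) : homotopic _ ((homJFunctor (k := k) z hz).map f)
      ((homJFunctor (k := k) z hz).map g) := by
  obtain ⟨c, hc⟩ := Cochain.equivHomotopy _ _ h
  refine ⟨postcomp _ c, homJ_postcomp_linear z hz c, ?_⟩
  change Cochain.ofHom (homComplexMap _ f) = _ + Cochain.ofHom (homComplexMap _ g)
  rw [ofHom_homComplexMap, ofHom_homComplexMap, hc, postcomp_add, δ_postcomp (neg_add_cancel 1)]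

/-- The functor `Hom(J, -)` from the homotopy category of complexes of `Λ`-modules to the homotopy
category of differential graded `S`-modules. -/
abbrev homJHtpy : HomotopyCategory (ModuleCat.{u} Λ) (ComplexShape.up ℤ) ⥤ HtpyCat (polyDG k r) :=
  CategoryTheory.Quotient.lift _ (homJFunctor z hz ⋙ htpyQuotient _) (by
    rintro M N f g ⟨h⟩
    exact htpy_map_eq (homJFunctor_homotopic z hz h))

/-- The functor `Hom(J, -)` from the homotopy category of complexes of injective `Λ`-modules to
the derived category of differential graded `S`-modules. -/
abbrev homJInj : HomotopyCategory (InjectiveObject (ModuleCat.{u} Λ)) (ComplexShape.up ℤ) ⥤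
    DerCat (polyDG k r) :=
  (InjectiveObject.ι (ModuleCat.{u} Λ)).mapHomotopyCategory (ComplexShape.up ℤ) ⋙
    homJHtpy z hz ⋙ derQ (polyDG k r)

end Functor

end BGG

section HomJShift

open DGModule

section

variable {k : Type u} [Field k] {C : Type*} [Category.{u} C] [Preadditive C] [Linear k C]
  (F M : CochainComplex C ℤ)

variable (k) in
/-- The isomorphism `Hom(F, M⟦a⟧) ≅ Hom(F, M)⟦a⟧`, which is the identity on underlying maps. -/
def homComplexShiftIso (a : ℤ) : homComplex k F (M⟦a⟧) ≅ (homComplex k F M)⟦a⟧ :=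
  HomologicalComplex.Hom.isoOfComponents (fun n =>
    ((Cochain.rightShiftLinearEquiv k F M (n + a) a n rfl).symm.toModuleIso :
      ModuleCat.of k (Cochain F (M⟦a⟧) n) ≅ ModuleCat.of k (Cochain F M (n + a))))
    (fun n m h => by
      refine ModuleCat.hom_ext (LinearMap.ext fun f => ?_)
      obtain ⟨f, rfl⟩ : ∃ g : Cochain F (M⟦a⟧) n, g = f := ⟨f, rfl⟩
      change a.negOnePow • δ (n + a) (m + a) (f.rightUnshift (n + a) rfl) =
        (δ n m f).rightUnshift (m + a) rfl
      rw [Cochain.δ_rightUnshift f (n + a) rfl (m + a) m rfl, smul_smul, Int.units_mul_self,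
        one_smul])

lemma homComplexShiftIso_hom_apply (a n : ℤ) (f : Cochain F (M⟦a⟧) n) :
    ((homComplexShiftIso k F M a).hom.f n).hom f = f.rightUnshift (n + a) rfl := rfl

variable {F M}

lemma homComplex_XIsoOfEq_v {n m : ℤ} (h : n = m) (f : Cochain F M n) (p q : ℤ) (hp : p + m = q) :
    Cochain.v (show Cochain F M m from ((homComplex k F M).XIsoOfEq h).hom.hom f) p q hp =
      f.v p q (by omega) := by
  subst h
  simp
  rfl

lemma rightUnshift_v_self (a n : ℤ) (f : Cochain F (M⟦a⟧) n) (p q : ℤ) (h : p + (n + a) = q)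
    (q' : ℤ) (h' : p + n = q') :
    (f.rightUnshift (n + a) rfl).v p q h = f.v p q' h' ≫
      (M.XIsoOfEq (show q' + a = q by omega)).hom :=
  Cochain.rightUnshift_v _ _ _ _ _ _ _ h'

lemma homComplexShiftIso_naturality {M N : CochainComplex C ℤ} (g : M ⟶ N) (a : ℤ) :
    homComplexMap (k := k) F (g⟦a⟧') ≫ (homComplexShiftIso k F N a).hom =
      (homComplexShiftIso k F M a).hom ≫ (homComplexMap (k := k) F g)⟦a⟧' := by
  refine HomologicalComplex.hom_ext _ _ fun n => ModuleCat.hom_ext (LinearMap.ext fun f => ?_)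
  obtain ⟨f, rfl⟩ : ∃ g : Cochain F (M⟦a⟧) n, g = f := ⟨f, rfl⟩
  change (f.comp (Cochain.ofHom (g⟦a⟧')) (add_zero n)).rightUnshift (n + a) rfl =
    (f.rightUnshift (n + a) rfl).comp (Cochain.ofHom g) (add_zero _)
  refine Cochain.ext _ _ fun p q h => ?_
  rw [Cochain.comp_zero_cochain_v, rightUnshift_v_self _ _ _ p q h (p + n) rfl,
    rightUnshift_v_self _ _ _ p q h (p + n) rfl, Cochain.comp_zero_cochain_v]
  have e : ∀ {i j : ℤ} (hij : i = j), (g.f i) ≫ (N.XIsoOfEq hij).hom =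
      (M.XIsoOfEq hij).hom ≫ g.f j := by
    rintro i _ rfl
    simp
  rw [Cochain.ofHom_v, Cochain.ofHom_v]
  exact (Category.assoc _ _ _).trans ((congrArg (fun t => f.v p (p + n) rfl ≫ t)
    (e (show p + n + a = q by omega))).trans (Category.assoc _ _ _).symm)

lemma homComplexShiftIso_zero (M : CochainComplex C ℤ) :
    (homComplexShiftIso k F M 0).hom =
      homComplexMap F ((shiftFunctorZero (CochainComplex C ℤ) ℤ).hom.app M) ≫
        (shiftFunctorZero (CochainComplex (ModuleCat.{u} k) ℤ) ℤ).inv.app (homComplex k F M) := by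
  refine HomologicalComplex.hom_ext _ _ fun n => ModuleCat.hom_ext (LinearMap.ext fun f => ?_)
  obtain ⟨f, rfl⟩ : ∃ g : Cochain F (M⟦(0 : ℤ)⟧) n, g = f := ⟨f, rfl⟩
  refine Cochain.ext _ _ fun p q h => ?_
  have hq : p + (n + 0) = q := h
  refine (rightUnshift_v_self _ _ _ p q h (p + n) rfl).trans ?_
  refine Eq.trans ?_ (homComplex_XIsoOfEq_v (k := k) (show n = n + 0 by omega)
    (f.comp (Cochain.ofHom ((shiftFunctorZero (CochainComplex C ℤ) ℤ).hom.app M)) (add_zero n))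
      p q h).symm
  obtain rfl : p + n = q := by omega
  rw [Cochain.comp_zero_cochain_v, Cochain.ofHom_v, CochainComplex.shiftFunctorZero_hom_app_f]

lemma comp_aux₃ {C : Type*} [Category C] {X Y Y₁ Y₂ Z : C} {u : X ⟶ Y} {w : Y ⟶ Z} {a : Y ⟶ Y₁} {b : Y₁ ⟶ Y₂} {c : Y₂ ⟶ Z}
    (h : w = a ≫ b ≫ c) : u ≫ w = ((u ≫ a) ≫ b) ≫ c := by
  simp [h]

lemma XIsoOfEq_comp₃ (M : CochainComplex C ℤ) {i₁ i₂ i₃ i₄ : ℤ} (h : i₁ = i₄) (h₁ : i₁ = i₂)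
    (h₂ : i₂ = i₃) (h₃ : i₃ = i₄) : (M.XIsoOfEq h).hom =
      (M.XIsoOfEq h₁).hom ≫ (M.XIsoOfEq h₂).hom ≫ (M.XIsoOfEq h₃).hom := by
  subst h₁ h₂ h₃
  simp

lemma homComplexShiftIso_add (M : CochainComplex C ℤ) (a b : ℤ) :
    (homComplexShiftIso k F M (a + b)).hom =
      homComplexMap F ((shiftFunctorAdd (CochainComplex C ℤ) a b).hom.app M) ≫
        (homComplexShiftIso k F (M⟦a⟧) b).hom ≫ (homComplexShiftIso k F M a).hom⟦b⟧' ≫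
        (shiftFunctorAdd (CochainComplex (ModuleCat.{u} k) ℤ) a b).inv.app (homComplex k F M) := by
  refine HomologicalComplex.hom_ext _ _ fun n => ModuleCat.hom_ext (LinearMap.ext fun f => ?_)
  obtain ⟨f, rfl⟩ : ∃ g : Cochain F (M⟦a + b⟧) n, g = f := ⟨f, rfl⟩
  refine Cochain.ext _ _ fun p q h => ?_
  have hq : p + (n + (a + b)) = q := h
  refine (rightUnshift_v_self _ _ _ p q h (p + n) rfl).trans ?_
  refine Eq.trans ?_ (homComplex_XIsoOfEq_v (k := k) (show n + b + a = n + (a + b) by omega)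
    (Cochain.rightUnshift (Cochain.rightUnshift (f.comp (Cochain.ofHom
      ((shiftFunctorAdd (CochainComplex C ℤ) a b).hom.app M)) (add_zero n)) (n + b) rfl)
        (n + b + a) rfl) p q h).symm
  rw [rightUnshift_v_self _ _ _ p q (by omega) (p + n + b) (by omega),
    rightUnshift_v_self _ _ _ p (p + n + b) (by omega) (p + n) rfl, Cochain.comp_zero_cochain_v,
    Cochain.ofHom_v, CochainComplex.shiftFunctorAdd_hom_app_f]
  exact comp_aux₃ (XIsoOfEq_comp₃ M (i₁ := p + n + (a + b)) (i₂ := p + n + b + a)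
    (i₃ := p + n + b + a) (i₄ := q) (by omega) (by omega) rfl (by omega))

end

variable {k : Type u} [Field k] {r : ℕ} {Λ : Type u} [CommRing Λ] [Algebra k Λ] (z : Fin r → Λ)
  [CharP k 2] (hz : ∀ i, z i * z i = 0)

lemma homJShiftIso_linear (M : CochainComplex (ModuleCat.{u} Λ) ℤ) (a : ℤ) :
    IsLinear (homJ (k := k) z hz (M⟦a⟧)) ((homJ (k := k) z hz M).shiftObj a)
      (Cochain.ofHom (homComplexShiftIso k _ M a).hom) := by
  intro p m h s
  rw [units_smul_cochain (k := k), shiftObj_act, units_smul_cochain (k := k)]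
  obtain rfl : m = p := by omega
  refine cochain_ext_apply fun i j hij f => ?_
  obtain ⟨f, rfl⟩ : ∃ g : Cochain _ (M⟦a⟧) i, g = f := ⟨f, rfl⟩
  rw [Cochain.comp_zero_cochain_v, Cochain.zero_cochain_comp_v, Cochain.ofHom_v, Cochain.ofHom_v,
    Cochain.shift_v']
  exact Cochain.rightUnshift_comp (zetaLin z hz m s) f ((add_comm m i).trans hij) (j + a) rfl (i + a) rfl

/-- The isomorphism `Hom(J, M⟦a⟧) ≅ Hom(J, M)⟦a⟧` of differential graded `S`-modules. -/
def homJShiftIso (M : CochainComplex (ModuleCat.{u} Λ) ℤ) (a : ℤ) :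
    (homJFunctor (k := k) z hz).obj (M⟦a⟧) ≅ ((homJFunctor (k := k) z hz).obj M)⟦a⟧ :=
  isoMk (homComplexShiftIso k _ M a) (homJShiftIso_linear z hz M a)

instance : (homJFunctor (k := k) z hz).CommShift ℤ where
  commShiftIso a := NatIso.ofComponents (fun M => homJShiftIso z hz M a)
    (fun g => hom_ext (homComplexShiftIso_naturality g a))
  commShiftIso_zero := by
    ext1
    ext1
    ext1 M
    rw [Functor.CommShift.isoZero_hom_app]
    exact hom_ext (homComplexShiftIso_zero M)
  commShiftIso_add a b := by
    ext1
    ext1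
    ext1 M
    rw [Functor.CommShift.isoAdd_hom_app]
    exact hom_ext (homComplexShiftIso_add M a b)

instance : (homJHtpy (k := k) z hz).CommShift ℤ :=
  CategoryTheory.Quotient.liftCommShift (homJFunctor (k := k) z hz ⋙ htpyQuotient _) _ ℤ _

end HomJShift

section GroupAlgebra

variable (k : Type u) [Field k] {E : Type u} [CommGroup E] {r : ℕ}

/-- The elements `z_i = g_i - 1` of the group algebra `kE`. -/
def groupZ (g : Fin r → E) (i : Fin r) : MonoidAlgebra k E := MonoidAlgebra.of k E (g i) - 1

lemma groupZ_mul_self [CharP k 2] (hE : ∀ a : E, a ^ 2 = 1) (g : Fin r → E) (i : Fin r) :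
    groupZ k g i * groupZ k g i = 0 := by
  have h2 : (2 : MonoidAlgebra k E) = 0 := by
    rw [← map_ofNat (algebraMap k (MonoidAlgebra k E)) 2,
      show (OfNat.ofNat 2 : k) = 0 from CharTwo.two_eq_zero, map_zero]
  have h : MonoidAlgebra.of k E (g i) * MonoidAlgebra.of k E (g i) = 1 := by
    rw [← map_mul, ← pow_two, hE, map_one]
  calc groupZ k g i * groupZ k g i
      = MonoidAlgebra.of k E (g i) * MonoidAlgebra.of k E (g i) + 1
        - 2 * MonoidAlgebra.of k E (g i) := by unfold groupZ; ring
    _ = 1 + 1 - 2 * MonoidAlgebra.of k E (g i) := by rw [h]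
    _ = 0 := by rw [one_add_one_eq_two, h2]; simp

end GroupAlgebra

end

/-!
Write `σ` for the top monomial `z_1 ⋯ z_r` and `Λ = k[z_1, …, z_r]/(z_i ^ 2)`. The complex `J` is
an injective resolution of the trivial module `k`, embedded as `k σ ⊗ 1`. Hence, for a complex `M`
of injective modules, evaluation at `σ ⊗ 1` is a quasi-isomorphism from `Hom(J, M)` to the complex
`soc M` of socles `{m | z_i m = 0 for all i}`. If `soc M` is acyclic then `M` is contractible,
because every `Λ`-module has a finite filtration with trivial quotients; so `Hom(J, -)` detects
isomorphisms. It has the left adjoint `J ⊗_S -`, and the unit `N ⟶ Hom(J, J ⊗_S N)` followed by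
evaluation is `v ↦ σ ⊗ v`, an isomorphism onto the socle of `Λ ⊗ N`; hence the unit is a
quasi-isomorphism and `J ⊗_S -` is a localization functor. The case `N = S` gives `ζ`.
-/

noncomputable section

open CategoryTheory CategoryTheory.Limits CategoryTheory.Pretriangulated
open CochainComplex.HomComplex
open scoped TensorProduct

section SquareFreeBasis

/-- The square-free monomials in elements `z i` of square zero form a basis `b` of `Λ`: this is
how `Λ` is presented as `k[z i]/(z i ^ 2)`. -/
structure IsSquareFreeBasis {k Λ ι : Type*} [CommRing k] [CommRing Λ] [Algebra k Λ]
    (z : ι → Λ) (b : Module.Basis (Finset ι) k Λ) : Prop where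
  eq_prod (I : Finset ι) : b I = ∏ i ∈ I, z i
  mul_self (i : ι) : z i * z i = 0

/-- The elements of a `Λ`-module killed by all the `z i`. When the `z i` generate the maximal ideal
of a local ring `Λ`, this is the socle in the usual sense. -/
def socle {Λ ι : Type*} [CommRing Λ] (z : ι → Λ) (M : Type*) [AddCommGroup M] [Module Λ M] :
    Submodule Λ M :=
  Submodule.torsionBySet Λ M (Set.range z)

lemma mem_socle_iff {Λ ι M : Type*} [CommRing Λ] {z : ι → Λ} [AddCommGroup M] [Module Λ M]
    {m : M} : m ∈ socle z M ↔ ∀ i, z i • m = 0 := by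
  rw [socle, Submodule.mem_torsionBySet_iff, Set.forall_subtype_range_iff]

/-- The coefficient in `V` of the top monomial `b univ`. For `V = k` this is the linear form which
makes `Λ` a Frobenius algebra. -/
def topCoord {k Λ ι : Type*} [CommRing k] [CommRing Λ] [Algebra k Λ] [Fintype ι]
    (b : Module.Basis (Finset ι) k Λ) (V : Type*) [AddCommGroup V] [Module k V] :
    Λ ⊗[k] V →ₗ[k] V :=
  (TensorProduct.lid k V).toLinearMap ∘ₗ (b.coord Finset.univ).rTensor V

variable {k Λ ι : Type*} [CommRing k] [CommRing Λ] [Algebra k Λ] {z : ι → Λ}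
  {b : Module.Basis (Finset ι) k Λ} {V : Type*} [AddCommGroup V] [Module k V]

lemma topCoord_tmul [Fintype ι] (a : Λ) (v : V) :
    topCoord b V (a ⊗ₜ v) = b.coord Finset.univ a • v := rfl

lemma topCoord_univ_tmul [Fintype ι] (v : V) : topCoord b V (b Finset.univ ⊗ₜ v) = v := by
  rw [topCoord_tmul, b.coord_apply, b.repr_self, Finsupp.single_eq_same, one_smul]

namespace IsSquareFreeBasis

lemma apply_empty (hb : IsSquareFreeBasis z b) : b ∅ = 1 := by
  rw [hb.eq_prod, Finset.prod_empty]

lemma z_mul [DecidableEq ι] (hb : IsSquareFreeBasis z b) (i : ι) (I : Finset ι) :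
    z i * b I = if i ∈ I then 0 else b (insert i I) := by
  split_ifs with hi
  · rw [hb.eq_prod, ← Finset.mul_prod_erase I z hi, ← mul_assoc, hb.mul_self, zero_mul]
  · rw [hb.eq_prod, hb.eq_prod, Finset.prod_insert hi]

lemma apply_mul_apply [DecidableEq ι] (hb : IsSquareFreeBasis z b) (I J : Finset ι) :
    b I * b J = if Disjoint I J then b (I ∪ J) else 0 := by
  split_ifs with h
  · simp only [hb.eq_prod, Finset.prod_union h]
  · obtain ⟨i, hiI, hiJ⟩ := Finset.not_disjoint_iff.1 h
    rw [hb.eq_prod I, ← Finset.mul_prod_erase I z hiI, mul_right_comm, hb.z_mul, if_pos hiJ,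
      zero_mul]

lemma apply_smul_eq_zero (hb : IsSquareFreeBasis z b) {M : Type*} [AddCommGroup M] [Module Λ M]
    {m : M} (hm : m ∈ socle z M) {I : Finset ι} (hI : I.Nonempty) : b I • m = 0 := by
  classical
  obtain ⟨i, hi⟩ := hI
  rw [hb.eq_prod, ← Finset.prod_erase_mul I z hi, mul_smul, mem_socle_iff.1 hm, smul_zero]

lemma smul_eq_coord_smul (hb : IsSquareFreeBasis z b) {M : Type*} [AddCommGroup M] [Module k M]
    [Module Λ M] [IsScalarTower k Λ M] {m : M} (hm : m ∈ socle z M) (a : Λ) :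
    a • m = b.coord ∅ a • m := by
  suffices h : (LinearMap.toSpanSingleton Λ M m).restrictScalars k = (b.coord ∅).smulRight m from
    LinearMap.congr_fun h a
  refine b.ext fun I => ?_
  change b I • m = b.coord ∅ (b I) • m
  rw [b.coord_apply, b.repr_self]
  obtain rfl | hI := I.eq_empty_or_nonempty
  · rw [hb.apply_empty, Finsupp.single_eq_same, one_smul, one_smul]
  · rw [hb.apply_smul_eq_zero hm hI, Finsupp.single_eq_of_ne hI.ne_empty.symm, zero_smul]

section Frobenius

variable [Fintype ι]

lemma univ_mem_socle (hb : IsSquareFreeBasis z b) : b Finset.univ ∈ socle z Λ :=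
  mem_socle_iff.2 fun i => by
    classical rw [smul_eq_mul, hb.z_mul, if_pos (Finset.mem_univ i)]

lemma univ_tmul_mem_socle (hb : IsSquareFreeBasis z b) (v : V) :
    b Finset.univ ⊗ₜ v ∈ socle z (Λ ⊗[k] V) :=
  mem_socle_iff.2 fun i => by
    rw [TensorProduct.smul_tmul', mem_socle_iff.1 hb.univ_mem_socle, TensorProduct.zero_tmul]

lemma coord_univ_compl_mul [DecidableEq ι] (hb : IsSquareFreeBasis z b) (I : Finset ι) (a : Λ) :
    b.coord Finset.univ (b Iᶜ * a) = b.coord I a := by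
  suffices h : b.coord Finset.univ ∘ₗ LinearMap.mulLeft k (b Iᶜ) = b.coord I from
    LinearMap.congr_fun h a
  refine b.ext fun J => ?_
  change b.coord Finset.univ (b Iᶜ * b J) = _
  rw [hb.apply_mul_apply]
  by_cases h : J ⊆ I
  · have hJ : Iᶜ ∪ J = Finset.univ ↔ J = I := by
      refine ⟨fun e => h.antisymm fun i hi => ?_, ?_⟩
      · have hi' := e.ge (Finset.mem_univ i)
        rwa [Finset.mem_union, Finset.mem_compl, or_iff_right (not_not.2 hi)] at hi'
      · rintro rfl
        exact compl_sup_eq_top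
    rw [if_pos (disjoint_compl_left_iff.2 h)]
    simp only [b.coord_apply, b.repr_self, Finsupp.single_apply, hJ]
  · rw [if_neg (mt disjoint_compl_left_iff.1 h), map_zero, b.coord_apply, b.repr_self,
      Finsupp.single_eq_of_ne]
    rintro rfl
    exact h Finset.Subset.rfl

lemma sum_tmul_topCoord [DecidableEq ι] (hb : IsSquareFreeBasis z b) (x : Λ ⊗[k] V) :
    ∑ I, b I ⊗ₜ[k] topCoord b V (b Iᶜ • x) = x := by
  induction x with
  | zero => simp only [smul_zero, map_zero, TensorProduct.tmul_zero, Finset.sum_const_zero]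
  | add x y hx hy =>
    simp only [smul_add, map_add, TensorProduct.tmul_add, Finset.sum_add_distrib, hx, hy]
  | tmul a v =>
    simp only [TensorProduct.smul_tmul', smul_eq_mul, topCoord_tmul, hb.coord_univ_compl_mul,
      ← TensorProduct.smul_tmul, ← TensorProduct.sum_tmul]
    rw [← b.sum_repr a]
    simp only [b.sum_repr, b.coord_apply]

lemma ext_topCoord (hb : IsSquareFreeBasis z b) {x y : Λ ⊗[k] V}
    (h : ∀ a : Λ, topCoord b V (a • x) = topCoord b V (a • y)) : x = y := by
  classical
  rw [← hb.sum_tmul_topCoord x, ← hb.sum_tmul_topCoord y]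
  simp only [h]

lemma eq_univ_tmul_topCoord (hb : IsSquareFreeBasis z b) {x : Λ ⊗[k] V}
    (hx : x ∈ socle z (Λ ⊗[k] V)) : x = b Finset.univ ⊗ₜ topCoord b V x := by
  classical
  conv_lhs => rw [← hb.sum_tmul_topCoord x]
  rw [Finset.sum_eq_single_of_mem Finset.univ (Finset.mem_univ _), Finset.compl_univ,
    hb.apply_empty, one_smul]
  intro I _ hI
  rw [hb.apply_smul_eq_zero hx (Finset.compl_ne_univ_iff_nonempty _ |>.1 (by simpa using hI)),
    map_zero, TensorProduct.tmul_zero]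

lemma topCoord_compl_smul_sum [DecidableEq ι] (hb : IsSquareFreeBasis z b) (f : Λ →ₗ[k] V)
    (a : Λ) :
    topCoord b V (a • ∑ I, b I ⊗ₜ[k] f (b Iᶜ)) = f a := by
  suffices h : topCoord b V ∘ₗ (LinearMap.toSpanSingleton Λ _
      (∑ I, b I ⊗ₜ[k] f (b Iᶜ))).restrictScalars k = f from LinearMap.congr_fun h a
  refine b.ext fun J => ?_
  change topCoord b V (b J • _) = _
  simp only [Finset.smul_sum, TensorProduct.smul_tmul', smul_eq_mul, map_sum, topCoord_tmul]
  rw [← compl_compl J]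
  simp only [hb.coord_univ_compl_mul, b.coord_apply, b.repr_self]
  rw [Finset.sum_eq_single_of_mem Jᶜ (Finset.mem_univ _) fun I _ hI => by
    rw [Finsupp.single_eq_of_ne hI.symm, zero_smul], Finsupp.single_eq_same, one_smul]

end Frobenius

end IsSquareFreeBasis

end SquareFreeBasis

section InjectiveModules

variable {k Λ : Type u} [CommRing k] [CommRing Λ] [Algebra k Λ] {ι : Type*}
  {z : ι → Λ} {b : Module.Basis (Finset ι) k Λ}

namespace IsSquareFreeBasis

lemma injective_tensor [Finite ι] (hb : IsSquareFreeBasis z b) (V : Type u) [AddCommGroup V]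
    [Module k V] [Module.Injective k V] : Module.Injective Λ (Λ ⊗[k] V) := by
  classical
  have := Fintype.ofFinite ι
  refine Module.Baer.injective fun I g => ?_
  obtain ⟨f, hf⟩ := Module.Injective.extension_property k V (I.restrictScalars k) Λ
    (I.subtype.restrictScalars k) Subtype.val_injective
    (topCoord b V ∘ₗ g.restrictScalars k)
  refine ⟨LinearMap.toSpanSingleton Λ _ (∑ J, b J ⊗ₜ f (b Jᶜ)), fun a ha => ?_⟩
  refine hb.ext_topCoord fun c => ?_
  rw [LinearMap.toSpanSingleton_apply, ← mul_smul, hb.topCoord_compl_smul_sum, ← map_smul]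
  exact LinearMap.congr_fun hf ⟨c * a, I.mul_mem_left c ha⟩

lemma exists_univ_smul_eq [Fintype ι] (hb : IsSquareFreeBasis z b) {M : Type u}
    [AddCommGroup M] [Module k M] [Module Λ M] [IsScalarTower k Λ M] [Module.Injective Λ M]
    {m : M} (hm : m ∈ socle z M) : ∃ y : M, b Finset.univ • y = m := by
  let f : Λ →ₗ[Λ] M := LinearMap.toSpanSingleton Λ M m
  let g : Λ →ₗ[Λ] Λ := LinearMap.toSpanSingleton Λ Λ (b Finset.univ)
  have hfg : LinearMap.ker g ≤ LinearMap.ker f := by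
    intro a ha
    have h : b.coord ∅ a • b Finset.univ = 0 :=
      (hb.smul_eq_coord_smul hb.univ_mem_socle a).symm.trans ha
    have h' : b.coord ∅ a = 0 := by
      simpa using congrArg (b.coord Finset.univ) h
    change a • m = 0
    rw [hb.smul_eq_coord_smul hm, h', zero_smul]
  obtain ⟨h, hh⟩ := Module.Injective.out ((LinearMap.ker g).liftQ g le_rfl)
    (LinearMap.ker_eq_bot.1 (Submodule.ker_liftQ_eq_bot _ _ _ le_rfl))
    ((LinearMap.ker g).liftQ f hfg)
  refine ⟨h 1, ?_⟩
  have e : h (g 1) = f 1 := hh (Submodule.Quotient.mk 1)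
  rw [← map_smul, smul_eq_mul, mul_one]
  simpa [f, g] using e

end IsSquareFreeBasis

end InjectiveModules

section GroupAlgebra

lemma span_range_prod_eq_adjoin {k Λ ι : Type*} [CommSemiring k] [CommSemiring Λ] [Algebra k Λ]
    {z : ι → Λ} (hz : ∀ i, z i * z i = 0) :
    Submodule.span k (Set.range fun I : Finset ι => ∏ i ∈ I, z i) =
      Subalgebra.toSubmodule (Algebra.adjoin k (Set.range z)) := by
  classical
  refine le_antisymm (Submodule.span_le.2 ?_) ?_
  · rintro _ ⟨I, rfl⟩
    exact Subalgebra.prod_mem _ fun i _ => Algebra.subset_adjoin ⟨i, rfl⟩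
  rw [Algebra.adjoin_eq_span, Submodule.span_le]
  intro x hx
  suffices h : x = 0 ∨ ∃ I : Finset ι, ∏ i ∈ I, z i = x by
    obtain rfl | h := h
    · exact Submodule.zero_mem _
    · exact Submodule.subset_span h
  induction hx using Submonoid.closure_induction_left with
  | one => exact Or.inr ⟨∅, Finset.prod_empty⟩
  | mul_left x hx y _ ih =>
    obtain ⟨i, rfl⟩ := hx
    obtain rfl | ⟨I, rfl⟩ := ih
    · exact Or.inl (mul_zero _)
    by_cases hi : i ∈ I
    · rw [← Finset.mul_prod_erase I z hi, ← mul_assoc, hz, zero_mul]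
      exact Or.inl rfl
    · exact Or.inr ⟨insert i I, Finset.prod_insert hi⟩

variable (k : Type u) [Field k] {E : Type u} [CommGroup E] {r : ℕ}

lemma adjoin_range_groupZ_eq_top (hE : ∀ a : E, a ^ 2 = 1) {g : Fin r → E}
    (hg : Subgroup.closure (Set.range g) = ⊤) :
    Algebra.adjoin k (Set.range (groupZ k g)) = ⊤ := by
  let S := Algebra.adjoin k (Set.range (groupZ k g))
  have hof (a : E) : MonoidAlgebra.of k E a ∈ S := by
    have ha : a ∈ Subgroup.closure (Set.range g) := hg ▸ Subgroup.mem_top a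
    induction ha using Subgroup.closure_induction with
    | mem a ha =>
      obtain ⟨i, rfl⟩ := ha
      rw [← sub_add_cancel (MonoidAlgebra.of k E (g i)) 1]
      exact S.add_mem (Algebra.subset_adjoin ⟨i, rfl⟩) S.one_mem
    | one => exact map_one (MonoidAlgebra.of k E) ▸ S.one_mem
    | mul a b _ _ ha hb => exact map_mul (MonoidAlgebra.of k E) a b ▸ S.mul_mem ha hb
    | inv a _ ha => rwa [inv_eq_of_mul_eq_one_left (by rw [← pow_two, hE])]
  refine eq_top_iff.2 fun x _ => ?_
  induction x using MonoidAlgebra.induction_on with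
  | of a => exact hof a
  | add x y hx hy => exact S.add_mem (hx trivial) (hy trivial)
  | smul c x hx => exact S.smul_mem (hx trivial) c

lemma exists_isSquareFreeBasis_groupZ [CharP k 2] (hE : ∀ a : E, a ^ 2 = 1)
    (hcard : Nat.card E = 2 ^ r) {g : Fin r → E} (hg : Subgroup.closure (Set.range g) = ⊤) :
    ∃ b : Module.Basis (Finset (Fin r)) k (MonoidAlgebra k E),
      IsSquareFreeBasis (groupZ k g) b := by
  have : Finite E := Nat.finite_of_card_ne_zero (by rw [hcard]; positivity)
  have := Fintype.ofFinite E
  have hspan :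
      ⊤ ≤ Submodule.span k (Set.range fun I : Finset (Fin r) => ∏ i ∈ I, groupZ k g i) := by
    rw [span_range_prod_eq_adjoin (groupZ_mul_self k hE g), adjoin_range_groupZ_eq_top k hE hg,
      Algebra.top_toSubmodule]
  have hfinrank : Fintype.card (Finset (Fin r)) = Module.finrank k (MonoidAlgebra k E) := by
    rw [Module.finrank_eq_card_basis (MonoidAlgebra.basis E k), Fintype.card_finset,
      Fintype.card_fin, ← hcard, Nat.card_eq_fintype_card]
  exact ⟨basisOfTopLeSpanOfCardEqFinrank _ hspan hfinrank,
    congrFun (coe_basisOfTopLeSpanOfCardEqFinrank _ hspan hfinrank), groupZ_mul_self k hE g⟩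

end GroupAlgebra

lemma add_self_eq_zero_of_charTwo (k : Type*) {V : Type*} [Semiring k] [CharP k 2]
    [AddCommMonoid V] [Module k V] (v : V) : v + v = 0 := by
  rw [← two_smul k, CharTwo.two_eq_zero, zero_smul]

section PartialDeriv

variable {k Λ ι : Type*} [CommRing k] [CommRing Λ] [Algebra k Λ] [DecidableEq ι] {z : ι → Λ}
  (b : Module.Basis (Finset ι) k Λ)

/-- The partial derivative of `Λ = k[z i]/(z i ^ 2)` with respect to `z j`. -/
def partialDeriv (j : ι) : Λ →ₗ[k] Λ :=
  b.constr k fun I => if j ∈ I then b (I.erase j) else 0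

lemma partialDeriv_apply_basis (j : ι) (I : Finset ι) :
    partialDeriv b j (b I) = if j ∈ I then b (I.erase j) else 0 :=
  b.constr_basis _ _ _

namespace IsSquareFreeBasis

variable {b}

lemma partialDeriv_mul_of_ne (hb : IsSquareFreeBasis z b) {i j : ι} (hij : i ≠ j) (a : Λ) :
    partialDeriv b j (z i * a) = z i * partialDeriv b j a := by
  suffices h : partialDeriv b j ∘ₗ LinearMap.mulLeft k (z i) =
      LinearMap.mulLeft k (z i) ∘ₗ partialDeriv b j from LinearMap.congr_fun h a
  refine b.ext fun I => ?_
  simp only [LinearMap.comp_apply, LinearMap.mulLeft_apply, hb.z_mul, partialDeriv_apply_basis]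
  by_cases hi : i ∈ I <;> by_cases hj : j ∈ I <;>
    simp [hi, hj, partialDeriv_apply_basis, hb.z_mul, hij, hij.symm, Finset.erase_insert_of_ne]

lemma partialDeriv_mul_self_add (hb : IsSquareFreeBasis z b) (j : ι) (a : Λ) :
    partialDeriv b j (z j * a) + z j * partialDeriv b j a = a := by
  suffices h : partialDeriv b j ∘ₗ LinearMap.mulLeft k (z j) +
      LinearMap.mulLeft k (z j) ∘ₗ partialDeriv b j = LinearMap.id from LinearMap.congr_fun h a
  refine b.ext fun I => ?_
  simp only [LinearMap.add_apply, LinearMap.comp_apply, LinearMap.mulLeft_apply, hb.z_mul,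
    partialDeriv_apply_basis]
  by_cases hj : j ∈ I <;> simp [hj, partialDeriv_apply_basis, hb.z_mul]

end IsSquareFreeBasis

end PartialDeriv

section PolynomialOperators

variable {k : Type u} [Field k] {r : ℕ}

lemma degree_eq_of_coeff_ne_zero {n : ℤ} (t : polyDeg k r n) {d : Fin r →₀ ℕ}
    (hd : t.1.coeff d ≠ 0) : (d.degree : ℤ) = n := by
  rw [← t.2 hd, Finsupp.weight_apply, Finsupp.degree_apply, Nat.cast_sum, Finsupp.sum]
  simp only [nsmul_eq_mul, mul_one]

lemma polyDeg_eq_zero_of_neg {n : ℤ} (hn : n < 0) (t : polyDeg k r n) : t = 0 := by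
  refine Subtype.ext (MvPolynomial.ext _ _ fun d => ?_)
  by_contra hd
  have := degree_eq_of_coeff_ne_zero t hd
  omega

lemma tensor_polyDeg_eq_zero_of_neg {Λ : Type*} [AddCommGroup Λ] [Module k Λ] {n : ℤ} (hn : n < 0)
    (x : Λ ⊗[k] polyDeg k r n) : x = 0 := by
  have : Subsingleton (polyDeg k r n) :=
    subsingleton_of_forall_eq 0 (polyDeg_eq_zero_of_neg hn)
  exact Subsingleton.elim x 0

lemma exists_eq_smul_polyOne (t : polyDeg k r 0) : ∃ c : k, t = c • polyOne k r := by
  refine ⟨t.1.coeff 0, Subtype.ext (MvPolynomial.ext _ _ fun d => ?_)⟩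
  change _ = MvPolynomial.coeff d (t.1.coeff 0 • (1 : MvPolynomial (Fin r) k))
  rw [MvPolynomial.coeff_smul, MvPolynomial.coeff_one, smul_eq_mul, mul_ite, mul_one, mul_zero]
  split_ifs with hd
  · rw [hd]
  · by_contra h
    have hdeg := degree_eq_of_coeff_ne_zero t h
    exact hd ((Finsupp.degree_eq_zero_iff d).1 (by exact_mod_cast hdeg)).symm

/-- The quotient of the division by `x_j`. -/
def polyDivVar (j : Fin r) {n m : ℤ} (h : n + 1 = m) : polyDeg k r m →ₗ[k] polyDeg k r n where
  toFun s := ⟨s.1.divMonomial (Finsupp.single j 1), fun d hd => by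
    rw [MvPolynomial.coeff_divMonomial] at hd
    have := s.2 hd
    rw [map_add, Finsupp.weight_single, one_smul] at this
    omega⟩
  map_add' s t := Subtype.ext (MvPolynomial.add_divMonomial _ _ _)
  map_smul' c s := Subtype.ext (MvPolynomial.ext _ _ fun d => by
    change MvPolynomial.coeff d (MvPolynomial.divMonomial (c • s.1) _) =
      MvPolynomial.coeff d (c • MvPolynomial.divMonomial s.1 _)
    simp only [MvPolynomial.coeff_smul, MvPolynomial.coeff_divMonomial])

lemma coeff_modMonomial {σ R : Type*} [CommSemiring R] (s d : σ →₀ ℕ) [Decidable (s ≤ d)]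
    (p : MvPolynomial σ R) : (p.modMonomial s).coeff d = if s ≤ d then 0 else p.coeff d := by
  split_ifs with h
  · exact MvPolynomial.coeff_modMonomial_of_le _ h
  · exact MvPolynomial.coeff_modMonomial_of_not_le _ h

/-- The remainder of the division by `x_j`: the projection onto the span of the monomials in which
`x_j` does not occur. -/
def polyModVar (j : Fin r) (n : ℤ) : Module.End k (polyDeg k r n) where
  toFun s := ⟨s.1.modMonomial (Finsupp.single j 1), fun d hd => s.2 fun h => hd (by
    rw [coeff_modMonomial, h, ite_self])⟩
  map_add' s t := Subtype.ext (MvPolynomial.ext _ _ fun d => by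
    change MvPolynomial.coeff d (MvPolynomial.modMonomial (s.1 + t.1) _) =
      MvPolynomial.coeff d (MvPolynomial.modMonomial s.1 _ + MvPolynomial.modMonomial t.1 _)
    simp only [MvPolynomial.coeff_add, coeff_modMonomial]
    split_ifs <;> simp only [add_zero])
  map_smul' c s := Subtype.ext (MvPolynomial.ext _ _ fun d => by
    change MvPolynomial.coeff d (MvPolynomial.modMonomial (c • s.1) _) =
      MvPolynomial.coeff d (c • MvPolynomial.modMonomial s.1 _)
    simp only [MvPolynomial.coeff_smul, coeff_modMonomial, smul_ite, smul_zero])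

lemma coeff_polyModVar (j : Fin r) {n : ℤ} (t : polyDeg k r n) (d : Fin r →₀ ℕ) :
    (polyModVar j n t).1.coeff d = if Finsupp.single j 1 ≤ d then 0 else t.1.coeff d :=
  coeff_modMonomial _ _ _

lemma polyDivVar_var_mul (j : Fin r) {n m : ℤ} (h : n + 1 = m) (h' : 1 + n = m)
    (t : polyDeg k r n) : polyDivVar j h (polyMul h' (polyVar k r j) t) = t :=
  Subtype.ext (MvPolynomial.X_mul_divMonomial j t.1)

lemma var_mul_polyDivVar_add (j : Fin r) {n m : ℤ} (h : n + 1 = m) (h' : 1 + n = m)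
    (t : polyDeg k r m) : polyMul h' (polyVar k r j) (polyDivVar j h t) + polyModVar j m t = t :=
  Subtype.ext (MvPolynomial.divMonomial_add_modMonomial_single t.1 j)

lemma X_mul_divMonomial_of_ne {σ R : Type*} [CommSemiring R] {i j : σ} (hij : i ≠ j)
    (p : MvPolynomial σ R) : (MvPolynomial.X i * p).divMonomial (Finsupp.single j 1) =
      MvPolynomial.X i * p.divMonomial (Finsupp.single j 1) := by
  classical
  refine MvPolynomial.ext _ _ fun d => ?_
  have hi : i ∈ (Finsupp.single j 1 + d).support ↔ i ∈ d.support := by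
    rw [Finsupp.mem_support_iff, Finsupp.mem_support_iff, Finsupp.add_apply,
      Finsupp.single_eq_of_ne hij, zero_add]
  rw [MvPolynomial.coeff_divMonomial, MvPolynomial.coeff_X_mul', MvPolynomial.coeff_X_mul']
  simp only [hi]
  split_ifs with hd
  · rw [MvPolynomial.coeff_divMonomial, add_tsub_assoc_of_le]
    exact Finsupp.single_le_iff.2 (Nat.one_le_iff_ne_zero.2 (Finsupp.mem_support_iff.1 hd))
  · rfl

lemma polyDivVar_var_mul_of_ne {i j : Fin r} (hij : i ≠ j) {l n m : ℤ} (h : l + 1 = n)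
    (h' : n + 1 = m) (h₁ : 1 + n = m) (h₂ : 1 + l = n) (t : polyDeg k r n) :
    polyDivVar j h' (polyMul h₁ (polyVar k r i) t) =
      polyMul h₂ (polyVar k r i) (polyDivVar j h t) :=
  Subtype.ext (X_mul_divMonomial_of_ne hij t.1)

lemma commute_polyModVar (i j : Fin r) (n : ℤ) :
    Commute (polyModVar (k := k) i n) (polyModVar j n) := by
  refine LinearMap.ext fun t => Subtype.ext (MvPolynomial.ext _ _ fun d => ?_)
  simp only [Module.End.mul_apply, coeff_polyModVar]
  split_ifs <;> rfl

lemma isIdempotentElem_polyModVar (j : Fin r) (n : ℤ) :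
    IsIdempotentElem (polyModVar (k := k) j n) := by
  refine LinearMap.ext fun t => Subtype.ext (MvPolynomial.ext _ _ fun d => ?_)
  simp only [Module.End.mul_apply, coeff_polyModVar]
  split_ifs <;> rfl

lemma eq_zero_of_polyModVar_eq {n : ℤ} (hn : n ≠ 0) {t : polyDeg k r n}
    (ht : ∀ j, polyModVar j n t = t) : t = 0 := by
  refine Subtype.ext (MvPolynomial.ext _ _ fun d => ?_)
  by_contra hd
  obtain ⟨j, hj⟩ : ∃ j, d j ≠ 0 := by
    by_contra! h
    refine hn ?_
    rw [← degree_eq_of_coeff_ne_zero t hd, show d = 0 from Finsupp.ext h, map_zero,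
      Nat.cast_zero]
  refine hd ?_
  rw [← ht j, coeff_polyModVar, if_pos]
  · rfl
  · exact Finsupp.single_le_iff.2 (Nat.one_le_iff_ne_zero.2 hj)

end PolynomialOperators

section Koszul

variable {k : Type u} [Field k] {r : ℕ} {Λ : Type u} [CommRing Λ] [Algebra k Λ] {z : Fin r → Λ}
  (b : Module.Basis (Finset (Fin r)) k Λ)

/-- The contraction of `Λ ⊗ S` in the direction `j`. -/
def koszulHomotopy (j : Fin r) {n m : ℤ} (h : n + 1 = m) :
    Λ ⊗[k] polyDeg k r m →ₗ[k] Λ ⊗[k] polyDeg k r n :=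
  TensorProduct.map (partialDeriv b j) (polyDivVar j h)

variable (z) in
/-- The part of `Λ ⊗ S` spanned by the `b I ⊗ x ^ d` with `j ∈ I` and `d j = 0`, as a projection:
it is what remains after the contraction in the direction `j`. -/
def koszulProj (j : Fin r) (n : ℤ) : Module.End k (Λ ⊗[k] polyDeg k r n) :=
  TensorProduct.map (LinearMap.mulLeft k (z j) ∘ₗ partialDeriv b j) (polyModVar j n)

lemma lTensor_polyModVar_koszulProj_self (j : Fin r) {n : ℤ} (x : Λ ⊗[k] polyDeg k r n) :
    (polyModVar j n).lTensor Λ (koszulProj z b j n x) = koszulProj z b j n x := by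
  rw [koszulProj, LinearMap.lTensor, ← LinearMap.comp_apply, ← TensorProduct.map_comp,
    LinearMap.id_comp, ← Module.End.mul_eq_comp (polyModVar j n), isIdempotentElem_polyModVar]

lemma lTensor_polyModVar_koszulProj (i j : Fin r) {n : ℤ} (x : Λ ⊗[k] polyDeg k r n) :
    (polyModVar i n).lTensor Λ (koszulProj z b j n x) =
      koszulProj z b j n ((polyModVar i n).lTensor Λ x) := by
  simp only [koszulProj, LinearMap.lTensor, ← LinearMap.comp_apply, ← TensorProduct.map_comp,
    LinearMap.id_comp, LinearMap.comp_id]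
  rw [← Module.End.mul_eq_comp (polyModVar i n), commute_polyModVar]
  rfl

variable {b}

lemma topCoord_lTensor {V W : Type*} [AddCommGroup V] [Module k V] [AddCommGroup W] [Module k W]
    (f : V →ₗ[k] W) (x : Λ ⊗[k] V) : topCoord b W (f.lTensor Λ x) = f (topCoord b V x) := by
  suffices h : topCoord b W ∘ₗ f.lTensor Λ = f ∘ₗ topCoord b V from LinearMap.congr_fun h x
  ext a v
  simp only [TensorProduct.AlgebraTensorModule.curry_apply, TensorProduct.curry_apply,
    LinearMap.restrictScalars_self, LinearMap.comp_apply, LinearMap.lTensor_tmul, topCoord_tmul,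
    map_smul]

namespace IsSquareFreeBasis

lemma eq_zero_of_lTensor_polyModVar_eq (hb : IsSquareFreeBasis z b) {n : ℤ} (hn : n ≠ 0)
    {x : Λ ⊗[k] polyDeg k r n} (hx : ∀ j, (polyModVar j n).lTensor Λ x = x) : x = 0 := by
  refine hb.ext_topCoord fun a => ?_
  rw [smul_zero, map_zero]
  refine eq_zero_of_polyModVar_eq hn fun j => ?_
  have h := LinearMap.map_smul ((polyModVar j n).baseChange Λ) a x
  rw [← topCoord_lTensor]
  exact congrArg _ (h.trans (congrArg _ (hx j)))

lemma z_smul_koszulProj (hb : IsSquareFreeBasis z b) (j : Fin r) {n : ℤ}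
    (x : Λ ⊗[k] polyDeg k r n) : z j • koszulProj z b j n x = 0 := by
  induction x with
  | zero => rw [map_zero, smul_zero]
  | add x y hx hy => rw [map_add, smul_add, hx, hy, add_zero]
  | tmul a t =>
    rw [koszulProj, TensorProduct.map_tmul, TensorProduct.smul_tmul', LinearMap.comp_apply,
      LinearMap.mulLeft_apply, smul_eq_mul, ← mul_assoc, hb.mul_self, zero_mul,
      TensorProduct.zero_tmul]

variable [CharP k 2]

lemma koszulHomotopy_comm (hb : IsSquareFreeBasis z b) (j : Fin r) {l n m : ℤ} (h : l + 1 = n)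
    (h' : n + 1 = m) (x : Λ ⊗[k] polyDeg k r n) :
    mulδ z h (koszulHomotopy b j h x) + koszulHomotopy b j h' (mulδ z h' x) +
      koszulProj z b j n x = x := by
  induction x with
  | zero => simp only [map_zero, add_zero]
  | add x y hx hy =>
    refine Eq.trans ?_ (congrArg₂ (· + ·) hx hy)
    simp only [map_add]
    abel
  | tmul a t =>
    simp only [koszulHomotopy, koszulProj, TensorProduct.map_tmul, mulδ_tmul, map_sum,
      LinearMap.comp_apply, LinearMap.mulLeft_apply]
    rw [← Finset.sum_add_distrib, Finset.sum_eq_single_of_mem j (Finset.mem_univ j)]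
    · rw [polyDivVar_var_mul]
      conv_rhs => rw [← hb.partialDeriv_mul_self_add j a, TensorProduct.add_tmul,
        ← var_mul_polyDivVar_add j h ((add_comm 1 l).trans h) t, TensorProduct.tmul_add,
        TensorProduct.tmul_add, ← TensorProduct.tmul_add, var_mul_polyDivVar_add]
      abel
    · intro i _ hij
      rw [hb.partialDeriv_mul_of_ne hij,
        polyDivVar_var_mul_of_ne hij h h' _ ((add_comm 1 l).trans h)]
      exact add_self_eq_zero_of_charTwo k _

lemma exists_mulδ_eq (hb : IsSquareFreeBasis z b) {l n m : ℤ} (h : l + 1 = n) (h' : n + 1 = m)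
    (hn : n ≠ 0) {x : Λ ⊗[k] polyDeg k r n} (hx : mulδ z h' x = 0) : ∃ y, mulδ z h y = x := by
  suffices key : ∀ s : Finset (Fin r), ∃ y, ∀ j ∈ s,
      (polyModVar j n).lTensor Λ (x - mulδ z h y) = x - mulδ z h y by
    obtain ⟨y, hy⟩ := key Finset.univ
    exact ⟨y, (sub_eq_zero.1 (hb.eq_zero_of_lTensor_polyModVar_eq hn fun j =>
      hy j (Finset.mem_univ j))).symm⟩
  intro s
  induction s using Finset.induction_on with
  | empty => exact ⟨0, fun j hj => absurd hj (Finset.notMem_empty j)⟩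
  | insert j s _ ih =>
    obtain ⟨y, hy⟩ := ih
    have hcocycle : mulδ z h' (x - mulδ z h y) = 0 := by
      rw [map_sub, hx, ← LinearMap.comp_apply, mulδ_mulδ z hb.mul_self, LinearMap.zero_apply,
        sub_zero]
    have hproj : x - mulδ z h (y + koszulHomotopy b j h (x - mulδ z h y)) =
        koszulProj z b j n (x - mulδ z h y) := by
      have e := hb.koszulHomotopy_comm j h h' (x - mulδ z h y)
      rw [hcocycle, map_zero, add_zero] at e
      rw [map_add, ← sub_sub, sub_eq_iff_eq_add', e]
    refine ⟨y + koszulHomotopy b j h (x - mulδ z h y), fun i hi => ?_⟩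
    rw [hproj]
    obtain rfl | hi := Finset.mem_insert.1 hi
    · exact lTensor_polyModVar_koszulProj_self b i _
    · rw [lTensor_polyModVar_koszulProj, hy i hi]

lemma exists_eq_smul_of_mulδ_eq_zero (hb : IsSquareFreeBasis z b) {m : ℤ} (h : 0 + 1 = m)
    {x : Λ ⊗[k] polyDeg k r 0} (hx : mulδ z h x = 0) :
    ∃ c : k, x = c • (b Finset.univ ⊗ₜ polyOne k r) := by
  have hsocle : x ∈ socle z (Λ ⊗[k] polyDeg k r 0) := mem_socle_iff.2 fun j => by
    have e := hb.koszulHomotopy_comm j (neg_add_cancel 1) h x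
    rw [hx, map_zero, add_zero, tensor_polyDeg_eq_zero_of_neg (by norm_num)
      (koszulHomotopy b j (neg_add_cancel 1) x), map_zero, zero_add] at e
    rw [← e, hb.z_smul_koszulProj]
  obtain ⟨c, hc⟩ := exists_eq_smul_polyOne (topCoord b _ x)
  exact ⟨c, by rw [hb.eq_univ_tmul_topCoord hsocle, hc, TensorProduct.tmul_smul]⟩

end IsSquareFreeBasis

end Koszul

section BoundedBelow

variable {C : Type*} [Category* C] [Abelian C] {K L : CochainComplex C ℤ}

lemma exists_eqUpTo_single_of_kernel_ι_comp_eq_zero (f : K ⟶ L) (d : ℤ) [K.IsStrictlyGE d]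
    [Injective (L.X d)] (hf : kernel.ι (K.d d (d + 1)) ≫ f.f d = 0) :
    ∃ h : K.X (d + 1) ⟶ L.X d,
      (δ (-1) 0 (Cochain.single h (-1))).EqUpTo (Cochain.ofHom f) d := by
  let S := ShortComplex.mk (kernel.ι (K.d d (d + 1))) (K.d d (d + 1)) (kernel.condition _)
  have hS : S.Exact := S.exact_of_f_is_kernel (kernelIsKernel _)
  refine ⟨hS.descToInjective (f.f d) hf, fun p q hpq hp => ?_⟩
  obtain rfl : p = q := by lia
  obtain hp | rfl := hp.lt_or_eq
  · exact (K.isZero_of_isStrictlyGE d p hp).eq_of_src _ _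
  · rw [δ_v (-1) 0 (neg_add_cancel 1) _ p p hpq (p - 1) (p + 1) rfl rfl, Cochain.single_v,
      Cochain.single_v_eq_zero _ _ _ _ _ (by lia), zero_comp, zero_add, Int.negOnePow_zero,
      one_smul, Cochain.ofHom_v]
    exact hS.comp_descToInjective _ hf

open Cochain.InductionUp in
lemma exists_δ_eq_ofHom_of_kernel_ι_comp_eq_zero (f : K ⟶ L) (d : ℤ) [K.IsStrictlyGE d]
    (hK : ∀ n, d < n → K.ExactAt n) [∀ n, Injective (L.X n)]
    (hf : kernel.ι (K.d d (d + 1)) ≫ f.f d = 0) :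
    ∃ α : Cochain K L (-1), δ (-1) 0 α = Cochain.ofHom f ∧
      ∀ (n : ℤ) (hn : d + -1 = n), α.v d n hn = 0 := by
  let X (n : ℕ) : Set (Cochain K L (-1)) :=
    Set.ofPred fun α => (δ (-1) 0 α).EqUpTo (Cochain.ofHom f) (d + n)
  obtain ⟨h, hh⟩ := exists_eqUpTo_single_of_kernel_ι_comp_eq_zero f d hf
  let x₀ : X 0 := ⟨Cochain.single h (-1), by simpa [X] using hh⟩
  let φ (n : ℕ) (α : X n) : X (n + 1) :=
    ⟨_, (CochainComplex.isKInjective_of_injective_aux f α.1 (d + n) (d + (n + 1 : ℕ)) (by lia)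
      (hK _ (by lia)) α.2).choose_spec⟩
  have hφ (n : ℕ) (α : X n) : (φ n α).1.EqUpTo α.1 (d + 1 + n) := fun p q hpq hp => by
    dsimp [φ]
    rw [add_eq_left, Cochain.single_v_eq_zero _ _ _ _ _ (by lia)]
  refine ⟨limitSequence φ hφ x₀, ?_, fun n hn => ?_⟩
  · ext n
    let n₀ := (n - d).toNat
    rw [← (sequence φ x₀ n₀).2 n n (add_zero n) (by lia),
      δ_v (-1) 0 (neg_add_cancel 1) _ n n (by lia) (n - 1) (n + 1) rfl (by lia),
      δ_v (-1) 0 (neg_add_cancel 1) _ n n (by lia) (n - 1) (n + 1) rfl (by lia),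
      limitSequence_eqUpTo φ hφ x₀ n₀ n (n - 1) (by lia) (by lia),
      limitSequence_eqUpTo φ hφ x₀ n₀ (n + 1) n (by lia) (by lia)]
  · rw [limitSequence_eqUpTo φ hφ x₀ 0 d n hn (by lia)]
    exact Cochain.single_v_eq_zero _ _ _ _ _ (by lia)

lemma exists_δ_eq_of_kernel_ι_comp_eq_zero {n : ℤ} (x : Cocycle K L n) (d : ℤ) [K.IsStrictlyGE d]
    (hK : ∀ n, d < n → K.ExactAt n) [∀ n, Injective (L.X n)] {e : ℤ} (he : d + n = e)
    (hx : kernel.ι (K.d d (d + 1)) ≫ x.1.v d e he = 0) (m : ℤ) (hm : m + 1 = n) :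
    ∃ α : Cochain K L m, δ m n α = x.1 ∧ ∀ (q : ℤ) (hq : d + m = q), α.v d q hq = 0 := by
  obtain ⟨f, hf⟩ : ∃ f : K ⟶ L⟦n⟧, Cochain.ofHom f = x.1.rightShift n 0 (zero_add n) := by
    obtain ⟨f, hf⟩ := (Cocycle.equivHom ..).surjective (x.rightShift n 0 (zero_add n))
    exact ⟨f, congrArg Subtype.val hf⟩
  have : ∀ i, Injective ((L⟦n⟧).X i) := fun i => inferInstanceAs (Injective (L.X (i + n)))
  have hfd : kernel.ι (K.d d (d + 1)) ≫ f.f d = 0 := by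
    have h := Cochain.congr_v hf d d (add_zero d)
    rw [Cochain.ofHom_v, Cochain.rightShift_v _ _ _ _ _ _ _ e (by lia)] at h
    rw [h, ← Category.assoc, hx, zero_comp]
  obtain ⟨α, hα, hαd⟩ := exists_δ_eq_ofHom_of_kernel_ι_comp_eq_zero f d hK hfd
  refine ⟨n.negOnePow • Cochain.rightUnshift α m (by omega), ?_, fun q hq => ?_⟩
  · apply (Cochain.rightShiftAddEquiv _ _ _ n 0 (zero_add n)).injective
    change Cochain.rightShift _ n 0 (zero_add n) = Cochain.rightShift x.1 n 0 (zero_add n)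
    rw [← hf, ← hα, δ_units_smul, Cochain.rightShift_units_smul,
      Cochain.δ_rightUnshift _ _ _ _ 0 (zero_add n)]
    simp [smul_smul]
  · rw [Cochain.units_smul_v, Cochain.rightUnshift_v _ _ _ _ _ _ (d - 1) rfl, hαd, zero_comp,
      smul_zero]

end BoundedBelow

section AcyclicKernel

lemma quasiIso_of_epi_of_acyclic_kernel {C : Type*} [Category* C] [Abelian C]
    {K L : CochainComplex C ℤ} (φ : K ⟶ L) [Epi φ] (h : (kernel φ).Acyclic) : QuasiIso φ := by
  let S := ShortComplex.mk (kernel.ι φ) φ (kernel.condition φ)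
  have hS : S.ShortExact := { exact := S.exact_of_f_is_kernel (kernelIsKernel φ) }
  have h₁ (n : ℤ) : IsZero (S.X₁.homology n) := (h n).isZero_homology
  refine ⟨fun n => ?_⟩
  rw [quasiIsoAt_iff_isIso_homologyMap]
  have : Mono (HomologicalComplex.homologyMap φ n) :=
    (hS.homology_exact₂ n).mono_g ((h₁ n).eq_of_src _ _)
  have : Epi (HomologicalComplex.homologyMap φ n) :=
    (hS.homology_exact₃ n (n + 1) rfl).epi_f ((h₁ (n + 1)).eq_of_tgt _ _)
  exact isIso_of_mono_of_epi _

lemma quasiIso_of_surjective {R : Type*} [Ring R] {K L : CochainComplex (ModuleCat.{u} R) ℤ}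
    (φ : K ⟶ L) (hφ : ∀ n, Function.Surjective (φ.f n))
    (h : ∀ (m n : ℤ), m + 1 = n → ∀ x : K.X n, K.d n (n + 1) x = 0 → φ.f n x = 0 →
      ∃ y : K.X m, K.d m n y = x ∧ φ.f m y = 0) : QuasiIso φ := by
  have (n : ℤ) : Epi (φ.f n) := (ModuleCat.epi_iff_surjective _).2 (hφ n)
  have : Epi φ := HomologicalComplex.epi_of_epi_f φ inferInstance
  let S := ShortComplex.mk (kernel.ι φ) φ (kernel.condition φ)
  have hS (n : ℤ) : (S.map (HomologicalComplex.eval _ _ n)).ShortExact :=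
    ShortComplex.ShortExact.map_of_exact
      { exact := S.exact_of_f_is_kernel (kernelIsKernel φ) } _
  have hι (n : ℤ) : Function.Injective ((kernel.ι φ).f n) := (hS n).moduleCat_injective_f
  refine quasiIso_of_epi_of_acyclic_kernel φ fun n => ?_
  rw [HomologicalComplex.exactAt_iff' _ (n - 1) n (n + 1) (by simp) (by simp),
    ShortComplex.moduleCat_exact_iff]
  intro x hx
  have hd (p q : ℤ) (x : (kernel φ).X p) :
      K.d p q ((kernel.ι φ).f p x) = (kernel.ι φ).f q ((kernel φ).d p q x) :=
    ConcreteCategory.congr_hom ((kernel.ι φ).comm p q) x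
  obtain ⟨y, hy, hy₀⟩ := h (n - 1) n (by lia) ((kernel.ι φ).f n x)
    ((hd n (n + 1) x).trans ((congrArg _ hx).trans (map_zero _)))
    (ConcreteCategory.congr_hom (S.map (HomologicalComplex.eval _ _ n)).zero x)
  obtain ⟨y, rfl⟩ := (ShortComplex.moduleCat_exact_iff _).1 (hS (n - 1)).exact y hy₀
  exact ⟨y, hι n ((hd (n - 1) n y).symm.trans hy)⟩

end AcyclicKernel

section Contractible

variable {C : Type*} [Category* C]

/-- The objects `T` such that `Hom(T, -)` preserves the exactness of `S`. -/
def homExact [HasZeroMorphisms C] (S : ShortComplex C) : ObjectProperty C := fun T =>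
  ∀ f : T ⟶ S.X₂, f ≫ S.g = 0 → ∃ g : T ⟶ S.X₁, g ≫ S.f = f

instance [Preadditive C] [Balanced C] (S : ShortComplex C) [Injective S.X₁] :
    (homExact S).IsClosedUnderExtensions where
  prop_X₂_of_shortExact {E} hE h₁ h₃ f hf := by
    have := hE.mono_f
    have := hE.epi_g
    obtain ⟨g₁, hg₁⟩ := h₁ (E.f ≫ f) (by rw [Category.assoc, hf, comp_zero])
    let g := Injective.factorThru g₁ E.f
    have hg : E.f ≫ (f - g ≫ S.f) = 0 := by
      rw [Preadditive.comp_sub, Injective.comp_factorThru_assoc, hg₁, sub_self]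
    obtain ⟨g₃, hg₃⟩ := h₃ (hE.exact.desc _ hg) (by
      rw [← cancel_epi E.g, hE.exact.g_desc_assoc, Preadditive.sub_comp, hf, Category.assoc,
        S.zero, comp_zero, sub_zero, comp_zero])
    refine ⟨E.g ≫ g₃ + g, ?_⟩
    rw [Preadditive.add_comp, Category.assoc, hg₃, hE.exact.g_desc, sub_add_cancel]

lemma nonempty_homotopy_id_zero_of_homExact [Preadditive C] {M : CochainComplex C ℤ}
    [∀ n, M.HasHomology n]
    (h : ∀ l n : ℤ, l + 1 = n → homExact (M.sc' l n (n + 1)) (M.cycles n)) :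
    Nonempty (Homotopy (𝟙 M) 0) := by
  have h (l n : ℤ) (hl : l + 1 = n) : ∃ s : M.cycles n ⟶ M.X l, s ≫ M.d l n = M.iCycles n :=
    h l n hl (M.iCycles n) (M.iCycles_d n (n + 1))
  choose s hs using h
  let p (n : ℤ) : M.X n ⟶ M.cycles n :=
    M.liftCycles (𝟙 _ - M.toCycles n (n + 1) ≫ s n (n + 1) rfl) (n + 1) (by simp) (by
      rw [Preadditive.sub_comp, Category.assoc, hs, M.toCycles_i, Category.id_comp, sub_self])
  have hp (n : ℤ) : p n ≫ M.iCycles n = 𝟙 _ - M.toCycles n (n + 1) ≫ s n (n + 1) rfl :=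
    M.liftCycles_i ..
  have hdp (n : ℤ) : M.d n (n + 1) ≫ p (n + 1) = M.toCycles n (n + 1) := by
    rw [← cancel_mono (M.iCycles _), Category.assoc, hp, M.toCycles_i, Preadditive.comp_sub,
      Category.comp_id, M.d_toCycles_assoc, zero_comp, sub_zero]
  let c : Cochain M M (-1) := Cochain.mk fun n l hl => p n ≫ s l n (by lia)
  refine ⟨(Cochain.equivHomotopy _ _).symm ⟨c, Cochain.ext₀ _ _ fun n => ?_⟩⟩
  rw [Cochain.add_v, Cochain.ofHom_v, Cochain.ofHom_v, δ_v (-1) 0 (neg_add_cancel 1) c n n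
    (add_zero n) (n - 1) (n + 1) (by lia) rfl]
  simp only [c, Cochain.mk_v, Category.assoc, hs, hp, reassoc_of% (hdp n)]
  simp

end Contractible

section Filtration

variable {Λ ι : Type*} [CommRing Λ] {z : ι → Λ}

lemma prop_of_socle_eq_top [Finite ι] (hz : ∀ i, z i * z i = 0)
    (P : ObjectProperty (ModuleCat.{u} Λ)) [P.IsClosedUnderExtensions]
    (hP : ∀ T : ModuleCat.{u} Λ, socle z T = ⊤ → P T) (T : ModuleCat.{u} Λ) : P T := by
  suffices h : ∀ (s : Set ι), s.Finite → ∀ T : ModuleCat.{u} Λ,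
      (∀ i ∉ s, ∀ t : T, z i • t = 0) → P T from
    h Set.univ Set.finite_univ T fun i hi => (hi (Set.mem_univ i)).elim
  intro s hs
  induction s, hs using Set.Finite.induction_on with
  | empty =>
    exact fun T hT => hP T (eq_top_iff.2 fun t _ => mem_socle_iff.2 fun i => hT i id t)
  | @insert j s _ _ ih =>
    intro T hT
    let f := (LinearMap.lsmul Λ T (z j)).rangeRestrict
    have hs (i : ι) (hi : i ∉ s) (hij : i ≠ j) (t : T) : z i • t = 0 :=
      hT i (by simp [hij, hi]) t
    refine P.prop_X₂_of_shortExact (LinearMap.shortExact_shortComplexKer (f := f)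
      (LinearMap.surjective_rangeRestrict _)) (ih _ ?_) (ih _ ?_)
    · rintro i hi ⟨t, ht⟩
      refine Subtype.ext ?_
      obtain rfl | hij := eq_or_ne i j
      · exact show z i • t = 0 from congrArg Subtype.val (LinearMap.mem_ker.1 ht)
      · exact hs i hi hij t
    · rintro i hi ⟨_, t, rfl⟩
      refine Subtype.ext ?_
      obtain rfl | hij := eq_or_ne i j
      · exact (smul_smul _ _ t).trans (by rw [hz, zero_smul]; rfl)
      · exact hs i hi hij _

end Filtration

section SocleComplex

open scoped ModuleCat

variable {k Λ : Type u} [Field k] [CommRing Λ] [Algebra k Λ]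

variable (k) in
/-- The functor sending a module to its socle, as a vector space over `k`. -/
def socleFunctor {ι : Type*} (z : ι → Λ) : ModuleCat.{u} Λ ⥤ ModuleCat.{u} k where
  obj M := ModuleCat.of k (socle z M)
  map f := ModuleCat.ofHom ((f.hom.restrict (p := socle z _) (q := socle z _) fun m hm =>
    mem_socle_iff.2 fun i => by
      rw [← map_smul, mem_socle_iff.1 hm, map_zero]).restrictScalars k)

instance {ι : Type*} (z : ι → Λ) : (socleFunctor k z).Additive where

variable (k) in
/-- The complex of socles of a complex of modules. -/
abbrev socleComplex {ι : Type*} (z : ι → Λ) (M : CochainComplex (ModuleCat.{u} Λ) ℤ) :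
    CochainComplex (ModuleCat.{u} k) ℤ :=
  ((socleFunctor k z).mapHomologicalComplex _).obj M

variable {r : ℕ} {z : Fin r → Λ} {b : Module.Basis (Finset (Fin r)) k Λ}

lemma homExact_of_socle_eq_top (hb : IsSquareFreeBasis z b)
    {M : CochainComplex (ModuleCat.{u} Λ) ℤ} {l n : ℤ} (hl : l + 1 = n)
    (hM : (socleComplex k z M).ExactAt n) {T : ModuleCat.{u} Λ} (hT : socle z T = ⊤) :
    homExact (M.sc' l n (n + 1)) T := by
  intro (f : T ⟶ M.X n) (hf : f ≫ M.d n (n + 1) = 0)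
  have hfT (t : T) : f t ∈ socle z (M.X n) := mem_socle_iff.2 fun i => by
    rw [← map_smul, mem_socle_iff.1 (hT.ge trivial), map_zero]
  let f' : ModuleCat.of k T ⟶ (socleComplex k z M).X n :=
    ModuleCat.ofHom ((f.hom.restrictScalars k).codRestrict
      ((socle z (M.X n)).restrictScalars k) hfT)
  have hf' : f' ≫ (socleComplex k z M).d n (n + 1) = 0 :=
    ModuleCat.hom_ext (LinearMap.ext fun t : T => Subtype.ext (ConcreteCategory.congr_hom hf t))
  rw [HomologicalComplex.exactAt_iff' _ l n (n + 1) (by simp; lia) (by simp)] at hM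
  obtain ⟨g, hg⟩ : ∃ g : ModuleCat.of k T ⟶ (socleComplex k z M).X l,
      g ≫ (socleComplex k z M).d l n = f' :=
    ⟨hM.liftFromProjective f' hf', hM.liftFromProjective_comp ..⟩
  let g' : T →ₗ[Λ] M.X l :=
    { toFun t := (g t : socle z (M.X l)).1
      map_add' t t' := congrArg Subtype.val (map_add g.hom t t')
      map_smul' a t := by
        rw [hb.smul_eq_coord_smul (hT.ge trivial : t ∈ socle z T) a]
        exact (congrArg Subtype.val (map_smul g.hom _ t)).trans
          (hb.smul_eq_coord_smul (g t : socle z (M.X l)).2 a).symm }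
  refine ⟨ModuleCat.ofHom g', ModuleCat.hom_ext (LinearMap.ext fun t : T => ?_)⟩
  have hgt : (g ≫ (socleComplex k z M).d l n).hom t = f'.hom t := by rw [hg]
  exact congrArg Subtype.val hgt

lemma nonempty_homotopy_id_zero_of_acyclic_socleComplex (hb : IsSquareFreeBasis z b)
    {M : CochainComplex (ModuleCat.{u} Λ) ℤ} [∀ n, Injective (M.X n)]
    (hM : (socleComplex k z M).Acyclic) : Nonempty (Homotopy (𝟙 M) 0) := by
  refine nonempty_homotopy_id_zero_of_homExact fun l n hl => ?_
  have : Injective (M.sc' l n (n + 1)).X₁ := inferInstanceAs (Injective (M.X l))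
  exact prop_of_socle_eq_top hb.mul_self _
    (fun T hT => homExact_of_socle_eq_top hb hl (hM n) hT) _

lemma bggJ_d [CharP k 2] (hz : ∀ i, z i * z i = 0) {n m : ℤ} (h : n + 1 = m) :
    (bggJ (k := k) z hz).d n m = ModuleCat.ofHom (mulδ z h) :=
  dif_pos h

lemma IsSquareFreeBasis.mulδ_univ_tmul (hb : IsSquareFreeBasis z b) {n m : ℤ} (h : n + 1 = m)
    (t : polyDeg k r n) : mulδ z h (b Finset.univ ⊗ₜ t) = 0 := by
  rw [mulδ_tmul]
  exact Finset.sum_eq_zero fun i _ => by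
    rw [← smul_eq_mul, mem_socle_iff.1 hb.univ_mem_socle, TensorProduct.zero_tmul]

section BggJ

variable [CharP k 2] (hz : ∀ i, z i * z i = 0)

instance bggJ_isStrictlyGE : (bggJ (k := k) z hz).IsStrictlyGE 0 := by
  rw [CochainComplex.isStrictlyGE_iff]
  exact fun i hi => ModuleCat.isZero_of_iff_subsingleton.2
    (subsingleton_of_forall_eq 0 (tensor_polyDeg_eq_zero_of_neg hi))

lemma bggJ_exactAt (hb : IsSquareFreeBasis z b) {n : ℤ} (hn : 0 < n) :
    (bggJ (k := k) z hb.mul_self).ExactAt n := by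
  rw [HomologicalComplex.exactAt_iff' _ (n - 1) n (n + 1) (by simp) (by simp),
    ShortComplex.moduleCat_exact_iff]
  intro x hx
  obtain ⟨y, hy⟩ := hb.exists_mulδ_eq (sub_add_cancel n 1) rfl hn.ne' (x := x)
    ((congrArg (fun f => f.hom x) (bggJ_d hb.mul_self rfl)).symm.trans hx)
  exact ⟨y, (congrArg (fun f => f.hom y) (bggJ_d hb.mul_self (sub_add_cancel n 1))).trans hy⟩

lemma kernel_ι_bggJ_d_comp_eq_zero (hb : IsSquareFreeBasis z b) {P : ModuleCat.{u} Λ}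
    (f : (bggJ (k := k) z hb.mul_self).X 0 ⟶ P) (hf : f (b Finset.univ ⊗ₜ polyOne k r) = 0) :
    kernel.ι ((bggJ (k := k) z hb.mul_self).d 0 (0 + 1)) ≫ f = 0 := by
  ext t
  let d := (bggJ (k := k) z hb.mul_self).d 0 (0 + 1)
  obtain ⟨c, hc⟩ := hb.exists_eq_smul_of_mulδ_eq_zero (zero_add 1) (x := kernel.ι d t)
    (ConcreteCategory.congr_hom (kernel.condition d) t)
  rw [← algebraMap_smul Λ c] at hc
  exact (congrArg f hc).trans ((map_smul f.hom _ _).trans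
    ((congrArg _ hf).trans (smul_zero _)))

end BggJ

section EvalSocle

variable [CharP k 2] (hb : IsSquareFreeBasis z b) (M : CochainComplex (ModuleCat.{u} Λ) ℤ)

/-- Evaluation at `σ ⊗ 1`, where `σ` is the top monomial `b univ`. -/
def evalSocle : homComplex k (bggJ (k := k) z hb.mul_self) M ⟶ socleComplex k z M where
  f n := ModuleCat.ofHom
    { toFun (f : Cochain (bggJ (k := k) z hb.mul_self) M n) :=
        ⟨f.v 0 n (zero_add n) (b Finset.univ ⊗ₜ polyOne k r), mem_socle_iff.2 fun i => by
          rw [← map_smul]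
          exact (congrArg _ (mem_socle_iff.1 (hb.univ_tmul_mem_socle _) i)).trans (map_zero _)⟩
      map_add' f g := rfl
      map_smul' c f := rfl }
  comm' n m (h : n + 1 = m) := by
    ext (f : Cochain (bggJ (k := k) z hb.mul_self) M n)
    refine Subtype.ext ?_
    change M.d n m (f.v 0 n (zero_add n) _) = (δ n m f).v 0 m (zero_add m) _
    rw [δ_v n m h f 0 m (zero_add m) n 1 (by lia) rfl, bggJ_d hb.mul_self (zero_add 1),
      units_smul_hom' (k := k)]
    have hd : f.v 1 m (by lia) (mulδ z (zero_add 1) (b Finset.univ ⊗ₜ polyOne k r)) = 0 :=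
      (congrArg _ (hb.mulδ_univ_tmul _ _)).trans (map_zero _)
    exact ((congrArg _ hd).trans (add_zero _)).symm

variable {M} [∀ n, Injective (M.X n)]

lemma evalSocle_surjective (n : ℤ) : Function.Surjective ((evalSocle hb M).f n) := by
  rintro ⟨m, hm⟩
  have : Module.Injective Λ (M.X n) := (Module.injective_iff_injective_object Λ _).2 inferInstance
  obtain ⟨y, rfl⟩ := hb.exists_univ_smul_eq hm
  let φ : polyDeg k r 0 →ₗ[k] M.X n :=
    (MvPolynomial.lcoeff k 0 ∘ₗ (polyDeg k r 0).subtype).smulRight y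
  let f : Cochain (bggJ (k := k) z hb.mul_self) M n :=
    Cochain.single (ModuleCat.ofHom (φ.liftBaseChange Λ)) n
  have hf : f.v 0 n (zero_add n) = ModuleCat.ofHom (φ.liftBaseChange Λ) := Cochain.single_v ..
  refine ⟨f, Subtype.ext ?_⟩
  change f.v 0 n (zero_add n) (b Finset.univ ⊗ₜ polyOne k r) = _
  rw [hf]
  change φ.liftBaseChange Λ (b Finset.univ ⊗ₜ polyOne k r) = _
  have hφ : φ (polyOne k r) = y := by simp [φ, polyOne]
  rw [LinearMap.liftBaseChange_tmul, hφ]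

lemma quasiIso_evalSocle : QuasiIso (evalSocle hb M) := by
  refine quasiIso_of_surjective _ (evalSocle_surjective hb) ?_
  intro m n hmn (x : Cochain (bggJ z hb.mul_self) M n) (hx : δ n (n + 1) x = 0) hx₀
  have hxσ : x.v 0 n (zero_add n) (b Finset.univ ⊗ₜ polyOne k r) = 0 :=
    congrArg Subtype.val hx₀
  obtain ⟨α, hα, hα₀⟩ := exists_δ_eq_of_kernel_ι_comp_eq_zero (Cocycle.mk x _ rfl hx) 0
    (fun _ => bggJ_exactAt hb) (zero_add n) (kernel_ι_bggJ_d_comp_eq_zero hb _ hxσ) m hmn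
  exact ⟨α, hα, Subtype.ext
    (congrArg (fun f => f.hom (b Finset.univ ⊗ₜ polyOne k r)) (hα₀ m (zero_add m)))⟩

lemma nonempty_homotopy_id_zero_of_acyclic_homComplex
    (hM : (homComplex k (bggJ (k := k) z hb.mul_self) M).Acyclic) :
    Nonempty (Homotopy (𝟙 M) 0) := by
  have := quasiIso_evalSocle hb (M := M)
  exact nonempty_homotopy_id_zero_of_acyclic_socleComplex hb fun n =>
    (exactAt_iff_of_quasiIsoAt (evalSocle hb M) n).1 (hM n)

end EvalSocle

end SocleComplex

section HomCone

open CochainComplex.mappingCone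

lemma mappingCone_triangle_mor₃_f {C : Type*} [Category* C] [Preadditive C]
    [HasBinaryBiproducts C] {M N : CochainComplex C ℤ} (f : M ⟶ N) (n : ℤ) :
    (triangle f).mor₃.f n = -(fst f).1.v n (n + 1) rfl := by
  have h := Cochain.congr_v (Cocycle.cochain_ofHom_homOf_eq_coe
    ((-fst f).rightShift 1 0 (zero_add 1))) n n (add_zero n)
  rw [Cochain.ofHom_v] at h
  exact h.trans ((Cochain.rightShift_v _ 1 0 (zero_add 1) n n (add_zero n) (n + 1) rfl).trans
    (Category.comp_id _))

variable {k : Type u} [Field k] {C : Type*} [Category.{u} C] [Preadditive C] [Linear k C]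
  [HasBinaryBiproducts C] (F : CochainComplex C ℤ) {M N : CochainComplex C ℤ} (f : M ⟶ N)

omit [HasBinaryBiproducts C] in
lemma postcomp_zero (M N : CochainComplex C ℤ) (n : ℤ) :
    postcomp (k := k) F (0 : Cochain M N n) = 0 :=
  cochain_ext_apply fun i _ h x => Cochain.comp_zero (show Cochain F M i from x) h

/-- The canonical morphism from the cone of `Hom(F, f)` to `Hom(F, cone f)`. -/
def homConeDesc : CochainComplex.mappingCone (homComplexMap (k := k) F f) ⟶
    homComplex k F (CochainComplex.mappingCone f) :=
  desc (homComplexMap F f) (postcomp F (inl f)) (homComplexMap F (inr f)) (by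
    rw [δ_postcomp (neg_add_cancel 1), δ_inl, Cochain.ofHom_comp, Cochain.ofHom_comp,
      postcomp_comp, ofHom_homComplexMap, ofHom_homComplexMap])

/-- The inverse of `homConeDesc`. -/
def homConeLift : homComplex k F (CochainComplex.mappingCone f) ⟶
    CochainComplex.mappingCone (homComplexMap (k := k) F f) :=
  lift (homComplexMap F f)
    (Cocycle.mk (postcomp F (fst f).1) 2 (by norm_num) (by
      rw [δ_postcomp (by norm_num), (fst f).δ_eq_zero, postcomp_zero]))
    (postcomp F (snd f)) (by
      rw [δ_postcomp (zero_add 1), δ_snd]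
      change _ + (postcomp (k := k) F (fst f).1).comp _ _ = 0
      rw [ofHom_homComplexMap, ← postcomp_comp, ← postcomp_add, neg_add_cancel, postcomp_zero])

lemma homConeLift_desc : homConeLift (k := k) F f ≫ homConeDesc F f = 𝟙 _ := by
  apply Cochain.ofHom_injective
  rw [Cochain.ofHom_comp, homConeLift, homConeDesc, ofHom_lift, ofHom_desc,
    liftCochain_descCochain _ _ _ _ _ _ _ _ (by norm_num)]
  change (postcomp (k := k) F (fst f).1).comp _ _ + _ = _
  rw [ofHom_homComplexMap, ← postcomp_comp, ← postcomp_comp, ← postcomp_add,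
    CochainComplex.mappingCone.id, postcomp_id]

lemma homConeDesc_lift : homConeDesc (k := k) F f ≫ homConeLift F f = 𝟙 _ := by
  apply Cochain.ofHom_injective
  rw [Cochain.ofHom_comp, homConeLift, homConeDesc, ofHom_lift, ofHom_desc,
    ext_cochain_from_iff _ (-1) 0 (by norm_num)]
  constructor
  · rw [← Cochain.comp_assoc_of_third_is_zero_cochain, inl_descCochain]
    change (postcomp (k := k) F (inl f)).comp ((postcomp (k := k) F (fst f).1).comp (inl _) _ +
      (postcomp (k := k) F (snd f)).comp _ _) _ = _
    rw [Cochain.comp_add, ← Cochain.comp_assoc _ _ _ (neg_add_cancel 1) (by norm_num) (by norm_num),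
      ← postcomp_comp, inl_fst, postcomp_id, Cochain.id_comp,
      ← Cochain.comp_assoc_of_second_is_zero_cochain, ← postcomp_comp, inl_snd, postcomp_zero,
      Cochain.zero_comp, add_zero, Cochain.comp_id]
  · rw [← Cochain.comp_assoc_of_third_is_zero_cochain, inr_descCochain, ofHom_homComplexMap]
    change (postcomp (k := k) F (Cochain.ofHom (inr f))).comp
      ((postcomp (k := k) F (fst f).1).comp (inl _) _ +
        (postcomp (k := k) F (snd f)).comp _ _) _ = _
    rw [Cochain.comp_add, ← Cochain.comp_assoc_of_first_is_zero_cochain,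
      ← postcomp_comp, inr_fst, postcomp_zero, Cochain.zero_comp, zero_add,
      ← Cochain.comp_assoc_of_second_is_zero_cochain, ← postcomp_comp, inr_snd, postcomp_id,
      Cochain.id_comp, Cochain.comp_id]

lemma inr_homConeDesc : inr (homComplexMap (k := k) F f) ≫ homConeDesc F f =
    homComplexMap F (inr f) := inr_desc _ _ _ _

lemma homConeLift_triangle_mor₃ :
    homConeLift F f ≫ (triangle (homComplexMap (k := k) F f)).mor₃ =
      homComplexMap (k := k) F (triangle f).mor₃ ≫ (homComplexShiftIso k F M 1).hom := by
  refine HomologicalComplex.hom_ext _ _ fun n => ?_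
  have hlift : (homConeLift (k := k) F f).f n ≫
      (fst (homComplexMap (k := k) F f)).1.v n (n + 1) rfl =
        (postcomp F (fst f).1).v n (n + 1) rfl :=
    lift_f_fst_v _ _ _ _ _ _ _
  refine (congrArg _ (mappingCone_triangle_mor₃_f _ n)).trans
    (((Preadditive.comp_neg _ _).trans (congrArg _ hlift)).trans ?_)
  refine ModuleCat.hom_ext (LinearMap.ext
    fun (x : Cochain F (CochainComplex.mappingCone f) n) => ?_)
  change _ = (x.comp (Cochain.ofHom (Cocycle.homOf ((-fst f).rightShift 1 0 (zero_add 1))))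
    (add_zero n)).rightUnshift (n + 1) rfl
  rw [Cocycle.cochain_ofHom_homOf_eq_coe, Cocycle.rightShift_coe,
    Cochain.rightUnshift_comp _ _ (add_zero n) (n + 1) rfl 1 (zero_add 1),
    Cochain.rightUnshift_rightShift]
  exact (Cochain.comp_neg _ _ _).symm

end HomCone

section HomJTriangle

open DGModule CochainComplex.mappingCone

variable {k : Type u} [Field k] {r : ℕ} {Λ : Type u} [CommRing Λ] [Algebra k Λ] (z : Fin r → Λ)
  [CharP k 2] (hz : ∀ i, z i * z i = 0) {M N : CochainComplex (ModuleCat.{u} Λ) ℤ} (f : M ⟶ N)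

/-- The `S`-linear isomorphism between `Hom(J, cone f)` and the cone of `Hom(J, f)`. -/
def homJConeIso : (homJFunctor (k := k) z hz).obj (CochainComplex.mappingCone f) ≅
    cone ((homJFunctor (k := k) z hz).map f) :=
  isoMk ⟨homConeLift _ f, homConeDesc _ f, homConeLift_desc _ f, homConeDesc_lift _ f⟩
    (lift_linear ((homJFunctor (k := k) z hz).map f) _ _ _
      (homJ_postcomp_linear z hz (fst f).1) (homJ_postcomp_linear z hz (snd f)))

lemma homJFunctor_map_inr_comp_homJConeIso_hom :
    (homJFunctor (k := k) z hz).map (inr f) ≫ (homJConeIso z hz f).hom =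
      coneInr ((homJFunctor (k := k) z hz).map f) := by
  rw [← Iso.eq_comp_inv]
  exact hom_ext (inr_homConeDesc _ f).symm

lemma homJConeIso_hom_comp_coneδ :
    (homJConeIso z hz f).hom ≫ coneδ ((homJFunctor (k := k) z hz).map f) =
      (homJFunctor (k := k) z hz).map (triangle f).mor₃ ≫
        ((homJFunctor (k := k) z hz).commShiftIso (1 : ℤ)).hom.app M :=
  hom_ext (homConeLift_triangle_mor₃ _ f)

/-- `Hom(J, -)` sends the standard triangle of `f` to that of `Hom(J, f)`. -/
def homJTriangleIso : (homJFunctor (k := k) z hz).mapTriangle.obj (triangle f) ≅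
    coneTriangle ((homJFunctor (k := k) z hz).map f) :=
  Triangle.isoMk _ _ (Iso.refl _) (Iso.refl _) (homJConeIso z hz f)
    ((Category.comp_id _).trans (Category.id_comp _).symm)
    ((homJFunctor_map_inr_comp_homJConeIso_hom z hz f).trans (Category.id_comp _).symm)
    ((comp_id_aux _ ((shiftFunctor (DGModule (polyDG k r)) (1 : ℤ)).map_id _)).trans
      (homJConeIso_hom_comp_coneδ z hz f).symm)

/-- `Hom(J, -)` on homotopy categories is induced by `Hom(J, -)` on complexes. -/
def quotientCompHomJHtpyIso : HomotopyCategory.quotient (ModuleCat.{u} Λ) (ComplexShape.up ℤ) ⋙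
    homJHtpy (k := k) z hz ≅ homJFunctor (k := k) z hz ⋙ htpyQuotient (polyDG k r) :=
  CategoryTheory.Quotient.lift.isLift _ _ _

instance : NatTrans.CommShift (quotientCompHomJHtpyIso (k := k) z hz).hom ℤ :=
  CategoryTheory.Quotient.liftCommShift_compatibility
    (homJFunctor (k := k) z hz ⋙ htpyQuotient (polyDG k r)) _ ℤ _

/-- The version of `homJTriangleIso` in the homotopy categories. -/
def homJTrianglehIso : (homJHtpy (k := k) z hz).mapTriangle.obj (triangleh f) ≅
    coneTriangleh ((homJFunctor (k := k) z hz).map f) :=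
  (Functor.mapTriangleCompIso (HomotopyCategory.quotient _ _) (homJHtpy (k := k) z hz)).symm.app
      (triangle f) ≪≫
    (Functor.mapTriangleIso (quotientCompHomJHtpyIso (k := k) z hz)).app (triangle f) ≪≫
    (Functor.mapTriangleCompIso (homJFunctor (k := k) z hz) (htpyQuotient _)).app (triangle f) ≪≫
    (htpyQuotient _).mapTriangle.mapIso (homJTriangleIso z hz f)

instance : (homJHtpy (k := k) z hz).IsTriangulated where
  map_distinguished := by
    rintro T ⟨M, N, f, ⟨e⟩⟩
    exact ⟨_, _, _, ⟨(homJHtpy (k := k) z hz).mapTriangle.mapIso e ≪≫ homJTrianglehIso z hz f⟩⟩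

end HomJTriangle

section PolynomialAction

variable {k : Type u} [Field k] {r : ℕ} {N : DGModule (polyDG k r)}

/-- The action `S^p × N^q → N^n` on a differential graded `S`-module, where `q + p = n`. -/
def DGModule.polyAct {p q n : ℤ} (h : q + p = n) : polyDeg k r p →ₗ[k] N.X.X q →ₗ[k] N.X.X n where
  toFun s := ((N.act p s).v q n h).hom
  map_add' s t := by
    rw [map_add, Cochain.add_v, ModuleCat.hom_add]
  map_smul' c s := by
    rw [map_smul, Cochain.smul_v, ModuleCat.hom_smul, RingHom.id_apply]

namespace DGModule

lemma polyAct_polyMul {p q n i j l : ℤ} (h : p + q = n) (hij : i + q = j) (hjl : j + p = l)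
    (hil : i + n = l) (s : polyDeg k r p) (t : polyDeg k r q) (v : N.X.X i) :
    polyAct hil (polyMul h s t) v = polyAct hjl s (polyAct hij t v) := by
  have e := Cochain.congr_v (N.act_mul h s t) i l hil
  rw [Cochain.comp_v _ _ ((add_comm q p).trans h) i j l hij hjl] at e
  exact congrArg (fun f => f.hom v) e

lemma polyAct_polyOne {i : ℤ} (h : i + 0 = i) (v : N.X.X i) : polyAct h (polyOne k r) v = v :=
  congrArg (fun f => f.hom v) ((Cochain.congr_v N.act_one i i h).trans (Cochain.ofHom_v _ _))

lemma polyAct_comm {p q i j j' l : ℤ} (hij : i + q = j) (hjl : j + p = l) (hij' : i + p = j')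
    (hjl' : j' + q = l) (s : polyDeg k r p) (t : polyDeg k r q) (v : N.X.X i) :
    polyAct hjl s (polyAct hij t v) = polyAct hjl' t (polyAct hij' s v) := by
  rw [← polyAct_polyMul rfl hij hjl (by lia), ← polyAct_polyMul (add_comm q p) hij' hjl' (by lia)]
  exact congrArg (fun s => polyAct _ s v) (Subtype.ext (mul_comm _ _))

variable [CharP k 2]

lemma d_polyAct {p i j i' j' : ℤ} (h : i + p = j) (h' : i' + p = j') (hi : i + 1 = i')
    (hj : j + 1 = j') (s : polyDeg k r p) (v : N.X.X i) :
    (N.X.d j j').hom (polyAct h s v) = polyAct h' s ((N.X.d i i').hom v) := by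
  have e : δ p (p + 1) (N.act p s) = 0 :=
    (N.leibniz s).trans (map_zero (N.act (p + 1)))
  have e' := Cochain.congr_v e i j' (by lia)
  rw [δ_v _ _ rfl _ i j' (by lia) j i' (by lia) hi, units_smul_hom' (k := k)] at e'
  rw [Cochain.zero_v] at e'
  exact congrArg (fun f => f.hom v) (add_right_cancel (e'.trans (add_self_hom (k := k) _).symm))

end DGModule
end PolynomialAction

lemma sum_sum_eq_zero_of_add_swap_eq_zero {ι A : Type*} [Fintype ι] [AddCommMonoid A]
    (f : ι → ι → A) (hdiag : ∀ i, f i i = 0) (hswap : ∀ i j, f i j + f j i = 0) :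
    ∑ i, ∑ j, f i j = 0 := by
  rw [← Finset.sum_product']
  refine Finset.sum_involution (fun p _ => p.swap) (fun p _ => hswap _ _) ?_
    (fun _ _ => Finset.mem_univ _) (fun p _ => p.swap_swap)
  rintro ⟨i, j⟩ _ hne heq
  obtain rfl : j = i := congrArg Prod.fst heq
  exact hne (hdiag j)

section Induction

variable {k : Type u} [Field k] {r : ℕ} {Λ : Type u} [CommRing Λ] [Algebra k Λ] (z : Fin r → Λ)
  (N : DGModule (polyDG k r))

open DGModule

/-- The differential of `J ⊗_S N = Λ ⊗ N`: the sum of the differential of `N` and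
multiplication by `∑ z_i ⊗ x_i`. -/
def inducedD {n m : ℤ} (h : n + 1 = m) : Λ ⊗[k] N.X.X n →ₗ[Λ] Λ ⊗[k] N.X.X m :=
  (N.X.d n m).hom.baseChange Λ + ∑ i, z i • (polyAct h (polyVar k r i)).baseChange Λ

lemma inducedD_tmul {n m : ℤ} (h : n + 1 = m) (a : Λ) (v : N.X.X n) :
    inducedD z N h (a ⊗ₜ[k] v) =
      a ⊗ₜ (N.X.d n m).hom v + ∑ i, (z i * a) ⊗ₜ polyAct h (polyVar k r i) v := by
  simp [inducedD, LinearMap.sum_apply, TensorProduct.smul_tmul']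

lemma hom_ext_one_tmul {V : Type u} [AddCommGroup V] [Module k V] {P : ModuleCat.{u} Λ}
    {f g : ModuleCat.of Λ (Λ ⊗[k] V) ⟶ P}
    (h : ∀ v : V, f.hom ((1 : Λ) ⊗ₜ[k] v) = g.hom ((1 : Λ) ⊗ₜ[k] v)) : f = g :=
  ModuleCat.hom_ext ((TensorProduct.isBaseChange k V Λ).algHom_ext _ _ h)

variable [CharP k 2] {z} (hz : ∀ i, z i * z i = 0)

include hz in
lemma inducedD_comp_inducedD {n m l : ℤ} (h : n + 1 = m) (h' : m + 1 = l) :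
    inducedD z N h' ∘ₗ inducedD z N h = 0 := by
  refine TensorProduct.AlgebraTensorModule.ext fun a v => ?_
  have hd : (N.X.d m l).hom ((N.X.d n m).hom v) = 0 :=
    congrArg (fun f => f.hom v) (N.X.d_comp_d n m l)
  have hdelta : ∑ i, ∑ j, (z j * (z i * a)) ⊗ₜ[k]
      polyAct h' (polyVar k r j) (polyAct h (polyVar k r i) v) = 0 := by
    refine sum_sum_eq_zero_of_add_swap_eq_zero _ (fun i => ?_) fun i j => ?_
    · rw [← mul_assoc, hz, zero_mul, TensorProduct.zero_tmul]
    · rw [mul_left_comm (z j), polyAct_comm h h' h h']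
      exact add_self_eq_zero_of_charTwo k _
  simp only [LinearMap.comp_apply, inducedD_tmul, map_add, map_sum, hd,
    TensorProduct.tmul_zero, zero_add, Finset.sum_add_distrib, hdelta, add_zero,
    d_polyAct h h' h h']
  exact add_self_eq_zero_of_charTwo k _

/-- The complex `J ⊗_S N = Λ ⊗ N`. -/
abbrev inducedComplex : CochainComplex (ModuleCat.{u} Λ) ℤ where
  X n := ModuleCat.of Λ (Λ ⊗[k] N.X.X n)
  d n m := if h : n + 1 = m then ModuleCat.ofHom (inducedD z N h) else 0
  shape _ _ h := dif_neg h
  d_comp_d' n m l (h : n + 1 = m) (h' : m + 1 = l) := by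
    rw [dif_pos h, dif_pos h', ← ModuleCat.ofHom_comp, inducedD_comp_inducedD N hz h h']
    rfl

lemma inducedComplex_d {n m : ℤ} (h : n + 1 = m) :
    (inducedComplex N hz).d n m = ModuleCat.ofHom (inducedD z N h) :=
  dif_pos h

variable {N}

/-- For `v ∈ N^q`, the map `J ⟶ J ⊗_S N` of degree `q` which sends `a ⊗ s` to `a ⊗ s v`. -/
def inducedUnitCochain (q : ℤ) :
    N.X.X q →ₗ[k] Cochain (bggJ (k := k) z hz) (inducedComplex N hz) q where
  toFun v := Cochain.mk fun p _ h =>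
    ModuleCat.ofHom (((polyAct ((add_comm q p).trans h)).flip v).baseChange Λ)
  map_add' v w := Cochain.ext _ _ fun _ _ _ => hom_ext_one_tmul fun s =>
    (congrArg (TensorProduct.tmul k (1 : Λ)) (map_add (polyAct _ s) v w)).trans
      (TensorProduct.tmul_add _ _ _)
  map_smul' c v := Cochain.ext _ _ fun _ _ _ => hom_ext_one_tmul fun s =>
    (congrArg (TensorProduct.tmul k (1 : Λ)) (map_smul (polyAct _ s) c v)).trans
      ((TensorProduct.tmul_smul _ _ _).trans (algebraMap_smul Λ c _).symm)

lemma inducedUnitCochain_v_tmul {q p n : ℤ} (h : p + q = n) (v : N.X.X q) (a : Λ)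
    (s : polyDeg k r p) : ((inducedUnitCochain hz q v).v p n h).hom (a ⊗ₜ[k] s) =
      a ⊗ₜ polyAct ((add_comm q p).trans h) s v := rfl

lemma δ_inducedUnitCochain {q q' : ℤ} (hq : q + 1 = q') (v : N.X.X q) :
    δ q q' (inducedUnitCochain hz q v) = inducedUnitCochain hz q' ((N.X.d q q').hom v) :=
  Cochain.ext _ _ fun p n h => hom_ext_one_tmul fun s => by
    have hn : p + q + 1 = n := by lia
    have hn' : p + 1 + q = n := by lia
    rw [δ_v _ _ hq _ p n h (p + q) (p + 1) (by lia) rfl, units_smul_hom' (k := k),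
      inducedComplex_d N hz hn, bggJ_d hz rfl]
    change inducedD z N hn (1 ⊗ₜ polyAct (add_comm q p) s v) +
      ((inducedUnitCochain hz q v).v (p + 1) n hn').hom (mulδ z rfl (1 ⊗ₜ[k] s)) = _
    rw [inducedD_tmul, mulδ_tmul, map_sum, d_polyAct _ ((add_comm q' p).trans h) hq hn]
    refine (add_assoc _ _ _).trans (add_eq_left.2 ?_)
    rw [← Finset.sum_add_distrib]
    refine Finset.sum_eq_zero fun i _ => ?_
    rw [inducedUnitCochain_v_tmul, polyAct_polyMul _ (add_comm q p) hn]
    exact add_self_eq_zero_of_charTwo k _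

lemma inducedUnitCochain_polyAct {p q n : ℤ} (h : q + p = n) (s : polyDeg k r p) (v : N.X.X q) :
    inducedUnitCochain hz n (polyAct h s v) =
      (zetaFun z hz s).comp (inducedUnitCochain hz q v) ((add_comm p q).trans h) :=
  Cochain.ext _ _ fun i j hij => hom_ext_one_tmul fun t => by
    rw [Cochain.comp_v _ _ ((add_comm p q).trans h) i (i + p) j rfl (by lia)]
    change (1 : Λ) ⊗ₜ polyAct _ t (polyAct h s v) = (1 : Λ) ⊗ₜ polyAct _ (polyMul _ s t) v
    rw [polyAct_polyMul _ (add_comm q i) (by lia), polyAct_comm]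

variable (N)

/-- The unit `N ⟶ Hom(J, J ⊗_S N)`. -/
def inducedUnit : N ⟶ (homJFunctor (k := k) z hz).obj (inducedComplex N hz) where
  hom :=
    { f q := ModuleCat.ofHom (inducedUnitCochain hz q)
      comm' q q' hq := ModuleCat.hom_ext (LinearMap.ext fun v => δ_inducedUnitCochain hz hq v) }
  linear p m h s := by
    obtain rfl : m = p := by lia
    rw [units_smul_cochain (k := k)]
    refine cochain_ext_apply fun q n hq v => ?_
    rw [Cochain.comp_zero_cochain_v, Cochain.zero_cochain_comp_v, Cochain.ofHom_v, Cochain.ofHom_v]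
    exact inducedUnitCochain_polyAct hz hq s v

end Induction

section Transposition

open DGModule
open scoped ModuleCat

variable {k : Type u} [Field k] [CharP k 2] {r : ℕ} {Λ : Type u} [CommRing Λ] [Algebra k Λ]
  {z : Fin r → Λ} (hz : ∀ i, z i * z i = 0) {N : DGModule (polyDG k r)}
  {M : CochainComplex (ModuleCat.{u} Λ) ℤ}

/-- Evaluation of cochains on `J` at the generator `1 ⊗ 1`. -/
def evalOne (n : ℤ) : Cochain (bggJ (k := k) z hz) M n →ₗ[k] M.X n where
  toFun f := (f.v 0 n (zero_add n)).hom ((1 : Λ) ⊗ₜ polyOne k r)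
  map_add' _ _ := by
    rw [Cochain.add_v]
    rfl
  map_smul' _ _ := by
    rw [Cochain.smul_v]
    rfl

lemma evalOne_zetaFun_comp {p n m : ℤ} (h : p + n = m) (s : polyDeg k r p)
    (f : Cochain (bggJ (k := k) z hz) M n) :
    evalOne hz m ((zetaFun z hz s).comp f h) = (f.v p m h).hom ((1 : Λ) ⊗ₜ s) := by
  change (((zetaFun z hz s).comp f h).v 0 m (zero_add m)).hom _ = _
  rw [Cochain.comp_v _ _ h 0 p m (zero_add p) h]
  exact congrArg (fun s => (f.v p m h).hom ((1 : Λ) ⊗ₜ s)) (Subtype.ext (mul_one s.1))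

lemma DGModule.IsLinear.apply_polyAct {n : ℤ}
    {c : Cochain N.X (homComplex k (bggJ (k := k) z hz) M) n}
    (hc : IsLinear N (homJ (k := k) z hz M) c) {p q i m j : ℤ} (hq : q + p = i) (hm : q + n = m)
    (hj : i + n = j) (hpm : p + m = j) (s : polyDeg k r p) (v : N.X.X q) :
    (c.v i j hj).hom (polyAct hq s v) =
      (zetaFun z hz s).comp (show Cochain _ M m from (c.v q m hm).hom v) hpm := by
  have e := Cochain.congr_v (hc p (p + n) rfl s) q j (by lia)
  rw [units_smul_cochain (k := k), Cochain.comp_v _ _ rfl q i j hq hj,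
    Cochain.comp_v _ _ (add_comm n p) q m j hm (by lia)] at e
  exact congrArg (fun f => f.hom v) e

/-- The cochain `J ⊗_S N ⟶ M` which sends `a ⊗ v` to `a c(v)(1 ⊗ 1)`. -/
def homJDesc {n : ℤ} (c : Cochain N.X (homComplex k (bggJ (k := k) z hz) M) n) :
    Cochain (inducedComplex N hz) M n :=
  Cochain.mk fun q m h => ModuleCat.ofHom
    (LinearMap.liftBaseChange Λ (evalOne hz m ∘ₗ (c.v q m h).hom))

lemma homJDesc_v_one_tmul {n : ℤ} (c : Cochain N.X (homComplex k (bggJ (k := k) z hz) M) n)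
    {q m : ℤ} (h : q + n = m) (v : N.X.X q) :
    ((homJDesc hz c).v q m h).hom ((1 : Λ) ⊗ₜ[k] v) = evalOne hz m ((c.v q m h).hom v) :=
  LinearMap.liftBaseChange_one_tmul Λ _ _

/-- The cochain `N ⟶ Hom(J, M)` obtained by composing the unit with `Hom(J, d)`. -/
def homJTranspose {n : ℤ} (d : Cochain (inducedComplex N hz) M n) :
    Cochain N.X (homComplex k (bggJ (k := k) z hz) M) n :=
  (Cochain.ofHom (inducedUnit N hz).hom).comp (postcomp _ d) (zero_add n)

lemma homJTranspose_v_apply {n : ℤ} (d : Cochain (inducedComplex N hz) M n) {q m : ℤ}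
    (h : q + n = m) (v : N.X.X q) :
    ((homJTranspose hz d).v q m h).hom v = (inducedUnitCochain hz q v).comp d h := by
  rw [homJTranspose, Cochain.zero_cochain_comp_v, Cochain.ofHom_v]
  rfl

lemma homJDesc_homJTranspose {n : ℤ} (d : Cochain (inducedComplex N hz) M n) :
    homJDesc hz (homJTranspose hz d) = d :=
  Cochain.ext _ _ fun q m h => hom_ext_one_tmul fun v => by
    rw [homJDesc_v_one_tmul, homJTranspose_v_apply]
    change (((inducedUnitCochain hz q v).comp d h).v 0 m (zero_add m)).hom _ = _
    rw [Cochain.comp_v _ _ h 0 q m (zero_add q) h]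
    exact congrArg (fun v => (d.v q m h).hom ((1 : Λ) ⊗ₜ v)) (polyAct_polyOne _ v)

lemma homJTranspose_homJDesc {n : ℤ} {c : Cochain N.X (homComplex k (bggJ (k := k) z hz) M) n}
    (hc : IsLinear N (homJ (k := k) z hz M) c) : homJTranspose hz (homJDesc hz c) = c := by
  refine cochain_ext_apply fun q m h v => (homJTranspose_v_apply hz _ h v).trans ?_
  refine Cochain.ext _ _ fun i j hij => hom_ext_one_tmul fun s => ?_
  have hj : i + q + n = j := by lia
  rw [Cochain.comp_v _ _ h i (i + q) j rfl hj]
  exact (homJDesc_v_one_tmul hz c hj (polyAct (add_comm q i) s v)).trans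
    ((congrArg _ (hc.apply_polyAct hz (add_comm q i) h hj hij s v)).trans
      (evalOne_zetaFun_comp hz hij s _))

lemma homJTranspose_injective (n : ℤ) :
    Function.Injective (homJTranspose hz : Cochain (inducedComplex N hz) M n → _) :=
  Function.LeftInverse.injective (homJDesc_homJTranspose hz)

lemma homJTranspose_add {n : ℤ} (d d' : Cochain (inducedComplex N hz) M n) :
    homJTranspose hz (d + d') = homJTranspose hz d + homJTranspose hz d' := by
  rw [homJTranspose, postcomp_add, Cochain.comp_add]
  rfl

lemma δ_homJTranspose {n m : ℤ} (h : n + 1 = m) (d : Cochain (inducedComplex N hz) M n) :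
    δ n m (homJTranspose hz d) = homJTranspose hz (δ n m d) := by
  rw [homJTranspose, δ_ofHom_comp, δ_postcomp h]
  rfl

lemma homJTranspose_ofHom (f : inducedComplex N hz ⟶ M) :
    homJTranspose hz (Cochain.ofHom f) =
      Cochain.ofHom (inducedUnit N hz ≫ (homJFunctor (k := k) z hz).map f).hom := by
  rw [homJTranspose, comp_hom, Cochain.ofHom_comp, ← ofHom_homComplexMap]

lemma exists_inducedUnit_comp_eq (g : N ⟶ (homJFunctor (k := k) z hz).obj M) :
    ∃ f : inducedComplex N hz ⟶ M, inducedUnit N hz ≫ (homJFunctor (k := k) z hz).map f = g := by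
  have hg := homJTranspose_homJDesc hz g.linear
  have hd : δ 0 1 (homJDesc hz (Cochain.ofHom g.hom)) = 0 := by
    refine homJTranspose_injective hz 1 ?_
    rw [← δ_homJTranspose hz (zero_add 1), hg, δ_ofHom, homJTranspose, postcomp_zero,
      Cochain.comp_zero]
  refine ⟨Cocycle.homOf (Cocycle.mk _ 1 (zero_add 1) hd), hom_ext (Cochain.ofHom_injective ?_)⟩
  rw [← homJTranspose_ofHom, Cocycle.cochain_ofHom_homOf_eq_coe]
  exact hg

lemma nonempty_homotopy_of_homotopic_inducedUnit_comp {f f' : inducedComplex N hz ⟶ M}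
    (h : homotopic _ (inducedUnit N hz ≫ (homJFunctor (k := k) z hz).map f)
      (inducedUnit N hz ≫ (homJFunctor (k := k) z hz).map f')) : Nonempty (Homotopy f f') := by
  obtain ⟨c, hc, e⟩ := h
  refine ⟨(Cochain.equivHomotopy _ _).symm ⟨homJDesc hz c, homJTranspose_injective hz 0 ?_⟩⟩
  rw [homJTranspose_add, ← δ_homJTranspose hz (neg_add_cancel 1), homJTranspose_homJDesc hz hc,
    homJTranspose_ofHom, homJTranspose_ofHom, e]

end Transposition

section Localization

variable {C D : Type*} [Category C] [Category D] {H : C ⥤ D} (W : MorphismProperty D)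
  [W.HasTwoOutOfThreeProperty] [W.ContainsIdentities]

lemma isEquivalence_comp_Q_of_adjunction {L : D ⥤ C} (adj : L ⊣ H)
    (hunit : ∀ N, W (adj.unit.app N)) (hH : ∀ {X Y : C} (f : X ⟶ Y), W (H.map f) → IsIso f) :
    (H ⋙ W.Q).IsEquivalence := by
  have hcounit (Y : C) : IsIso (adj.counit.app Y) := hH _ <|
    W.of_precomp _ _ (hunit (H.obj Y)) (adj.right_triangle_components Y ▸ W.id_mem _)
  have : IsIso adj.counit := NatIso.isIso_of_isIso_app _
  have : H.Full := adj.fullyFaithfulROfIsIsoCounit.full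
  have : H.Faithful := adj.fullyFaithfulROfIsIsoCounit.faithful
  have hL : W.IsInvertedBy L := fun X Y f hf => hH _ <|
    W.of_precomp _ _ (hunit X) (adj.unit_naturality f ▸ W.comp_mem _ _ hf (hunit Y))
  have : L.IsLocalization W := adj.isLocalization_leftAdjoint W hL hunit
  let uniq := (Localization.uniq W.Q L W).functor
  let e : (H ⋙ W.Q) ⋙ uniq ≅ 𝟭 C :=
    Functor.isoWhiskerLeft H (Localization.compUniqFunctor W.Q L W) ≪≫ asIso adj.counit
  have : ((H ⋙ W.Q) ⋙ uniq).IsEquivalence := Functor.isEquivalence_of_iso e.symm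
  exact Functor.isEquivalence_of_comp_right _ uniq

lemma isEquivalence_comp_Q_of_universal {F : D → C} (η : ∀ N, N ⟶ H.obj (F N))
    (hη : ∀ (N : D) (Y : C), Function.Bijective fun f : F N ⟶ Y => η N ≫ H.map f)
    (hW : ∀ N, W (η N)) (hH : ∀ {X Y : C} (f : X ⟶ Y), W (H.map f) → IsIso f) :
    (H ⋙ W.Q).IsEquivalence := by
  let adj := Adjunction.adjunctionOfEquivLeft
    (fun N Y => Equiv.ofBijective _ (hη N Y)) (fun N Y Y' g h => by simp)
  have hunit (N : D) : adj.unit.app N = η N := by simp [adj, Adjunction.adjunctionOfEquivLeft]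
  exact isEquivalence_comp_Q_of_adjunction W adj (fun N => (hunit N).symm ▸ hW N) hH

end Localization

section Equivalence

open DGModule
open scoped ModuleCat

instance {k : Type u} [Field k] : (HomotopyCategory.quasiIso (ModuleCat.{u} k)
    (ComplexShape.up ℤ)).HasTwoOutOfThreeProperty where
  of_precomp f g hf hg n :=
    (MorphismProperty.isomorphisms (ModuleCat.{u} k)).of_precomp _ _ (hf n)
      ((HomotopyCategory.homologyFunctor _ _ n).map_comp f g ▸ hg n)
  of_postcomp f g hf hg n :=
    (MorphismProperty.isomorphisms (ModuleCat.{u} k)).of_postcomp _ _ (hf n)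
      ((HomotopyCategory.homologyFunctor _ _ n).map_comp f g ▸ hg n)

instance {k : Type u} [Field k] (A : DGAlgebra k) : (quasiIso A).HasTwoOutOfThreeProperty := by
  unfold quasiIso; infer_instance

instance {k : Type u} [Field k] (A : DGAlgebra k) : (quasiIso A).ContainsIdentities := by
  rw [quasiIso_eq]; infer_instance

variable {k Λ : Type u} [Field k] [CommRing Λ] [Algebra k Λ] {r : ℕ} {z : Fin r → Λ}
  {b : Module.Basis (Finset (Fin r)) k Λ}

namespace IsSquareFreeBasis

lemma bijective_univ_tmul (hb : IsSquareFreeBasis z b) (V : Type*) [AddCommGroup V] [Module k V] :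
    Function.Bijective fun v : V =>
      (⟨b Finset.univ ⊗ₜ v, hb.univ_tmul_mem_socle v⟩ : socle z (Λ ⊗[k] V)) :=
  ⟨fun v w h => by
    simpa only [topCoord_univ_tmul] using congrArg (topCoord b V) (congrArg Subtype.val h),
  fun x => ⟨_, Subtype.ext (hb.eq_univ_tmul_topCoord x.2).symm⟩⟩

lemma injective_of_tensor (hb : IsSquareFreeBasis z b) (V : Type u) [AddCommGroup V] [Module k V] :
    Injective (ModuleCat.of Λ (Λ ⊗[k] V)) :=
  have := Module.injective_of_isSemisimpleRing k V
  (Module.injective_iff_injective_object Λ _).1 (hb.injective_tensor V)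

end IsSquareFreeBasis

variable [CharP k 2] (hb : IsSquareFreeBasis z b)

lemma quasiIso_of_bijective_comp_evalSocle {X : CochainComplex (ModuleCat.{u} k) ℤ}
    {M : CochainComplex (ModuleCat.{u} Λ) ℤ} [∀ n, Injective (M.X n)]
    (φ : X ⟶ homComplex k (bggJ (k := k) z hb.mul_self) M)
    (hφ : ∀ n, Function.Bijective ((φ ≫ evalSocle hb M).f n)) : QuasiIso φ := by
  have (n : ℤ) : IsIso ((φ ≫ evalSocle hb M).f n) :=
    (ConcreteCategory.isIso_iff_bijective _).2 (hφ n)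
  have : IsIso (φ ≫ evalSocle hb M) := HomologicalComplex.Hom.isIso_of_components _
  have := quasiIso_evalSocle hb (M := M)
  exact quasiIso_of_comp_right φ (evalSocle hb M)

lemma quasiIso_inducedUnit (N : DGModule (polyDG k r)) :
    QuasiIso (inducedUnit N hb.mul_self).hom := by
  have (n : ℤ) : Injective ((inducedComplex N hb.mul_self).X n) := hb.injective_of_tensor _
  refine quasiIso_of_bijective_comp_evalSocle hb _ fun n => ?_
  have h (v : N.X.X n) : (evalSocle hb _).f n ((inducedUnit N hb.mul_self).hom.f n v) =
      ⟨b Finset.univ ⊗ₜ v, hb.univ_tmul_mem_socle v⟩ :=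
    Subtype.ext (congrArg (b Finset.univ ⊗ₜ[k] ·) (polyAct_polyOne _ v))
  exact (congrArg Function.Bijective (funext h)).mpr (hb.bijective_univ_tmul (N.X.X n))

lemma quasiIso_zeta : QuasiIso (zeta (k := k) z hb.mul_self).hom := by
  have (n : ℤ) : Injective ((bggJ (k := k) z hb.mul_self).X n) := hb.injective_of_tensor _
  refine quasiIso_of_bijective_comp_evalSocle hb _ fun n => ?_
  have h (s : polyDeg k r n) :
      (evalSocle hb _).f n ((zeta (k := k) z hb.mul_self).hom.f n s) =
        ⟨b Finset.univ ⊗ₜ s, hb.univ_tmul_mem_socle s⟩ :=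
    Subtype.ext (congrArg (b Finset.univ ⊗ₜ[k] ·) (Subtype.ext (mul_one s.1)))
  exact (congrArg Function.Bijective (funext h)).mpr (hb.bijective_univ_tmul (polyDeg k r n))

variable (z) in
/-- `Hom(J, -)` between homotopy categories, before passing to `D(S)`. -/
abbrev homJInjHtpy (hz : ∀ i, z i * z i = 0) :
    HomotopyCategory (InjectiveObject (ModuleCat.{u} Λ)) (ComplexShape.up ℤ) ⥤
      HtpyCat (polyDG k r) :=
  (InjectiveObject.ι (ModuleCat.{u} Λ)).mapHomotopyCategory (ComplexShape.up ℤ) ⋙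
    homJHtpy (k := k) z hz

lemma isZero_of_acyclic_homJ
    {M : HomotopyCategory (InjectiveObject (ModuleCat.{u} Λ)) (ComplexShape.up ℤ)}
    (hM : (HomotopyCategory.subcategoryAcyclic (ModuleCat.{u} k)).inverseImage
      (htpyForget (polyDG k r)) ((homJInjHtpy (k := k) z hb.mul_self).obj M)) : IsZero M := by
  obtain ⟨M⟩ := M
  let ι := (InjectiveObject.ι (ModuleCat.{u} Λ)).mapHomologicalComplex (ComplexShape.up ℤ)
  have (n : ℤ) : Injective ((ι.obj M).X n) := (M.X n).2
  obtain ⟨H⟩ := nonempty_homotopy_id_zero_of_acyclic_homComplex hb (M := ι.obj M)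
    ((HomotopyCategory.quotient_obj_mem_subcategoryAcyclic_iff_acyclic _).1 hM)
  exact (HomotopyCategory.isZero_quotient_obj_iff M).2
    ⟨(InjectiveObject.ι (ModuleCat.{u} Λ)).preimageHomotopy
      ((Homotopy.ofEq (ι.map_id M)).trans (H.trans (Homotopy.ofEq (ι.map_zero M M).symm)))⟩

lemma isIso_of_quasiIso_homJInjHtpy_map
    {M N : HomotopyCategory (InjectiveObject (ModuleCat.{u} Λ)) (ComplexShape.up ℤ)} (f : M ⟶ N)
    (hf : quasiIso (polyDG k r) ((homJInjHtpy (k := k) z hb.mul_self).map f)) : IsIso f := by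
  obtain ⟨P, g, h, hT⟩ := Pretriangulated.distinguished_cocone_triangle f
  rw [quasiIso_eq] at hf
  have hP := (ObjectProperty.trW_iff_of_distinguished _ _
    ((homJInjHtpy (k := k) z hb.mul_self).map_distinguished _ hT)).1 hf
  exact (Triangle.isZero₃_iff_isIso₁ _ hT).1 (isZero_of_acyclic_homJ hb hP)

variable (N : DGModule (polyDG k r))

/-- `J ⊗_S N` as a complex of injective modules. -/
abbrev inducedInj : CochainComplex (InjectiveObject (ModuleCat.{u} Λ)) ℤ where
  X n := ⟨(inducedComplex N hb.mul_self).X n, hb.injective_of_tensor _⟩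
  d n m := ObjectProperty.homMk ((inducedComplex N hb.mul_self).d n m)
  shape n m h := ObjectProperty.hom_ext _ ((inducedComplex N hb.mul_self).shape n m h)
  d_comp_d' n m l _ _ := ObjectProperty.hom_ext _ ((inducedComplex N hb.mul_self).d_comp_d n m l)

/-- The unit `N ⟶ Hom(J, J ⊗_S N)` in the homotopy category. -/
abbrev inducedUnitHtpy : (htpyQuotient _).obj N ⟶ (homJInjHtpy (k := k) z hb.mul_self).obj
    ((HomotopyCategory.quotient _ _).obj (inducedInj hb N)) :=
  (htpyQuotient _).map (inducedUnit N hb.mul_self)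

lemma bijective_inducedUnitHtpy_comp
    (Y : HomotopyCategory (InjectiveObject (ModuleCat.{u} Λ)) (ComplexShape.up ℤ)) :
    Function.Bijective fun f : (HomotopyCategory.quotient _ _).obj (inducedInj hb N) ⟶ Y =>
      inducedUnitHtpy hb N ≫ (homJInjHtpy (k := k) z hb.mul_self).map f := by
  obtain ⟨M⟩ := Y
  let ι := (InjectiveObject.ι (ModuleCat.{u} Λ)).mapHomologicalComplex (ComplexShape.up ℤ)
  constructor
  · intro f f' h
    obtain ⟨f, rfl⟩ := (HomotopyCategory.quotient _ _).map_surjective f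
    obtain ⟨f', rfl⟩ := (HomotopyCategory.quotient _ _).map_surjective f'
    obtain ⟨H⟩ := nonempty_homotopy_of_homotopic_inducedUnit_comp (M := ι.obj M) hb.mul_self
      (f := ι.map f) (f' := ι.map f') (homotopic_of_map_eq
        (((htpyQuotient _).map_comp _ _).trans (h.trans ((htpyQuotient _).map_comp _ _).symm)))
    exact HomotopyCategory.eq_of_homotopy _ _
      ((InjectiveObject.ι (ModuleCat.{u} Λ)).preimageHomotopy H)
  · intro g
    obtain ⟨g, rfl⟩ := (htpyQuotient _).map_surjective
      (Y := (homJFunctor (k := k) z hb.mul_self).obj (ι.obj M)) g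
    obtain ⟨f, hf⟩ := exists_inducedUnit_comp_eq (M := ι.obj M) hb.mul_self g
    obtain ⟨f, rfl⟩ := ι.map_surjective (X := inducedInj hb N) (Y := M) f
    exact ⟨(HomotopyCategory.quotient _ _).map f,
      ((htpyQuotient _).map_comp _ _).symm.trans (congrArg _ hf)⟩

include hb in
lemma homJInj_isEquivalence : (homJInj (k := k) z hb.mul_self).IsEquivalence :=
  isEquivalence_comp_Q_of_universal (H := homJInjHtpy (k := k) z hb.mul_self)
    (quasiIso (polyDG k r)) (fun N => inducedUnitHtpy hb N.as)
    (fun N Y => bijective_inducedUnitHtpy_comp hb N.as Y)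
    (fun N => (HomotopyCategory.quotient_map_mem_quasiIso_iff _).2 (quasiIso_inducedUnit hb N.as))
    (isIso_of_quasiIso_homJInjHtpy_map hb)

theorem mainTheorem4_general (k : Type u) [Field k] [CharP k 2] {Λ : Type u} [CommRing Λ]
    [Algebra k Λ] {r : ℕ} {z : Fin r → Λ} {b : Module.Basis (Finset (Fin r)) k Λ}
    (hb : IsSquareFreeBasis z b) :
    QuasiIso (zeta (k := k) z hb.mul_self).hom ∧
    (homJInj (k := k) z hb.mul_self).IsTriangulated ∧
    (homJInj (k := k) z hb.mul_self).IsEquivalence :=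
  ⟨quasiIso_zeta hb, inferInstance, homJInj_isEquivalence hb⟩

end Equivalence

end

theorem mainTheorem4 (k : Type u) [Field k] [CharP k 2] (r : ℕ) (E : Type u) [CommGroup E]
    (hE : ∀ a : E, a ^ 2 = 1) (hcard : Nat.card E = 2 ^ r) (g : Fin r → E)
    (hg : Subgroup.closure (Set.range g) = ⊤) :
    QuasiIso (zeta (k := k) (groupZ k g) (groupZ_mul_self k hE g)).hom ∧
    (homJInj (k := k) (groupZ k g) (groupZ_mul_self k hE g)).IsTriangulated ∧
    (homJInj (k := k) (groupZ k g) (groupZ_mul_self k hE g)).IsEquivalence :=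
  have ⟨_, hb⟩ := exists_isSquareFreeBasis_groupZ k hE hcard hg
  mainTheorem4_general k hb
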